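/- Let $\lambda,\mu\ge 0$, $\beta>0$, $g(w)=\sqrt{\beta/2\pi}\,e^{-\beta w^2/2}$. For $N\ge 2$ and a function $f$ on $\mathbb R^N$ put $$Q[f](\mathbf v)=\binom N2^{-1}\sum_{i<j}\frac1{2\pi}\int_0^{2\pi} f(\dots,v_i\cos\theta+v_j\sin\theta,\dots,-v_i\sin\theta+v_j\cos\theta,\dots)\,d\theta,$$ $$R_j[f](\mathbf v)=\int dw\,\frac1{2\pi}\int_0^{2\pi} d\theta\; g(-v_j\sin\theta+w\cos\theta)\,f(v_1,\dots,v_j\cos\theta+w\sin\theta,\dots,v_N).$$ Let $f^{(N)}_t$, $t\ge 0$, be the solution in $L^1(\mathbb R^N)$ of the master equation $$\partial_t f=-\lambda N(I-Q)[f]-\mu\sum_{j=1}^N(I-R_j)[f],$$ whose initial values $f_0^{(N)}$ are probability densities, symmetric under permutations of $v_1,\dots,v_N$, and form a chaotic sequence: for every $k\ge1$ the $k$-particle marginals of $f_0^{(N)}$ and the $k$-fold products of its one-particle marginals have, as $N\to\infty$, the same weak limit (tested against bounded continuous functions). Suppose that the weak limit of the one-particle marginals of $f^{(N)}_0$ is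 a function $\bar f_0\in L^1(\mathbb R)$. Then for every $t\ge0$ the one-particle marginals $\int f^{(N)}_t(v,v_2,\dots,v_N)\,dv_2\cdots dv_N$ converge weakly, as $N\to\infty$, to a probability density $\bar f_t$ on $\mathbb R$, and $\bar f_t$ is the solution of the Boltzmann equation $$\frac{\partial \bar f_t(v)}{\partial t}=2\lambda \frac1{2\pi}\int_0^{2\pi} d\theta\int dw\,\big[\bar f_t(v\cos\theta+w\sin\theta)\bar f_t(-v\sin\theta+w\cos\theta)-\bar f_t(v)\bar f_t(w)\big]$$ $$\qquad+\mu\Big[\int dw\,\frac1{2\pi}\int_0^{2\pi} d\theta\; g(-v\sin\theta+w\cos\theta)\,\bar f_t(v\cos\theta+w\sin\theta)-\bar f_t(v)\Big]$$ with initial condition $\bar f_0$. Here "the solution" means: the equation holds for all $t\ge 0$ with the time derivative taken in $L^1(\mathbb R)$; $\bar f_t$ is the only such curve in $L^1(\mathbb R)$ starting from $\bar f_0$; and there are representatives of the $\bar f_t$ for which, for almost every $v$, the equation holds pointwise for all $t\ge 0$. (At $t=0$ derivatives are one-sided.) -/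

import Mathlib

open MeasureTheory Filter Topology Real
open scoped BoundedContinuousFunction

noncomputable section

namespace KacThermostat

/-- The Gaussian density `g` at inverse temperature `β`. -/
def gauss (β w : ℝ) : ℝ := √(β / (2 * π)) * exp (-(β / 2) * w ^ 2)

/-- The velocities after particles `i` and `j` collide with scattering angle `θ`. -/
def collide {N : ℕ} (v : Fin N → ℝ) (i j : Fin N) (θ : ℝ) : Fin N → ℝ :=
  Function.update
    (Function.update v i (v i * cos θ + v j * sin θ)) j (-v i * sin θ + v j * cos θ)

/-- The velocities after particle `j` collides with a thermostat particle of velocity `w`. -/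
def thermalize {N : ℕ} (v : Fin N → ℝ) (j : Fin N) (θ w : ℝ) : Fin N → ℝ :=
  Function.update v j (v j * cos θ + w * sin θ)

/-- The Kac operator `Q`: average over all pairs `i < j` and all angles. -/
def kacQ {N : ℕ} (f : (Fin N → ℝ) → ℝ) (v : Fin N → ℝ) : ℝ :=
  1 / (N.choose 2 : ℝ) *
    ∑ i : Fin N, ∑ j ∈ Finset.Ioi i, ⨍ θ in (0 : ℝ)..(2 * π), f (collide v i j θ)

/-- The thermostat operator `R_j`. -/
def thermR {N : ℕ} (β : ℝ) (j : Fin N) (f : (Fin N → ℝ) → ℝ) (v : Fin N → ℝ) : ℝ :=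
  ∫ w : ℝ, ⨍ θ in (0 : ℝ)..(2 * π),
    gauss β (-v j * sin θ + w * cos θ) * f (thermalize v j θ w)

/-- The right-hand side `-λ N (I - Q)[f] - μ ∑ j, (I - R_j)[f]` of the master equation. -/
def masterRHS {N : ℕ} (lam mu β : ℝ) (f : (Fin N → ℝ) → ℝ) (v : Fin N → ℝ) : ℝ :=
  -(lam * N * (f v - kacQ f v)) - mu * ∑ j : Fin N, (f v - thermR β j f v)

/-- `f` solves the master equation on `[0, ∞)`, the time derivative being taken in `L¹(ℝ^N)`
(one-sided at `t = 0`). -/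
def IsMasterSolution {N : ℕ} (lam mu β : ℝ) (f : ℝ → (Fin N → ℝ) →₁[volume] ℝ) : Prop :=
  ∀ t : ℝ, 0 ≤ t → ∃ D : (Fin N → ℝ) →₁[volume] ℝ,
    HasDerivWithinAt f D (Set.Ici 0) t ∧ D =ᵐ[volume] masterRHS lam mu β (f t)

/-- Probability densities with respect to Lebesgue measure. -/
def IsProbDensity {E : Type*} [MeasureSpace E] (f : E → ℝ) : Prop :=
  Integrable f volume ∧ 0 ≤ᵐ[volume] f ∧ ∫ x, f x = 1

/-- Invariance under relabelling of the particles. -/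
def IsSymmetric {N : ℕ} (f : (Fin N → ℝ) → ℝ) : Prop :=
  ∀ σ : Equiv.Perm (Fin N), (fun v => f (fun i => v (σ i))) =ᵐ[volume] f

/-- The `k`-particle marginal (`k ≤ N`): the variables `v_{k+1}, …, v_N` are integrated out. -/
def marginal {N : ℕ} (k : ℕ) (f : (Fin N → ℝ) → ℝ) (x : Fin k → ℝ) : ℝ :=
  ∫ y : Fin (N - k) → ℝ,
    f (fun i => if hi : i.1 < k then x ⟨i.1, hi⟩ else y ⟨i.1 - k, by omega⟩)

/-- The one-particle marginal as a function on `ℝ`. -/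
def marginalOne {N : ℕ} (f : (Fin N → ℝ) → ℝ) (v : ℝ) : ℝ := marginal 1 f (fun _ => v)

/-- Chaotic sequences: for every `k ≥ 1` the `k`-particle marginals and the `k`-fold products of
the one-particle marginals have the same weak limit, weak meaning tested against bounded
continuous functions. -/
def IsChaotic (f : ∀ N : ℕ, (Fin N → ℝ) → ℝ) : Prop :=
  ∀ k : ℕ, 1 ≤ k → ∀ φ : (Fin k → ℝ) →ᵇ ℝ, ∃ l : ℝ,
    Tendsto (fun N => ∫ x, φ x * marginal k (f N) x) atTop (𝓝 l) ∧
    Tendsto (fun N => ∫ x, φ x * ∏ j, marginalOne (f N) (x j)) atTop (𝓝 l)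

/-- Weak convergence of a sequence of functions on `ℝ`, tested against bounded continuous
functions. -/
def WeakTendsto (u : ℕ → ℝ → ℝ) (u' : ℝ → ℝ) : Prop :=
  ∀ φ : ℝ →ᵇ ℝ, Tendsto (fun N => ∫ v, φ v * u N v) atTop (𝓝 (∫ v, φ v * u' v))

/-- The right-hand side of the Boltzmann equation. -/
def boltzmannRHS (lam mu β : ℝ) (f : ℝ → ℝ) (v : ℝ) : ℝ :=
  2 * lam * (⨍ θ in (0 : ℝ)..(2 * π), ∫ w : ℝ,
      (f (v * cos θ + w * sin θ) * f (-v * sin θ + w * cos θ) - f v * f w)) +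
    mu * ((∫ w : ℝ, ⨍ θ in (0 : ℝ)..(2 * π),
      gauss β (-v * sin θ + w * cos θ) * f (v * cos θ + w * sin θ)) - f v)

/-- `F` solves the Boltzmann equation on `[0, ∞)` with initial condition `f₀`, the time derivative
being taken in `L¹(ℝ)` (one-sided at `t = 0`). -/
def IsBoltzmannSolution (lam mu β : ℝ) (f₀ : ℝ → ℝ) (F : ℝ → ℝ →₁[volume] ℝ) : Prop :=
  F 0 =ᵐ[volume] f₀ ∧
  ∀ t : ℝ, 0 ≤ t → ∃ D : ℝ →₁[volume] ℝ,
    HasDerivWithinAt F D (Set.Ici 0) t ∧ D =ᵐ[volume] boltzmannRHS lam mu β (F t)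

/-- `f` is a choice of representatives of `F` that satisfies the Boltzmann equation pointwise:
for almost every `v`, classically in `t` for all `t ≥ 0`. -/
def IsPointwiseSolution (lam mu β : ℝ) (F : ℝ → ℝ →₁[volume] ℝ) (f : ℝ → ℝ → ℝ) : Prop :=
  (∀ t : ℝ, 0 ≤ t → f t =ᵐ[volume] F t) ∧
  ∀ᵐ v : ℝ, ∀ t : ℝ, 0 ≤ t →
    HasDerivWithinAt (fun s => f s v) (boltzmannRHS lam mu β (f t) v) (Set.Ici 0) t

end KacThermostat

end

open MeasureTheory Filter Topology Real
open scoped BoundedContinuousFunction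

noncomputable section

namespace KacThermostat

/-! The argument is dual: densities are tested against bounded continuous functions φ of the first k
velocities, and the collisions are moved onto φ. In the N-particle generator, collisions among
particles beyond the k-th do not affect φ. Collisions of one of the first k particles with a later
one all contribute equally, by exchange symmetry, and yield a test function of k + 1 velocities.
Collisions inside the first k are too few to matter. Each pair collides at rate λN divided by the
number of pairs, which is 2λ/(N - 1), and a given particle has about N partners; this is the origin
of the factor 2λ. With α = 2λ + μ, the quantity ⟨φ⟩ therefore satisfies ⟨φ⟩' = ⟨Γφ⟩ - αk⟨φ⟩ up to an
error of order k²/N, where Γφ depends on k + 1 velocities and ‖Γφ‖ ≤ αk‖φ‖ (`hierarchy_error`,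
`norm_gainTest_le`). Tensor powers of a solution of the Boltzmann equation with unit mass satisfy
the same hierarchy without error (`hasDerivAt_pair_tpow`).

The difference of the two families is bounded by 2‖φ‖ and, by chaos, vanishes at time 0 in the
limit. Iterating Duhamel's formula n times leaves a remainder governed by the rates αk, which are
the birth rates of a Yule process started from k particles. The remainder is at most 2‖φ‖ times a
Chernoff bound for the probability of n births before time t. It decays geometrically in n for every
fixed t, so no short-time restriction appears and no restarting is needed
(`tendsto_zero_of_hierarchy`).

The limit equation is solved by a Wild sum. Its linear terms become bilinear on multiplication by
the mass of the second argument, and a fictitious collision of rate one that changes nothing keeps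
the total rate positive. The equation then reads x' = r(H(x, x) - x), where H maps pairs of
densities to densities, and x(t) = e^(-rt) y(1 - e^(-rt)) with y a power series solving y' = H(y,
y). All coefficients of y are densities. This gives convergence in L¹, positivity and unit mass,
and, because the terms are nonnegative, convergence at almost every v for all times at once; hence
the pointwise form of the equation (`isPointwiseSolution_boltzPt`). Uniqueness holds because a
quadratic vector field is Lipschitz on balls (`eq_of_quadratic_ode`). -/

/-- The uniform probability measure on the scattering angles. -/
def angleMeasure : Measure ℝ :=
  (volume.restrict (Set.uIoc 0 (2 * π)) Set.univ)⁻¹ • volume.restrict (Set.uIoc 0 (2 * π))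

instance : IsProbabilityMeasure angleMeasure := by
  have h1 : volume.restrict (Set.uIoc 0 (2 * π)) Set.univ ≠ 0 := by
    simp
  have h2 : volume.restrict (Set.uIoc 0 (2 * π)) Set.univ ≠ ⊤ := by
    simp [ENNReal.mul_eq_top]
  refine ⟨?_⟩
  rw [angleMeasure, Measure.smul_apply, smul_eq_mul]
  exact ENNReal.inv_mul_cancel h1 h2

lemma intervalAverage_eq (h : ℝ → ℝ) :
    ⨍ θ in (0 : ℝ)..(2 * π), h θ = ∫ θ, h θ ∂angleMeasure := rfl

lemma integral_angle_neg {h : ℝ → ℝ} (hh : Function.Periodic h (2 * π)) :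
    ∫ θ, h (-θ) ∂angleMeasure = ∫ θ, h θ ∂angleMeasure := by
  rw [← intervalAverage_eq, ← intervalAverage_eq, interval_average_eq, interval_average_eq,
    intervalIntegral.integral_comp_neg]
  congr 1
  have := hh.intervalIntegral_add_eq (-(2 * π)) 0
  simpa using this

/-! ### Volume preserving flows and averages over the angle -/

/-- A measurable family of volume preserving maps indexed by angles, `T (-θ)` being the inverse
of `T θ`. -/
structure IsFlow {E : Type*} [MeasureSpace E] (T : ℝ → E → E) : Prop where
  measurable : Measurable fun p : E × ℝ => T p.2 p.1
  preserving : ∀ θ, MeasurePreserving (T θ) volume volume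
  inv : ∀ θ v, T (-θ) (T θ v) = v

/-- The average of `f` over the orbits of a flow. -/
def avg {E : Type*} (T : ℝ → E → E) (f : E → ℝ) (v : E) : ℝ := ∫ θ, f (T θ v) ∂angleMeasure

lemma avg_smul {E : Type*} (T : ℝ → E → E) (c : ℝ) (f : E → ℝ) : avg T (c • f) = c • avg T f := by
  ext v
  exact integral_const_mul _ _

section flow

variable {E : Type*} [MeasureSpace E] [SigmaFinite (volume : Measure E)] {T : ℝ → E → E}

/-- Every slice preserves volume, hence so does the skew product. This is the source of the joint
integrability of `f (T θ v)` and of the fact that null sets stay null along almost every orbit. -/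
lemma IsFlow.preserving_skew (hT : IsFlow T) :
    MeasurePreserving (fun p : E × ℝ => (T p.2 p.1, p.2))
      ((volume : Measure E).prod angleMeasure) ((volume : Measure E).prod angleMeasure) := by
  have h := (MeasurePreserving.id angleMeasure).skew_product (μc := (volume : Measure E))
    (μd := volume) (g := fun θ v => T θ v) (hT.measurable.comp measurable_swap)
    (ae_of_all _ fun θ => (hT.preserving θ).map_eq)
  exact (Measure.measurePreserving_swap.comp h).comp Measure.measurePreserving_swap

lemma IsFlow.integrable_prod (hT : IsFlow T) {f : E → ℝ} (hf : Integrable f) :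
    Integrable (fun p : E × ℝ => f (T p.2 p.1)) ((volume : Measure E).prod angleMeasure) := by
  have := (hT.preserving_skew).integrable_comp_of_integrable (hf.comp_fst angleMeasure)
  exact this

lemma IsFlow.integrable_avg (hT : IsFlow T) {f : E → ℝ} (hf : Integrable f) :
    Integrable (avg T f) :=
  (hT.integrable_prod hf).integral_prod_left

lemma IsFlow.integrable_ae (hT : IsFlow T) {f : E → ℝ} (hf : Integrable f) :
    ∀ᵐ v : E, Integrable (fun θ => f (T θ v)) angleMeasure :=
  (hT.integrable_prod hf).prod_right_ae

lemma IsFlow.ae_of_ae (hT : IsFlow T) {p : E → Prop} (h : ∀ᵐ v, p v) :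
    ∀ᵐ v, ∀ᵐ θ ∂angleMeasure, p (T θ v) := by
  have h1 : ∀ᵐ q : E × ℝ ∂((volume : Measure E).prod angleMeasure), p q.1 :=
    Measure.quasiMeasurePreserving_fst.ae h
  exact Measure.ae_ae_of_ae_prod (hT.preserving_skew.quasiMeasurePreserving.ae h1)

lemma IsFlow.avg_congr (hT : IsFlow T) {f g : E → ℝ} (h : f =ᵐ[volume] g) :
    avg T f =ᵐ[volume] avg T g := by
  filter_upwards [hT.ae_of_ae h] with v hv
  exact integral_congr_ae hv

lemma IsFlow.avg_add (hT : IsFlow T) {f g : E → ℝ} (hf : Integrable f) (hg : Integrable g) :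
    avg T (f + g) =ᵐ[volume] avg T f + avg T g := by
  filter_upwards [hT.integrable_ae hf, hT.integrable_ae hg] with v h1 h2
  exact integral_add h1 h2

/-- The adjoint of `avg T`. -/
def avgDual (T : ℝ → E → E) (ψ : E → ℝ) (v : E) : ℝ := ∫ θ, ψ (T (-θ) v) ∂angleMeasure

/-- Fubini brings the angle outside, and at fixed θ the substitution of `T θ v` for `v` moves the
flow from `f` to `ψ`. Boundedness of `ψ` makes both double integrals absolutely convergent. All
later duality formulas rest on this one. -/
lemma IsFlow.integral_mul_avg (hT : IsFlow T) {f ψ : E → ℝ} (hf : Integrable f)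
    (hψ : Measurable ψ) {C : ℝ} (hC : ∀ v, |ψ v| ≤ C) :
    ∫ v, ψ v * avg T f v = ∫ v, avgDual T ψ v * f v := by
  have h1 : Integrable (fun p : E × ℝ => ψ p.1 * f (T p.2 p.1))
      ((volume : Measure E).prod angleMeasure) :=
    (hT.integrable_prod hf).bdd_mul (hψ.comp measurable_fst).aestronglyMeasurable
      (ae_of_all _ fun p => hC p.1)
  have hm : Measurable (fun p : E × ℝ => ψ (T (-p.2) p.1)) :=
    hψ.comp (hT.measurable.comp (measurable_fst.prodMk measurable_snd.neg))
  have h2 : Integrable (fun p : E × ℝ => ψ (T (-p.2) p.1) * f p.1)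
      ((volume : Measure E).prod angleMeasure) :=
    (hf.comp_fst angleMeasure).bdd_mul hm.aestronglyMeasurable (ae_of_all _ fun p => hC _)
  have e1 : ∫ v, ψ v * avg T f v = ∫ v, ∫ θ, ψ v * f (T θ v) ∂angleMeasure := by
    simp only [avg, integral_const_mul]
  have e2 : ∫ v, avgDual T ψ v * f v = ∫ v, ∫ θ, ψ (T (-θ) v) * f v ∂angleMeasure := by
    simp only [avgDual, integral_mul_const]
  rw [e1, e2, integral_integral_swap (f := fun v θ => ψ v * f (T θ v)) h1,
    integral_integral_swap (f := fun v θ => ψ (T (-θ) v) * f v) h2]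
  congr 1
  ext θ
  have hg : Integrable (fun v => ψ (T (-θ) v) * f v) :=
    hf.bdd_mul (hψ.comp (hT.preserving (-θ)).measurable).aestronglyMeasurable
      (ae_of_all _ fun p => hC _)
  have h3 := integral_map (hT.preserving θ).measurable.aemeasurable
    (f := fun v => ψ (T (-θ) v) * f v) (by
      rw [(hT.preserving θ).map_eq]; exact hg.aestronglyMeasurable)
  rw [(hT.preserving θ).map_eq] at h3
  rw [h3]
  simp only [hT.inv]

lemma IsFlow.integral_avg (hT : IsFlow T) {f : E → ℝ} (hf : Integrable f) :
    ∫ v, avg T f v = ∫ v, f v := by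
  have := hT.integral_mul_avg (ψ := fun _ => 1) (C := 1) hf measurable_const (by simp)
  simpa [avgDual] using this

lemma IsFlow.integral_abs_avg_le (hT : IsFlow T) {f : E → ℝ} (hf : Integrable f) :
    ∫ v, |avg T f v| ≤ ∫ v, |f v| := by
  rw [← hT.integral_avg hf.abs]
  exact integral_mono (hT.integrable_avg hf).abs (hT.integrable_avg hf.abs)
    fun v => abs_integral_le_integral_abs

end flow

/-! ### Rotations and collisions are volume preserving -/

/-- From J² = 1 and (JL)² = 1 one gets (det L)² = 1. For L a collision and J the sign change of one
velocity, JL is a reflection, so no determinant in N dimensions has to be computed. -/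
lemma measurePreserving_of_involutive {V : Type*} [NormedAddCommGroup V] [NormedSpace ℝ V]
    [FiniteDimensional ℝ V] [MeasureSpace V] [BorelSpace V]
    [(volume : Measure V).IsAddHaarMeasure] (L J : V → V) (hL : IsLinearMap ℝ L)
    (hJ : IsLinearMap ℝ J) (hJJ : ∀ v, J (J v) = v) (hJL : ∀ v, J (L (J (L v))) = v) :
    MeasurePreserving L volume volume := by
  set L' := hL.mk' L
  set J' := hJ.mk' J
  have h1 : J' * J' = 1 := LinearMap.ext hJJ
  have h2 : J' * L' * (J' * L') = 1 := LinearMap.ext hJL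
  have h3 := congrArg LinearMap.det h1
  have h4 := congrArg LinearMap.det h2
  simp only [map_mul, map_one] at h3 h4
  have h5 : LinearMap.det L' * LinearMap.det L' = 1 := by
    linear_combination h4 - (LinearMap.det L' * LinearMap.det L') * h3
  have h6 : |LinearMap.det L'| = 1 := by
    have := abs_mul_abs_self (LinearMap.det L')
    rw [h5] at this
    nlinarith [abs_nonneg (LinearMap.det L')]
  refine ⟨L'.continuous_of_finiteDimensional.measurable, ?_⟩
  have := Measure.map_linearMap_addHaar_eq_smul_addHaar (volume : Measure V) (f := L')
    (by intro h; simp [h] at h5)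
  rw [abs_inv, h6, inv_one, ENNReal.ofReal_one, one_smul] at this
  exact this

/-- Rotation of the plane. -/
def rot (θ : ℝ) (p : ℝ × ℝ) : ℝ × ℝ :=
  (p.1 * cos θ + p.2 * sin θ, -p.1 * sin θ + p.2 * cos θ)

lemma isFlow_rot : IsFlow rot where
  measurable := by
    have : Continuous fun p : (ℝ × ℝ) × ℝ => rot p.2 p.1 := by unfold rot; fun_prop
    exact this.measurable
  preserving θ := by
    have : (volume : Measure (ℝ × ℝ)).IsAddHaarMeasure := by
      rw [Measure.volume_eq_prod]; infer_instance
    refine measurePreserving_of_involutive _ (fun p => (p.1, -p.2)) ⟨?_, ?_⟩ ⟨?_, ?_⟩ ?_ ?_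
    · intro x y; ext <;> simp [rot] <;> ring
    · intro c x; ext <;> simp [rot] <;> ring
    · intro x y; ext <;> simp; ring
    · intro c x; ext <;> simp
    · intro v; simp
    · intro v
      have := sin_sq_add_cos_sq θ
      ext <;> simp only [rot]
      · linear_combination v.1 * this
      · linear_combination v.2 * this
  inv θ v := by
    have := sin_sq_add_cos_sq θ
    ext <;> simp only [rot, cos_neg, sin_neg]
    · linear_combination v.1 * this
    · linear_combination v.2 * this

/-- Collision of particle `j` with an additional particle. -/
def kick {N : ℕ} (j : Fin N) (θ : ℝ) (p : (Fin N → ℝ) × ℝ) : (Fin N → ℝ) × ℝ :=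
  (thermalize p.1 j θ p.2, -p.1 j * sin θ + p.2 * cos θ)

lemma isFlow_kick {N : ℕ} (j : Fin N) : IsFlow (kick j) where
  measurable := by
    have : Continuous fun p : ((Fin N → ℝ) × ℝ) × ℝ => kick j p.2 p.1 := by
      unfold kick thermalize; fun_prop
    exact this.measurable
  preserving θ := by
    have : (volume : Measure ((Fin N → ℝ) × ℝ)).IsAddHaarMeasure := by
      rw [Measure.volume_eq_prod]; infer_instance
    refine measurePreserving_of_involutive _ (fun p => (p.1, -p.2)) ⟨?_, ?_⟩ ⟨?_, ?_⟩ ?_ ?_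
    · intro x y
      refine Prod.ext (funext fun i => ?_) ?_
      · rcases eq_or_ne i j with rfl | h
        · simp [kick, thermalize]; ring
        · simp [kick, thermalize, h]
      · simp [kick]; ring
    · intro c x
      refine Prod.ext (funext fun i => ?_) ?_
      · rcases eq_or_ne i j with rfl | h
        · simp [kick, thermalize]; ring
        · simp [kick, thermalize, h]
      · simp [kick]; ring
    · intro x y; ext <;> simp; ring
    · intro c x; ext <;> simp
    · intro v; simp
    · intro v
      have := sin_sq_add_cos_sq θ
      refine Prod.ext (funext fun i => ?_) ?_
      · rcases eq_or_ne i j with rfl | h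
        · simp only [kick, thermalize, Function.update_self]
          linear_combination v.1 i * this
        · simp [kick, thermalize, h]
      · simp only [kick, thermalize, Function.update_self]
        linear_combination v.2 * this
  inv θ v := by
    have := sin_sq_add_cos_sq θ
    refine Prod.ext (funext fun i => ?_) ?_
    · rcases eq_or_ne i j with rfl | h
      · simp only [kick, thermalize, Function.update_self, cos_neg, sin_neg]
        linear_combination v.1 i * this
      · simp [kick, thermalize, h]
    · simp only [kick, thermalize, Function.update_self, cos_neg, sin_neg]
      linear_combination v.2 * this

lemma collide_apply {N : ℕ} (v : Fin N → ℝ) {i j : Fin N} (hij : i ≠ j) (θ : ℝ) (k : Fin N) :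
    collide v i j θ k = if k = i then v i * cos θ + v j * sin θ
      else if k = j then -v i * sin θ + v j * cos θ else v k := by
  unfold collide
  by_cases h1 : k = j
  · subst h1; simp [hij.symm]
  · by_cases h2 : k = i
    · subst h2; simp [h1]
    · simp [h1, h2]

lemma isFlow_collide {N : ℕ} {i j : Fin N} (hij : i ≠ j) :
    IsFlow fun θ v => collide v i j θ where
  measurable := by
    have : Continuous fun p : (Fin N → ℝ) × ℝ => collide p.1 i j p.2 := by
      unfold collide; fun_prop
    exact this.measurable
  preserving θ := by
    refine measurePreserving_of_involutive _ (fun p => Function.update p j (-p j))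
      ⟨?_, ?_⟩ ⟨?_, ?_⟩ ?_ ?_
    · intro x y
      ext k
      simp only [collide_apply _ hij, Pi.add_apply]
      split_ifs <;> ring
    · intro x y
      ext k
      simp only [collide_apply _ hij, Pi.smul_apply, smul_eq_mul]
      split_ifs <;> ring
    · intro x y
      ext k
      rcases eq_or_ne k j with rfl | h
      · simp; ring
      · simp [h]
    · intro c x
      ext k
      rcases eq_or_ne k j with rfl | h
      · simp
      · simp [h]
    · intro v
      simp
    · intro v
      have := sin_sq_add_cos_sq θ
      ext k
      simp only [Function.update_apply, collide_apply _ hij, hij, hij.symm, if_true, if_false]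
      split_ifs with h1 h2
      · subst h1; linear_combination v k * this
      · subst h2; linear_combination v k * this
      · rfl
  inv θ v := by
    have := sin_sq_add_cos_sq θ
    ext k
    simp only [collide_apply _ hij, hij.symm, if_true, if_false, cos_neg, sin_neg]
    split_ifs with h1 h2
    · subst h1; linear_combination v k * this
    · subst h2; linear_combination v k * this
    · rfl

/-! ### Operators induced on L¹, and the bilinear collision operator -/

section operators

variable {E E' : Type*} [MeasureSpace E] [MeasureSpace E']

/-- A transformation of functions which induces a linear contraction between `L¹` spaces. -/
structure IsL1Op (A : (E → ℝ) → E' → ℝ) : Prop where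
  integrable : ∀ {f}, Integrable f → Integrable (A f)
  congr : ∀ {f g}, Integrable f → f =ᵐ[volume] g → A f =ᵐ[volume] A g
  add : ∀ {f g}, Integrable f → Integrable g → A (f + g) =ᵐ[volume] A f + A g
  smul : ∀ (c : ℝ) {f}, Integrable f → A (c • f) =ᵐ[volume] c • A f
  norm_le : ∀ {f}, Integrable f → ∫ v, |A f v| ≤ ∫ v, |f v|

/-- The linear contraction induced by `A`. -/
def IsL1Op.toCLM {A : (E → ℝ) → E' → ℝ} (hA : IsL1Op A) :
    (E →₁[volume] ℝ) →L[ℝ] (E' →₁[volume] ℝ) :=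
  LinearMap.mkContinuous
    { toFun := fun f => (hA.integrable (L1.integrable_coeFn f)).toL1 _
      map_add' := fun f g => by
        rw [← Integrable.toL1_add, Integrable.toL1_eq_toL1_iff]
        have hf := L1.integrable_coeFn f
        have hg := L1.integrable_coeFn g
        exact (hA.congr (L1.integrable_coeFn _) (Lp.coeFn_add f g)).trans (hA.add hf hg)
      map_smul' := fun c f => by
        simp only [RingHom.id_apply]
        rw [← Integrable.toL1_smul', Integrable.toL1_eq_toL1_iff]
        have hf := L1.integrable_coeFn f
        exact (hA.congr (L1.integrable_coeFn _) (Lp.coeFn_smul c f)).trans (hA.smul c hf) }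
    1 (fun f => by
      have hf := L1.integrable_coeFn f
      rw [one_mul, L1.norm_eq_integral_norm f]
      simp only [LinearMap.coe_mk, AddHom.coe_mk]
      rw [L1.norm_of_fun_eq_integral_norm]
      exact hA.norm_le hf)

lemma IsL1Op.coeFn_toCLM {A : (E → ℝ) → E' → ℝ} (hA : IsL1Op A) (f : E →₁[volume] ℝ) :
    hA.toCLM f =ᵐ[volume] A f :=
  Integrable.coeFn_toL1 (hA.integrable (L1.integrable_coeFn f))

lemma IsL1Op.norm_toCLM_le {A : (E → ℝ) → E' → ℝ} (hA : IsL1Op A) (f : E →₁[volume] ℝ) :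
    ‖hA.toCLM f‖ ≤ ‖f‖ := by
  have h : ‖hA.toCLM‖ ≤ 1 := LinearMap.mkContinuous_norm_le _ zero_le_one _
  simpa using hA.toCLM.le_of_opNorm_le h f

lemma IsFlow.isL1Op [SigmaFinite (volume : Measure E)] {T : ℝ → E → E} (hT : IsFlow T) :
    IsL1Op (avg T) where
  integrable := hT.integrable_avg
  congr _ h := hT.avg_congr h
  add := hT.avg_add
  smul c _ _ := by rw [avg_smul]
  norm_le := hT.integral_abs_avg_le

/-- Integration over the second variable. -/
def marg (f : E × ℝ → ℝ) (v : E) : ℝ := ∫ w, f (v, w)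

lemma isL1Op_marg [SigmaFinite (volume : Measure E)] : IsL1Op (marg (E := E)) where
  integrable hf := hf.integral_prod_left
  congr _ h := by
    filter_upwards [Measure.ae_ae_of_ae_prod h] with v hv
    exact integral_congr_ae hv
  add hf hg := by
    filter_upwards [hf.prod_right_ae, hg.prod_right_ae] with v h1 h2
    exact integral_add h1 h2
  smul c f _ := by
    refine ae_of_all _ fun v => ?_
    exact integral_const_mul _ _
  norm_le {f} hf := by
    have h1 : ∫ p, |f p| = ∫ v, ∫ w, |f (v, w)| := integral_prod _ hf.abs
    rw [h1]
    exact integral_mono hf.integral_prod_left.abs hf.abs.integral_prod_left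
      fun v => abs_integral_le_integral_abs

/-- The tensor product of two functions. -/
def tensor (f : E → ℝ) (h : ℝ → ℝ) (p : E × ℝ) : ℝ := f p.1 * h p.2

lemma integrable_tensor [SigmaFinite (volume : Measure E)] {f : E → ℝ} {h : ℝ → ℝ}
    (hf : Integrable f) (hh : Integrable h) : Integrable (tensor f h) := hf.mul_prod hh

lemma tensor_congr [SigmaFinite (volume : Measure E)] {f f' : E → ℝ} {h h' : ℝ → ℝ}
    (hf : f =ᵐ[volume] f') (hh : h =ᵐ[volume] h') : tensor f h =ᵐ[volume] tensor f' h' := by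
  have h1 : ∀ᵐ q : E × ℝ, f q.1 = f' q.1 := Measure.quasiMeasurePreserving_fst.ae hf
  have h2 : ∀ᵐ q : E × ℝ, h q.2 = h' q.2 := Measure.quasiMeasurePreserving_snd.ae hh
  filter_upwards [h1, h2] with q e1 e2
  simp [tensor, e1, e2]

/-- The tensor product as a continuous bilinear map. -/
def tensorL [SigmaFinite (volume : Measure E)] :
    (E →₁[volume] ℝ) →L[ℝ] (ℝ →₁[volume] ℝ) →L[ℝ] (E × ℝ →₁[volume] ℝ) :=
  LinearMap.mkContinuous₂
    (LinearMap.mk₂ ℝ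
      (fun f h => (integrable_tensor (L1.integrable_coeFn f) (L1.integrable_coeFn h)).toL1 _)
      (fun f f' h => by
        rw [← Integrable.toL1_add, Integrable.toL1_eq_toL1_iff]
        filter_upwards [tensor_congr (Lp.coeFn_add f f') (ae_eq_refl h)] with q e
        rw [e]; simp [tensor, add_mul])
      (fun c f h => by
        rw [← Integrable.toL1_smul', Integrable.toL1_eq_toL1_iff]
        filter_upwards [tensor_congr (Lp.coeFn_smul c f) (ae_eq_refl h)] with q e
        rw [e]; simp [tensor, mul_assoc])
      (fun f h h' => by
        rw [← Integrable.toL1_add, Integrable.toL1_eq_toL1_iff]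
        filter_upwards [tensor_congr (ae_eq_refl f) (Lp.coeFn_add h h')] with q e
        rw [e]; simp [tensor, mul_add])
      (fun c f h => by
        rw [← Integrable.toL1_smul', Integrable.toL1_eq_toL1_iff]
        filter_upwards [tensor_congr (ae_eq_refl f) (Lp.coeFn_smul c h)] with q e
        rw [e]; simp [tensor, mul_left_comm]))
    1 (fun f h => by
      have hf := L1.integrable_coeFn f
      have hh := L1.integrable_coeFn h
      simp only [LinearMap.mk₂_apply]
      rw [L1.norm_of_fun_eq_integral_norm,
        one_mul, L1.norm_eq_integral_norm f, L1.norm_eq_integral_norm h]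
      simp only [tensor, norm_mul]
      exact (integral_prod_mul (fun v => ‖f v‖) (fun w => ‖h w‖)).le)

lemma coeFn_tensorL [SigmaFinite (volume : Measure E)] (f : E →₁[volume] ℝ)
    (h : ℝ →₁[volume] ℝ) : tensorL f h =ᵐ[volume] tensor f h :=
  Integrable.coeFn_toL1 (integrable_tensor (L1.integrable_coeFn f) (L1.integrable_coeFn h))

lemma norm_tensorL_le [SigmaFinite (volume : Measure E)] (f : E →₁[volume] ℝ)
    (h : ℝ →₁[volume] ℝ) : ‖tensorL f h‖ ≤ ‖f‖ * ‖h‖ := by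
  have h1 : ‖tensorL (E := E)‖ ≤ 1 := LinearMap.mkContinuous₂_norm_le _ zero_le_one _
  calc ‖tensorL f h‖ ≤ ‖tensorL (E := E)‖ * ‖f‖ * ‖h‖ := ContinuousLinearMap.le_opNorm₂ _ _ _
    _ ≤ 1 * ‖f‖ * ‖h‖ := by gcongr
    _ = ‖f‖ * ‖h‖ := by ring

/-- The law of a particle with initial law `f` after a collision with a particle of law `h`. -/
def coll (T : ℝ → E × ℝ → E × ℝ) (f : E → ℝ) (h : ℝ → ℝ) : E → ℝ := marg (avg T (tensor f h))

lemma coll_eq_of_integrable {E : Type*} {T : ℝ → E × ℝ → E × ℝ} {f : E → ℝ} {h : ℝ → ℝ} {v : E}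
    (hi : Integrable (fun q : ℝ × ℝ => f (T q.2 (v, q.1)).1 * h (T q.2 (v, q.1)).2)
        (volume.prod angleMeasure)) :
    coll T f h v = ∫ q : ℝ × ℝ, f (T q.2 (v, q.1)).1 * h (T q.2 (v, q.1)).2
      ∂(volume.prod angleMeasure) := (integral_prod _ hi).symm

variable [SigmaFinite (volume : Measure E)] {T : ℝ → E × ℝ → E × ℝ}

/-- The operator `coll` as a continuous bilinear map. -/
def collL (hT : IsFlow T) : (E →₁[volume] ℝ) →L[ℝ] (ℝ →₁[volume] ℝ) →L[ℝ] (E →₁[volume] ℝ) :=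
  (ContinuousLinearMap.compL ℝ _ _ _
    ((isL1Op_marg (E := E)).toCLM.comp hT.isL1Op.toCLM)).comp tensorL

lemma collL_apply (hT : IsFlow T) (f : E →₁[volume] ℝ) (h : ℝ →₁[volume] ℝ) :
    collL hT f h = (isL1Op_marg (E := E)).toCLM (hT.isL1Op.toCLM (tensorL f h)) := rfl

lemma coll_congr (hT : IsFlow T) {f f' : E → ℝ} {h h' : ℝ → ℝ} (hi : Integrable f)
    (hi' : Integrable h)
    (hf : f =ᵐ[volume] f') (hh : h =ᵐ[volume] h') : coll T f h =ᵐ[volume] coll T f' h' :=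
  isL1Op_marg.congr (hT.integrable_avg (integrable_tensor hi hi'))
    (hT.avg_congr (tensor_congr hf hh))

lemma coeFn_collL (hT : IsFlow T) (f : E →₁[volume] ℝ) (h : ℝ →₁[volume] ℝ) :
    collL hT f h =ᵐ[volume] coll T f h := by
  rw [collL_apply]
  refine (IsL1Op.coeFn_toCLM _ _).trans (isL1Op_marg.congr (L1.integrable_coeFn _) ?_)
  exact (IsL1Op.coeFn_toCLM _ _).trans (hT.avg_congr (coeFn_tensorL f h))

lemma norm_collL_le (hT : IsFlow T) (f : E →₁[volume] ℝ) (h : ℝ →₁[volume] ℝ) :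
    ‖collL hT f h‖ ≤ ‖f‖ * ‖h‖ :=
  (IsL1Op.norm_toCLM_le isL1Op_marg _).trans ((IsL1Op.norm_toCLM_le _ _).trans (norm_tensorL_le f h))

/-- The outgoing velocity of the second particle is integrated out, so `ψ` may be regarded as a
function of both particles that ignores the second; the adjoint formula for `avg` then applies. -/
lemma integral_mul_coll (hT : IsFlow T) {f : E → ℝ} {h : ℝ → ℝ} (hf : Integrable f)
    (hh : Integrable h) {ψ : E → ℝ} (hψ : Measurable ψ) {C : ℝ} (hC : ∀ v, |ψ v| ≤ C) :
    ∫ v, ψ v * coll T f h v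
      = ∫ p : E × ℝ, (∫ θ, ψ (T (-θ) p).1 ∂angleMeasure) * (f p.1 * h p.2) := by
  have hi := hT.integrable_avg (integrable_tensor hf hh)
  have h1 := hT.integral_mul_avg (integrable_tensor hf hh) (ψ := fun p => ψ p.1)
    (hψ.comp measurable_fst) (fun p => hC p.1)
  have h2 : ∫ p : E × ℝ, ψ p.1 * avg T (tensor f h) p
      = ∫ v, ∫ w, ψ v * avg T (tensor f h) (v, w) :=
    integral_prod _ (hi.bdd_mul (hψ.comp measurable_fst).aestronglyMeasurable
      (ae_of_all _ fun p => hC p.1))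
  simp only [integral_const_mul] at h2
  rw [h2] at h1
  exact h1

lemma integral_coll (hT : IsFlow T) {f : E → ℝ} {h : ℝ → ℝ} (hf : Integrable f)
    (hh : Integrable h) : ∫ v, coll T f h v = (∫ v, f v) * ∫ w, h w := by
  have := integral_mul_coll hT hf hh (ψ := fun _ => 1) (C := 1) measurable_const (by simp)
  simp only [one_mul, integral_const, probReal_univ, smul_eq_mul] at this
  rw [this]
  exact integral_prod_mul f h

lemma coll_nonneg (hT : IsFlow T) {f : E → ℝ} {h : ℝ → ℝ} (hf : 0 ≤ᵐ[volume] f)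
    (hh : 0 ≤ᵐ[volume] h) : 0 ≤ᵐ[volume] coll T f h := by
  have h1 : ∀ᵐ q : E × ℝ, 0 ≤ f q.1 := Measure.quasiMeasurePreserving_fst.ae hf
  have h2 : ∀ᵐ q : E × ℝ, 0 ≤ h q.2 := Measure.quasiMeasurePreserving_snd.ae hh
  have h3 : ∀ᵐ q : E × ℝ, 0 ≤ tensor f h q := by
    filter_upwards [h1, h2] with q e1 e2 using mul_nonneg e1 e2
  filter_upwards [Measure.ae_ae_of_ae_prod (hT.ae_of_ae h3)] with v hv
  refine integral_nonneg_of_ae ?_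
  filter_upwards [hv] with w hw
  exact integral_nonneg_of_ae hw

/-- For almost every `v`, the integrand of `coll` is integrable, and the order of integration is
immaterial. -/
lemma coll_integrable_ae (hT : IsFlow T) {f : E → ℝ} {h : ℝ → ℝ} (hf : Integrable f)
    (hh : Integrable h) : ∀ᵐ v : E,
      Integrable (fun q : ℝ × ℝ => f (T q.2 (v, q.1)).1 * h (T q.2 (v, q.1)).2)
        (volume.prod angleMeasure) := by
  have h1 := hT.integrable_prod (integrable_tensor hf hh)
  rw [Measure.volume_eq_prod] at h1
  have h2 := (measurePreserving_prodAssoc (volume : Measure E) (volume : Measure ℝ)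
    angleMeasure).symm.integrable_comp_of_integrable h1
  exact h2.prod_right_ae

end operators

/-! ### Pairing with bounded continuous functions -/

section pairing

variable {E : Type*} [MeasureSpace E] [TopologicalSpace E] [BorelSpace E]

lemma integrable_bcf_mul (ψ : E →ᵇ ℝ) {f : E → ℝ} (hf : Integrable f) :
    Integrable fun v => ψ v * f v :=
  hf.bdd_mul ψ.continuous.measurable.aestronglyMeasurable (ae_of_all _ fun v => ψ.norm_coe_le_norm v)

/-- Integration against a bounded continuous function. -/
def pair (ψ : E →ᵇ ℝ) : (E →₁[volume] ℝ) →L[ℝ] ℝ :=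
  LinearMap.mkContinuous
    { toFun := fun f => ∫ v, ψ v * f v
      map_add' := fun f g => by
        rw [← integral_add (integrable_bcf_mul ψ (L1.integrable_coeFn f))
          (integrable_bcf_mul ψ (L1.integrable_coeFn g))]
        refine integral_congr_ae ?_
        filter_upwards [Lp.coeFn_add f g] with v hv
        rw [hv, Pi.add_apply, mul_add]
      map_smul' := fun c f => by
        rw [RingHom.id_apply, smul_eq_mul, ← integral_const_mul]
        refine integral_congr_ae ?_
        filter_upwards [Lp.coeFn_smul c f] with v hv
        rw [hv, Pi.smul_apply, smul_eq_mul, mul_left_comm] }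
    ‖ψ‖ (fun f => by
      rw [L1.norm_eq_integral_norm, ← integral_const_mul]
      refine (norm_integral_le_integral_norm _).trans (integral_mono
        (integrable_bcf_mul ψ (L1.integrable_coeFn f)).norm
        ((L1.integrable_coeFn f).norm.const_mul _) fun v => ?_)
      simp only [norm_mul]
      gcongr
      exact ψ.norm_coe_le_norm v)

lemma pair_apply (ψ : E →ᵇ ℝ) (f : E →₁[volume] ℝ) : pair ψ f = ∫ v, ψ v * f v := rfl

lemma abs_pair_le (ψ : E →ᵇ ℝ) (f : E →₁[volume] ℝ) : |pair ψ f| ≤ ‖ψ‖ * ‖f‖ :=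
  (pair ψ).le_of_opNorm_le (LinearMap.mkContinuous_norm_le _ (norm_nonneg _) _) f

lemma pair_add (ψ χ : E →ᵇ ℝ) (f : E →₁[volume] ℝ) :
    pair (ψ + χ) f = pair ψ f + pair χ f := by
  simp only [pair_apply, BoundedContinuousFunction.coe_add, Pi.add_apply, add_mul]
  exact integral_add (integrable_bcf_mul ψ (L1.integrable_coeFn f))
    (integrable_bcf_mul χ (L1.integrable_coeFn f))

lemma pair_smul (c : ℝ) (ψ : E →ᵇ ℝ) (f : E →₁[volume] ℝ) :
    pair (c • ψ) f = c * pair ψ f := by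
  simp only [pair_apply, BoundedContinuousFunction.coe_smul, smul_eq_mul, mul_assoc,
    integral_const_mul]

lemma pair_sum {ι : Type*} (s : Finset ι) (ψ : ι → E →ᵇ ℝ) (f : E →₁[volume] ℝ) :
    pair (∑ i ∈ s, ψ i) f = ∑ i ∈ s, pair (ψ i) f := by
  classical
  induction s using Finset.induction_on with
  | empty => simp [pair_apply]
  | insert a s ha ih => rw [Finset.sum_insert ha, Finset.sum_insert ha, pair_add, ih]

/-- The total mass. -/
def mass : (E →₁[volume] ℝ) →L[ℝ] ℝ := pair (BoundedContinuousFunction.const E 1)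

lemma mass_apply (f : E →₁[volume] ℝ) : mass f = ∫ v, f v := by
  simp [mass, pair_apply]

end pairing

/-! ### The Gaussian density -/

section gauss

lemma gauss_nonneg (β w : ℝ) : 0 ≤ gauss β w := by unfold gauss; positivity

lemma continuous_gauss (β : ℝ) : Continuous (gauss β) := by unfold gauss; fun_prop

lemma integrable_gauss {β : ℝ} (hβ : 0 < β) : Integrable (gauss β) :=
  (integrable_exp_neg_mul_sq (half_pos hβ)).const_mul _

lemma integral_gauss {β : ℝ} (hβ : 0 < β) : ∫ w, gauss β w = 1 := by
  unfold gauss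
  rw [integral_const_mul, integral_gaussian, ← Real.sqrt_mul (by positivity), Real.sqrt_eq_one]
  field_simp

end gauss

/-! ### Wild sums in a Banach space -/

section wild

variable {X : Type*} [NormedAddCommGroup X] [NormedSpace ℝ X]

/-- The coefficients of the Wild sum, i.e. of the solution of `x' = H x x`. -/
def wildCoeff (H : X →L[ℝ] X →L[ℝ] X) (x₀ : X) : ℕ → X
  | 0 => x₀
  | n + 1 => (n + 1 : ℝ)⁻¹ • ∑ k : Fin (n + 1), H (wildCoeff H x₀ k) (wildCoeff H x₀ (n - k))
decreasing_by all_goals omega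

lemma wildCoeff_zero (H : X →L[ℝ] X →L[ℝ] X) (x₀ : X) : wildCoeff H x₀ 0 = x₀ := by
  rw [wildCoeff]

lemma wildCoeff_succ (H : X →L[ℝ] X →L[ℝ] X) (x₀ : X) (n : ℕ) :
    ((n : ℝ) + 1) • wildCoeff H x₀ (n + 1)
      = ∑ p ∈ Finset.HasAntidiagonal.antidiagonal n, H (wildCoeff H x₀ p.1) (wildCoeff H x₀ p.2) := by
  rw [wildCoeff, smul_inv_smul₀ (by positivity)]
  rw [Finset.Nat.sum_antidiagonal_eq_sum_range_succ
    (fun k l => H (wildCoeff H x₀ k) (wildCoeff H x₀ l)), Finset.sum_range]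

/-- The recursion averages `n + 1` values of `H` with equal weights, so a convex set stable under
`H` is never left. -/
lemma wildCoeff_mem {H : X →L[ℝ] X →L[ℝ] X} {x₀ : X} {C : Set X} (hC : Convex ℝ C)
    (h₀ : x₀ ∈ C) (hH : ∀ x ∈ C, ∀ y ∈ C, H x y ∈ C) (n : ℕ) : wildCoeff H x₀ n ∈ C := by
  induction n using Nat.strong_induction_on with
  | _ n ih =>
    cases n with
    | zero => rwa [wildCoeff_zero]
    | succ n =>
      rw [wildCoeff, Finset.smul_sum]
      refine hC.sum_mem (fun _ _ => by positivity) ?_ fun k _ => hH _ (ih _ (by omega)) _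
        (ih _ (by omega))
      simp; field_simp

/-- The sum of a power series with coefficients `a`. -/
def powSum (a : ℕ → X) (z : ℝ) : X := ∑' n, z ^ n • a n

lemma hasDerivAt_powSum [CompleteSpace X] {a : ℕ → X}
    (ha : ∀ r : ℝ, 0 ≤ r → r < 1 → Summable fun n => r ^ n * ‖a n‖) {z : ℝ} (hz : |z| < 1) :
    HasDerivAt (powSum a) (∑' n : ℕ, z ^ n • ((n : ℝ) + 1) • a (n + 1)) z := by
  obtain ⟨r, hr1, hr2⟩ := exists_between hz
  obtain ⟨s, hs1, hs2⟩ := exists_between hr2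
  have hr0 : 0 < r := (abs_nonneg z).trans_lt hr1
  have hs0 : 0 < s := hr0.trans hs1
  have hu : Summable fun n : ℕ => (n * r ^ (n - 1)) * ‖a n‖ := by
    have h1 : Tendsto (fun n : ℕ => n * (r / s) ^ n) atTop (𝓝 0) :=
      tendsto_self_mul_const_pow_of_abs_lt_one (by
        rw [abs_of_pos (by positivity), div_lt_one hs0]; exact hs1)
    -- The threshold `r` supplies the power lost by differentiation: it turns the inequality into `n
    -- * r ^ (n - 1) < s ^ n`, so the derivative series is dominated by the original one at the
    -- larger radius `s`.
    have h2 : ∀ᶠ n : ℕ in atTop, n * (r / s) ^ n < r := h1.eventually (gt_mem_nhds hr0)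
    refine Summable.of_norm_bounded_eventually_nat (ha s hs0.le hs2) ?_
    filter_upwards [h2, eventually_ge_atTop 1] with n hn hn1
    rw [Real.norm_of_nonneg (by positivity)]
    gcongr
    obtain ⟨k, rfl⟩ : ∃ k, n = k + 1 := ⟨n - 1, by omega⟩
    rw [div_pow, ← mul_div_assoc, div_lt_iff₀ (by positivity)] at hn
    rw [Nat.add_sub_cancel]
    rw [pow_succ] at hn
    nlinarith
  have h := hasDerivAt_tsum_of_isPreconnected (g := fun n (z : ℝ) => z ^ n • a n)
    (g' := fun n (z : ℝ) => (n * z ^ (n - 1)) • a n) (y₀ := 0) (y := z)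
    (t := Metric.ball (0 : ℝ) r) hu Metric.isOpen_ball
    (convex_ball _ _).isPreconnected (fun n y _ => (hasDerivAt_pow n y).smul_const (a n))
    (fun n y hy => ?_) (Metric.mem_ball_self hr0) ?_ (by simpa using hr1)
  · have hd : Summable fun n : ℕ => (n * z ^ (n - 1)) • a n := by
      refine Summable.of_norm_bounded hu fun n => ?_
      rw [norm_smul, norm_mul, norm_pow, Real.norm_natCast, Real.norm_eq_abs]
      gcongr
    rw [hd.tsum_eq_zero_add] at h
    simp only [Nat.cast_zero, zero_mul, zero_smul, zero_add, Nat.add_sub_cancel] at h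
    have e : ∑' n : ℕ, z ^ n • ((n : ℝ) + 1) • a (n + 1)
        = ∑' n : ℕ, (((n + 1 : ℕ) : ℝ) * z ^ n) • a (n + 1) :=
      tsum_congr fun n => by rw [smul_smul]; push_cast; ring_nf
    rw [e]
    exact h
  · rw [norm_smul, norm_mul, norm_pow, Real.norm_natCast]
    have : ‖y‖ < r := by simpa using hy
    gcongr
  · refine summable_of_ne_finset_zero (s := {0}) fun n hn => ?_
    simp at hn
    simp [hn]

lemma hasSum_antidiagonal {c : ℕ × ℕ → X} {V : X} {z : ℝ}
    (h : HasSum (fun p : ℕ × ℕ => z ^ (p.1 + p.2) • c p) V) :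
    HasSum (fun n => z ^ n • ∑ p ∈ Finset.HasAntidiagonal.antidiagonal n, c p) V := by
  have h1 := (Finset.HasAntidiagonal.sigmaAntidiagonalEquivProd (A := ℕ)).hasSum_iff.2 h
  have h2 := h1.sigma (g := fun n => z ^ n • ∑ p ∈ Finset.HasAntidiagonal.antidiagonal n, c p)
    fun n => ?_
  · exact h2
  · have h3 := hasSum_fintype fun x : Finset.HasAntidiagonal.antidiagonal n =>
      z ^ (x.1.1 + x.1.2) • c x.1
    convert h3 using 1
    · rfl
    rw [Finset.smul_sum, ← Finset.sum_coe_sort]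
    refine Finset.sum_congr rfl fun x _ => ?_
    rw [Finset.HasAntidiagonal.mem_antidiagonal.1 x.2]

lemma hasSum_bilinear_powSum [CompleteSpace X] (H : X →L[ℝ] X →L[ℝ] X) {a : ℕ → X} {z : ℝ}
    (ha : Summable fun n => ‖z ^ n • a n‖) :
    HasSum (fun p : ℕ × ℕ => z ^ (p.1 + p.2) • H (a p.1) (a p.2))
      (H (powSum a z) (powSum a z)) := by
  have e : ∀ p : ℕ × ℕ, z ^ (p.1 + p.2) • H (a p.1) (a p.2)
      = H (z ^ p.1 • a p.1) (z ^ p.2 • a p.2) := fun p => by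
    simp [smul_smul, pow_add, mul_comm]
  have hs : Summable fun p : ℕ × ℕ => H (z ^ p.1 • a p.1) (z ^ p.2 • a p.2) := by
    refine Summable.of_norm_bounded ((ha.mul_of_nonneg ha (fun _ => norm_nonneg _)
      fun _ => norm_nonneg _).mul_left ‖H‖) fun p => ?_
    rw [← mul_assoc]
    exact H.le_opNorm₂ _ _
  simp only [e]
  convert hs.hasSum using 1
  rw [hs.tsum_prod]
  have h1 : H (powSum a z) (powSum a z) = H.flip (powSum a z) (∑' n, z ^ n • a n) := rfl
  rw [h1, (H.flip (powSum a z)).map_tsum ha.of_norm]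
  refine tsum_congr fun k => ?_
  rw [ContinuousLinearMap.flip_apply, powSum, (H (z ^ k • a k)).map_tsum ha.of_norm]

/-- The Wild sum solving `x' = α (H x x - x)`. -/
def wildSum (H : X →L[ℝ] X →L[ℝ] X) (x₀ : X) (α t : ℝ) : X :=
  exp (-(α * t)) • powSum (wildCoeff H x₀) (1 - exp (-(α * t)))

lemma wild_arg_mem {α t : ℝ} (hα : 0 < α) (ht : 0 ≤ t) :
    0 ≤ 1 - exp (-(α * t)) ∧ 1 - exp (-(α * t)) < 1 := by
  constructor
  · have : exp (-(α * t)) ≤ 1 := Real.exp_le_one_iff.2 (by nlinarith)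
    linarith
  · linarith [Real.exp_pos (-(α * t))]

lemma hasDerivAt_exp_neg_mul (α t : ℝ) :
    HasDerivAt (fun t => exp (-(α * t))) (-(α * exp (-(α * t)))) t := by
  have h : HasDerivAt (fun t => -(α * t)) (-α) t := by
    simpa using ((hasDerivAt_id t).const_mul α).fun_neg
  exact h.exp.congr_deriv (by ring)

/-- Chain rule for the time change z = 1 - e^(-αt): one factor e^(-αt) comes from dz/dt and one from
the prefactor. Stated for a general coefficient sequence, so that it serves both in L¹ and, at a
fixed velocity, in ℝ. -/
lemma hasDerivAt_exp_smul_powSum [CompleteSpace X] {a : ℕ → X}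
    (ha : ∀ r : ℝ, 0 ≤ r → r < 1 → Summable fun n => r ^ n * ‖a n‖) {α t : ℝ} (hα : 0 < α)
    (ht : 0 ≤ t) {D : X}
    (hD : HasSum (fun n : ℕ => (1 - exp (-(α * t))) ^ n • ((n : ℝ) + 1) • a (n + 1)) D) :
    HasDerivAt (fun t => exp (-(α * t)) • powSum a (1 - exp (-(α * t))))
      ((α * exp (-(α * t)) ^ 2) • D - α • (exp (-(α * t)) • powSum a (1 - exp (-(α * t))))) t := by
  have h0 := wild_arg_mem hα ht
  have h1 := hasDerivAt_powSum ha (z := 1 - exp (-(α * t))) (by rw [abs_of_nonneg h0.1]; exact h0.2)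
  rw [hD.tsum_eq] at h1
  have h2 : HasDerivAt (fun t => 1 - exp (-(α * t))) (α * exp (-(α * t))) t := by
    simpa using (hasDerivAt_exp_neg_mul α t).const_sub 1
  have h3 := (hasDerivAt_exp_neg_mul α t).smul (h1.scomp t h2)
  refine h3.congr_deriv ?_
  simp only [Function.comp, smul_smul]
  module

lemma hasDerivAt_wildSum [CompleteSpace X] {H : X →L[ℝ] X →L[ℝ] X} {x₀ : X}
    (hb : ∀ n, ‖wildCoeff H x₀ n‖ ≤ 1) {α t : ℝ} (hα : 0 < α) (ht : 0 ≤ t) :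
    HasDerivAt (wildSum H x₀ α)
      (α • (H (wildSum H x₀ α t) (wildSum H x₀ α t) - wildSum H x₀ α t)) t := by
  have h0 := wild_arg_mem hα ht
  have ha : ∀ r : ℝ, 0 ≤ r → r < 1 → Summable fun n => r ^ n * ‖wildCoeff H x₀ n‖ :=
    fun r h1 h2 => Summable.of_nonneg_of_le (fun n => by positivity)
      (fun n => mul_le_of_le_one_right (by positivity) (hb n)) (summable_geometric_of_lt_one h1 h2)
  have hs : Summable fun n => ‖(1 - exp (-(α * t))) ^ n • wildCoeff H x₀ n‖ := by
    convert ha _ h0.1 h0.2 using 2 with n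
    rw [norm_smul, norm_pow, Real.norm_of_nonneg h0.1]
  have h1 := hasSum_antidiagonal (hasSum_bilinear_powSum H hs)
  simp only [← wildCoeff_succ] at h1
  refine (hasDerivAt_exp_smul_powSum ha hα ht h1).congr_deriv ?_
  simp only [wildSum, map_smul, _root_.smul_apply]
  module

lemma wildSum_zero (H : X →L[ℝ] X →L[ℝ] X) (x₀ : X) (α : ℝ) : wildSum H x₀ α 0 = x₀ := by
  have : powSum (wildCoeff H x₀) 0 = x₀ := by
    rw [powSum, tsum_eq_single 0]
    · simp [wildCoeff_zero]
    · intro n hn; simp [hn]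
  simp [wildSum, this]

end wild

/-! ### Uniqueness for quadratic differential equations -/

section quadratic

variable {X : Type*} [NormedAddCommGroup X] [NormedSpace ℝ X]

/-- Uniqueness for differential equations with a linear plus quadratic right-hand side. -/
lemma eq_of_quadratic_ode (B : X →L[ℝ] X →L[ℝ] X) (L : X →L[ℝ] X) {u v : ℝ → X}
    (hu : ∀ t, 0 ≤ t → HasDerivWithinAt u (B (u t) (u t) + L (u t)) (Set.Ici 0) t)
    (hv : ∀ t, 0 ≤ t → HasDerivWithinAt v (B (v t) (v t) + L (v t)) (Set.Ici 0) t)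
    (h0 : u 0 = v 0) {t : ℝ} (ht : 0 ≤ t) : u t = v t := by
  have hcu : ContinuousOn u (Set.Icc 0 t) := fun s hs =>
    ((hu s hs.1).continuousWithinAt).mono Set.Icc_subset_Ici_self
  have hcv : ContinuousOn v (Set.Icc 0 t) := fun s hs =>
    ((hv s hs.1).continuousWithinAt).mono Set.Icc_subset_Ici_self
  obtain ⟨R₁, h1⟩ := isCompact_Icc.exists_bound_of_continuousOn hcu
  obtain ⟨R₂, h2⟩ := isCompact_Icc.exists_bound_of_continuousOn hcv
  -- By compactness of the time interval both curves stay in one ball, on which the vector field is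
  -- Lipschitz.
  set R := max R₁ R₂
  have hR : 0 ≤ R := ((norm_nonneg _).trans (h1 0 ⟨le_rfl, ht⟩)).trans (le_max_left _ _)
  have hlip : LipschitzOnWith (Real.toNNReal (‖B‖ * R + ‖B‖ * R + ‖L‖))
      (fun x => B x x + L x) (Metric.closedBall 0 R) := by
    refine LipschitzOnWith.of_dist_le_mul fun x hx y hy => ?_
    rw [mem_closedBall_zero_iff] at hx hy
    rw [Real.coe_toNNReal _ (by positivity), dist_eq_norm, dist_eq_norm]
    have e : B x x + L x - (B y y + L y) = B (x - y) x + B y (x - y) + L (x - y) := by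
      simp only [map_sub, _root_.sub_apply]; abel
    rw [e]
    calc _ ≤ ‖B (x - y) x‖ + ‖B y (x - y)‖ + ‖L (x - y)‖ := norm_add₃_le
      _ ≤ ‖B‖ * ‖x - y‖ * ‖x‖ + ‖B‖ * ‖y‖ * ‖x - y‖ + ‖L‖ * ‖x - y‖ := by
        gcongr
        exacts [B.le_opNorm₂ _ _, B.le_opNorm₂ _ _, L.le_opNorm _]
      _ ≤ ‖B‖ * ‖x - y‖ * R + ‖B‖ * R * ‖x - y‖ + ‖L‖ * ‖x - y‖ := by gcongr
      _ = _ := by ring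
  refine ODE_solution_unique_of_mem_Icc_right (v := fun _ x => B x x + L x)
    (s := fun _ => Metric.closedBall 0 R) (fun _ _ => hlip) hcu
    (fun s hs => (hu s hs.1).mono (Set.Ici_subset_Ici.2 hs.1)) (fun s hs => ?_) hcv
    (fun s hs => (hv s hs.1).mono (Set.Ici_subset_Ici.2 hs.1)) (fun s hs => ?_) h0 ⟨ht, le_rfl⟩
  · rw [mem_closedBall_zero_iff]
    exact (h1 s ⟨hs.1, hs.2.le⟩).trans (le_max_left _ _)
  · rw [mem_closedBall_zero_iff]
    exact (h2 s ⟨hs.1, hs.2.le⟩).trans (le_max_right _ _)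

end quadratic

/-! ### Probability densities in L¹ -/

/-- The Gaussian density as an element of `L¹`. -/
def gaussL {β : ℝ} (hβ : 0 < β) : ℝ →₁[volume] ℝ := (integrable_gauss hβ).toL1 _

lemma coeFn_gaussL {β : ℝ} (hβ : 0 < β) : gaussL hβ =ᵐ[volume] gauss β :=
  Integrable.coeFn_toL1 _

section density

variable {E : Type*} [MeasureSpace E] [TopologicalSpace E] [BorelSpace E]

variable (E) in
/-- The set of probability densities in `L¹`. -/
def densities : Set (E →₁[volume] ℝ) := {F | 0 ≤ F ∧ mass F = 1}

lemma mem_densities_iff {F : E →₁[volume] ℝ} : F ∈ densities E ↔ IsProbDensity F := by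
  change 0 ≤ F ∧ mass F = 1 ↔ _
  rw [IsProbDensity, ← Lp.coeFn_nonneg, mass_apply]
  exact ⟨fun h => ⟨L1.integrable_coeFn F, h⟩, fun h => h.2⟩

lemma smul_nonneg_L1 {E : Type*} [MeasureSpace E] {c : ℝ} {F : E →₁[volume] ℝ} (hc : 0 ≤ c)
    (hF : 0 ≤ F) : 0 ≤ c • F := by
  rw [← Lp.coeFn_nonneg] at hF ⊢
  filter_upwards [hF, Lp.coeFn_smul c F] with v h1 h2
  rw [h2]
  exact mul_nonneg hc h1

lemma convex_densities : Convex ℝ (densities E) := by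
  intro x hx y hy a b ha hb hab
  refine ⟨add_nonneg (smul_nonneg_L1 ha hx.1) (smul_nonneg_L1 hb hy.1), ?_⟩
  rw [map_add, map_smul, map_smul, hx.2, hy.2]
  simpa using hab

lemma norm_eq_one_of_mem_densities {F : E →₁[volume] ℝ} (hF : F ∈ densities E) : ‖F‖ = 1 := by
  rw [L1.norm_eq_integral_norm, ← hF.2, mass_apply]
  refine integral_congr_ae ?_
  filter_upwards [(Lp.coeFn_nonneg F).2 hF.1] with v hv
  exact Real.norm_of_nonneg hv

lemma collL_mem_densities [SigmaFinite (volume : Measure E)] {T : ℝ → E × ℝ → E × ℝ}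
    (hT : IsFlow T) {F : E →₁[volume] ℝ} {G : ℝ →₁[volume] ℝ} (hF : F ∈ densities E)
    (hG : G ∈ densities ℝ) : collL hT F G ∈ densities E := by
  constructor
  · rw [← Lp.coeFn_nonneg]
    filter_upwards [coeFn_collL hT F G, coll_nonneg hT ((Lp.coeFn_nonneg F).2 hF.1)
      ((Lp.coeFn_nonneg G).2 hG.1)] with v h1 h2
    rwa [h1]
  · rw [mass_apply, integral_congr_ae (coeFn_collL hT F G),
      integral_coll hT (L1.integrable_coeFn F) (L1.integrable_coeFn G), ← mass_apply,
      ← mass_apply, hF.2, hG.2, one_mul]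

end density

lemma gaussL_mem_densities {β : ℝ} (hβ : 0 < β) : gaussL hβ ∈ densities ℝ := by
  constructor
  · rw [← Lp.coeFn_nonneg]
    filter_upwards [coeFn_gaussL hβ] with v h1
    rw [h1]; exact gauss_nonneg β v
  · rw [mass_apply, integral_congr_ae (coeFn_gaussL hβ), integral_gauss hβ]

lemma coll_smul_smul {E : Type*} {T : ℝ → E × ℝ → E × ℝ} (c d : ℝ) (f : E → ℝ) (h : ℝ → ℝ)
    (v : E) : coll T (c • f) (d • h) v = c * d * coll T f h v := by
  simp only [coll, marg, avg, tensor, Pi.smul_apply, smul_eq_mul]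
  rw [← integral_const_mul]
  congr 1
  ext w
  rw [← integral_const_mul]
  congr 1
  ext θ
  ring

/-! ### Existence and uniqueness for the Boltzmann equation in L¹ -/

section boltzmann

variable {lam mu β : ℝ} (hβ : 0 < β)

/-- The integrand of the collision and thermostat terms at velocity `v`. -/
def rotIntegrand (f h : ℝ → ℝ) (v : ℝ) (q : ℝ × ℝ) : ℝ :=
  f (rot q.2 (v, q.1)).1 * h (rot q.2 (v, q.1)).2

/-- Gain and loss share one integral in the equation. Integrability of the gain integrand at this
particular `v` is what permits splitting them and exchanging the integrals over `w` and θ. -/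
lemma boltzmannRHS_eq {f : ℝ → ℝ} (hf : Integrable f) {v : ℝ}
    (hi : Integrable (rotIntegrand f f v) (volume.prod angleMeasure)) :
    boltzmannRHS lam mu β f v = 2 * lam * (coll rot f f v - f v * ∫ w, f w)
      + mu * (coll rot f (gauss β) v - f v) := by
  unfold boltzmannRHS
  congr 2
  · rw [intervalAverage_eq]
    have h1 : ∀ᵐ θ ∂angleMeasure, ∫ w, (f (v * cos θ + w * sin θ) * f (-v * sin θ + w * cos θ)
        - f v * f w) = (∫ w, rotIntegrand f f v (w, θ)) - f v * ∫ w, f w := by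
      filter_upwards [hi.prod_left_ae] with θ hθ
      rw [← integral_const_mul]
      exact integral_sub hθ (hf.const_mul _)
    rw [integral_congr_ae h1, integral_sub hi.integral_prod_right (integrable_const _)]
    simp only [integral_const, probReal_univ, one_smul]
    congr 1
    exact (integral_integral_swap (f := fun w θ => rotIntegrand f f v (w, θ)) hi).symm
  · congr 1
    simp only [coll, marg, avg, tensor, intervalAverage_eq, mul_comm (gauss β _)]
    rfl

lemma rotIntegrand_integrable_ae {f h : ℝ → ℝ} (hf : Integrable f) (hh : Integrable h) :
    ∀ᵐ v, Integrable (rotIntegrand f h v) (volume.prod angleMeasure) :=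
  coll_integrable_ae isFlow_rot hf hh

/-- The bilinear map `(F, G) ↦ mass G • A F`. -/
def massMul {E : Type*} [MeasureSpace E]
    (A : (E →₁[volume] ℝ) →L[ℝ] (E →₁[volume] ℝ)) :
    (E →₁[volume] ℝ) →L[ℝ] (ℝ →₁[volume] ℝ) →L[ℝ] (E →₁[volume] ℝ) :=
  ((ContinuousLinearMap.lsmul ℝ ℝ).comp mass).flip.comp A

/-- The quadratic part of the Boltzmann equation. -/
def boltzQuad (lam : ℝ) :
    (ℝ →₁[volume] ℝ) →L[ℝ] (ℝ →₁[volume] ℝ) →L[ℝ] (ℝ →₁[volume] ℝ) :=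
  (2 * lam) • (collL isFlow_rot - massMul (ContinuousLinearMap.id ℝ _))

/-- The linear part of the Boltzmann equation. -/
def boltzLin (mu : ℝ) : (ℝ →₁[volume] ℝ) →L[ℝ] (ℝ →₁[volume] ℝ) :=
  mu • ((collL isFlow_rot).flip (gaussL hβ) - ContinuousLinearMap.id ℝ _)

lemma boltzOp_eq (F : ℝ →₁[volume] ℝ) : boltzQuad lam F F + boltzLin hβ mu F
    = (2 * lam) • (collL isFlow_rot F F - mass F • F)
      + mu • (collL isFlow_rot F (gaussL hβ) - F) := rfl

lemma coeFn_boltzOp (F : ℝ →₁[volume] ℝ) :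
    (boltzQuad lam F F + boltzLin hβ mu F : ℝ →₁[volume] ℝ) =ᵐ[volume]
      boltzmannRHS lam mu β F := by
  have hF := L1.integrable_coeFn F
  rw [boltzOp_eq]
  filter_upwards [rotIntegrand_integrable_ae hF hF,
    coeFn_collL isFlow_rot F F, coeFn_collL isFlow_rot F (gaussL hβ),
    coll_congr isFlow_rot hF (L1.integrable_coeFn (gaussL hβ)) (ae_eq_refl F) (coeFn_gaussL hβ),
    Lp.coeFn_add ((2 * lam) • (collL isFlow_rot F F - mass F • F))
      (mu • (collL isFlow_rot F (gaussL hβ) - F)),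
    Lp.coeFn_smul (2 * lam) (collL isFlow_rot F F - mass F • F),
    Lp.coeFn_sub (collL isFlow_rot F F) (mass F • F), Lp.coeFn_smul (mass F) F,
    Lp.coeFn_smul mu (collL isFlow_rot F (gaussL hβ) - F),
    Lp.coeFn_sub (collL isFlow_rot F (gaussL hβ)) F]
    with v hv h1 h2 h3 e1 e2 e3 e4 e5 e6
  rw [boltzmannRHS_eq hF hv, e1, Pi.add_apply, e2, Pi.smul_apply, e3, Pi.sub_apply, e4,
    Pi.smul_apply, e5, Pi.smul_apply, e6, Pi.sub_apply, h1, h2, h3, mass_apply]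
  simp only [smul_eq_mul]
  ring

lemma IsBoltzmannSolution.hasDerivWithinAt {f₀ : ℝ → ℝ} {F : ℝ → ℝ →₁[volume] ℝ}
    (hF : IsBoltzmannSolution lam mu β f₀ F) (t : ℝ) (ht : 0 ≤ t) :
    HasDerivWithinAt F (boltzQuad lam (F t) (F t) + boltzLin hβ mu (F t)) (Set.Ici 0) t := by
  obtain ⟨D, h1, h2⟩ := hF.2 t ht
  rwa [← Lp.ext (h2.trans (coeFn_boltzOp hβ (F t)).symm)]

lemma IsBoltzmannSolution.unique {lam mu β : ℝ} (hβ : 0 < β) {f₀ : ℝ → ℝ} {F G : ℝ → ℝ →₁[volume] ℝ}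
    (hF : IsBoltzmannSolution lam mu β f₀ F) (hG : IsBoltzmannSolution lam mu β f₀ G)
    {t : ℝ} (ht : 0 ≤ t) : F t = G t :=
  eq_of_quadratic_ode _ _ (hF.hasDerivWithinAt hβ) (hG.hasDerivWithinAt hβ)
    (Lp.ext (hF.1.trans hG.1.symm)) ht

/-- The total rate, increased by one to make it positive. -/
def rate (lam mu : ℝ) : ℝ := 2 * lam + mu + 1

/-- The bilinear map which generates the Wild sum of the Boltzmann equation. -/
def wildOp (lam mu : ℝ) : (ℝ →₁[volume] ℝ) →L[ℝ] (ℝ →₁[volume] ℝ) →L[ℝ] (ℝ →₁[volume] ℝ) :=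
  (rate lam mu)⁻¹ • ((2 * lam) • collL isFlow_rot
    + mu • massMul ((collL isFlow_rot).flip (gaussL hβ)) + massMul (ContinuousLinearMap.id ℝ _))

lemma wildOp_apply (F G : ℝ →₁[volume] ℝ) : wildOp hβ lam mu F G = (rate lam mu)⁻¹ •
    ((2 * lam) • collL isFlow_rot F G + mu • mass G • collL isFlow_rot F (gaussL hβ)
      + mass G • F) := rfl

lemma rate_pos (hlam : 0 ≤ lam) (hmu : 0 ≤ mu) : 0 < rate lam mu := by unfold rate; positivity

/-- When `G` has mass one, `wildOp` is a convex combination of three densities, with weights 2λ, μ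
and 1 divided by their sum. -/
lemma wildOp_mem (hlam : 0 ≤ lam) (hmu : 0 ≤ mu) (F : ℝ →₁[volume] ℝ) (hF : F ∈ densities ℝ)
    (G : ℝ →₁[volume] ℝ) (hG : G ∈ densities ℝ) : wildOp hβ lam mu F G ∈ densities ℝ := by
  have hr := rate_pos hlam hmu
  have h1 := collL_mem_densities isFlow_rot hF hG
  have h2 := collL_mem_densities isFlow_rot hF (gaussL_mem_densities hβ)
  rw [wildOp_apply, hG.2, one_smul, one_smul]
  constructor
  · exact smul_nonneg_L1 (by positivity) (add_nonneg (add_nonneg (smul_nonneg_L1 (by positivity) h1.1)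
      (smul_nonneg_L1 hmu h2.1)) hF.1)
  · simp only [map_smul, map_add, h1.2, h2.2, hF.2, smul_eq_mul, mul_one]
    exact inv_mul_cancel₀ hr.ne'

/-- The solution of the Boltzmann equation. -/
def boltzSol (lam mu : ℝ) (f₀ : ℝ →₁[volume] ℝ) (t : ℝ) : ℝ →₁[volume] ℝ :=
  wildSum (wildOp hβ lam mu) f₀ (rate lam mu) t

variable {f₀ : ℝ →₁[volume] ℝ}

lemma boltzCoeff_mem (hlam : 0 ≤ lam) (hmu : 0 ≤ mu) (h₀ : f₀ ∈ densities ℝ) (n : ℕ) :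
    wildCoeff (wildOp hβ lam mu) f₀ n ∈ densities ℝ :=
  wildCoeff_mem convex_densities h₀ (wildOp_mem hβ hlam hmu) n

lemma summable_powSum_of_mem {a : ℕ → ℝ →₁[volume] ℝ} (ha : ∀ n, a n ∈ densities ℝ) {z : ℝ}
    (h0 : 0 ≤ z) (h1 : z < 1) : Summable fun n => z ^ n • a n := by
  refine Summable.of_norm_bounded (summable_geometric_of_lt_one h0 h1) fun n => ?_
  rw [norm_smul, norm_eq_one_of_mem_densities (ha n), mul_one, norm_pow, Real.norm_of_nonneg h0]

lemma boltzSol_mem (hlam : 0 ≤ lam) (hmu : 0 ≤ mu) (h₀ : f₀ ∈ densities ℝ) {t : ℝ}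
    (ht : 0 ≤ t) : boltzSol hβ lam mu f₀ t ∈ densities ℝ := by
  have hz := wild_arg_mem (rate_pos hlam hmu) ht
  have hc := boltzCoeff_mem hβ hlam hmu h₀
  constructor
  · exact smul_nonneg_L1 (Real.exp_pos _).le (tsum_nonneg fun n => smul_nonneg_L1
      (pow_nonneg hz.1 n) (hc n).1)
  · rw [boltzSol, wildSum, map_smul, powSum, mass.map_tsum (summable_powSum_of_mem hc hz.1 hz.2)]
    simp only [map_smul, (hc _).2, smul_eq_mul, mul_one]
    rw [tsum_geometric_of_lt_one hz.1 hz.2, sub_sub_cancel]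
    exact mul_inv_cancel₀ (Real.exp_pos _).ne'

/-- The Wild equation and the Boltzmann equation differ only by factors of the mass, which is one
along the solution; the fictitious collision of rate one cancels against its own loss term. -/
lemma boltzSol_hasDerivAt (hlam : 0 ≤ lam) (hmu : 0 ≤ mu) (h₀ : f₀ ∈ densities ℝ) {t : ℝ}
    (ht : 0 ≤ t) : HasDerivAt (boltzSol hβ lam mu f₀)
      (boltzQuad lam (boltzSol hβ lam mu f₀ t) (boltzSol hβ lam mu f₀ t)
        + boltzLin hβ mu (boltzSol hβ lam mu f₀ t)) t := by
  have hr := rate_pos hlam hmu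
  have h := hasDerivAt_wildSum (H := wildOp hβ lam mu) (x₀ := f₀)
    (fun n => (norm_eq_one_of_mem_densities (boltzCoeff_mem hβ hlam hmu h₀ n)).le) hr ht
  refine h.congr_deriv ?_
  change rate lam mu • (wildOp hβ lam mu (boltzSol hβ lam mu f₀ t) (boltzSol hβ lam mu f₀ t)
    - boltzSol hβ lam mu f₀ t) = _
  rw [wildOp_apply, boltzOp_eq, (boltzSol_mem hβ hlam hmu h₀ ht).2, smul_sub,
    smul_inv_smul₀ hr.ne', rate]
  module

lemma isBoltzmannSolution_boltzSol (hlam : 0 ≤ lam) (hmu : 0 ≤ mu) (h₀ : f₀ ∈ densities ℝ) :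
    IsBoltzmannSolution lam mu β f₀ (boltzSol hβ lam mu f₀) :=
  ⟨by rw [boltzSol, wildSum_zero], fun _ ht =>
    ⟨_, (boltzSol_hasDerivAt hβ hlam hmu h₀ ht).hasDerivWithinAt, coeFn_boltzOp hβ _⟩⟩

end boltzmann

/-! ### The Boltzmann equation at almost every velocity -/

section pointwise

lemma hasSum_of_eq {ι : Type*} {f g : ι → ℝ} {s : ℝ} (h : HasSum g s) (hfg : ∀ i, f i = g i) :
    HasSum f s := (funext hfg : f = g) ▸ h

variable {a b : ℕ → ℝ →₁[volume] ℝ}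

/-- The pointwise sum of a power series in `L¹`. -/
def ptSum (a : ℕ → ℝ →₁[volume] ℝ) (z v : ℝ) : ℝ := powSum (fun n => a n v) z

lemma ptSum_hasSum_ae (ha : ∀ n, a n ∈ densities ℝ) {z : ℝ} (h0 : 0 ≤ z) (h1 : z < 1) :
    ∀ᵐ v, HasSum (fun n => z ^ n * a n v) ((powSum a z : ℝ →₁[volume] ℝ) v) := by
  have h2 : ∑' n, ‖z ^ n • a n‖ₑ ≠ ⊤ := by
    have h3 : Summable fun n => ‖z ^ n • a n‖ := by
      simp only [norm_smul, norm_eq_one_of_mem_densities (ha _), mul_one, norm_pow,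
        Real.norm_of_nonneg h0]
      exact summable_geometric_of_lt_one h0 h1
    exact tsum_enorm_ne_top_iff_summable_norm.2 h3
  filter_upwards [Lp.hasSum_coeFn_tsum h2, ae_all_iff.2 fun n => Lp.coeFn_smul (z ^ n) (a n)]
    with v hv hn
  refine hasSum_of_eq hv fun n => ?_
  rw [hn, Pi.smul_apply, smul_eq_mul]

lemma ptSum_ae_eq (ha : ∀ n, a n ∈ densities ℝ) {z : ℝ} (h0 : 0 ≤ z) (h1 : z < 1) :
    ptSum a z =ᵐ[volume] (powSum a z : ℝ →₁[volume] ℝ) := by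
  filter_upwards [ptSum_hasSum_ae ha h0 h1] with v hv
  exact hv.tsum_eq

lemma exists_nat_ratio {z : ℝ} (h1 : z < 1) : ∃ m : ℕ, z ≤ m / (m + 1) := by
  obtain ⟨m, hm⟩ := exists_nat_ge (1 / (1 - z))
  refine ⟨m, ?_⟩
  have h2 : 0 < 1 - z := by linarith
  rw [div_le_iff₀ h2] at hm
  rw [le_div_iff₀ (by positivity)]
  linarith

lemma nat_ratio_lt_one (m : ℕ) : (m : ℝ) / (m + 1) < 1 := by
  rw [div_lt_one (by positivity)]; linarith

/-- The points where a power series with nonnegative coefficients converges in the unit disc. -/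
def ConvAt (a : ℕ → ℝ →₁[volume] ℝ) (v : ℝ) : Prop :=
  (∀ n, 0 ≤ a n v) ∧ ∀ z : ℝ, 0 ≤ z → z < 1 → Summable fun n => z ^ n * a n v

/-- Convergence in L¹ gives a null set for each `z`. Only the countably many radii `m / (m + 1)` are
used, and nonnegativity of the terms carries convergence to every smaller `z`, so a single null set
serves all `z`. -/
lemma convAt_ae (ha : ∀ n, a n ∈ densities ℝ) : ∀ᵐ v, ConvAt a v := by
  have h1 : ∀ᵐ v, ∀ m : ℕ, HasSum (fun n => ((m : ℝ) / (m + 1)) ^ n * a n v)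
      ((powSum a ((m : ℝ) / (m + 1)) : ℝ →₁[volume] ℝ) v) :=
    ae_all_iff.2 fun m => ptSum_hasSum_ae ha (by positivity) (nat_ratio_lt_one m)
  filter_upwards [h1, ae_all_iff.2 fun n => (Lp.coeFn_nonneg (a n)).2 (ha n).1] with v h2 h3
  refine ⟨h3, fun z hz0 hz1 => ?_⟩
  obtain ⟨m, hm⟩ := exists_nat_ratio hz1
  refine Summable.of_nonneg_of_le (fun n => mul_nonneg (by positivity) (h3 n)) (fun n => ?_)
    (h2 m).summable
  exact mul_le_mul_of_nonneg_right (by gcongr) (h3 n)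

lemma ConvAt.hasSum {v : ℝ} (h : ConvAt a v) {z : ℝ} (h0 : 0 ≤ z) (h1 : z < 1) :
    HasSum (fun n => z ^ n * a n v) (ptSum a z v) := (h.2 z h0 h1).hasSum

lemma integrable_ptSum (ha : ∀ n, a n ∈ densities ℝ) {z : ℝ} (h0 : 0 ≤ z) (h1 : z < 1) :
    Integrable (ptSum a z) :=
  (L1.integrable_coeFn (powSum a z)).congr (ptSum_ae_eq ha h0 h1).symm

lemma convAt_rot_ae (ha : ∀ n, a n ∈ densities ℝ) (hb : ∀ n, b n ∈ densities ℝ) :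
    ∀ᵐ v, ∀ᵐ q : ℝ × ℝ ∂(volume.prod angleMeasure),
      ConvAt a (rot q.2 (v, q.1)).1 ∧ ConvAt b (rot q.2 (v, q.1)).2 := by
  have h1 : ∀ᵐ p : ℝ × ℝ, ConvAt a p.1 ∧ ConvAt b p.2 :=
    (Measure.quasiMeasurePreserving_fst.ae (convAt_ae ha)).and
      (Measure.quasiMeasurePreserving_snd.ae (convAt_ae hb))
  have h2 : ∀ᵐ q : (ℝ × ℝ) × ℝ ∂((volume : Measure (ℝ × ℝ)).prod angleMeasure),
      ConvAt a (rot q.2 q.1).1 ∧ ConvAt b (rot q.2 q.1).2 :=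
    isFlow_rot.preserving_skew.quasiMeasurePreserving.ae
      (Measure.quasiMeasurePreserving_fst.ae h1)
  rw [Measure.volume_eq_prod] at h2
  have h3 := (measurePreserving_prodAssoc (volume : Measure ℝ) (volume : Measure ℝ)
    angleMeasure).symm.quasiMeasurePreserving.ae h2
  exact Measure.ae_ae_of_ae_prod h3

/-- For almost every velocity, the collision integral of two power series is the double series of
the collision integrals. -/
lemma hasSum_coll_ptSum_ae (ha : ∀ n, a n ∈ densities ℝ) (hb : ∀ n, b n ∈ densities ℝ) :
    ∀ᵐ v, ∀ z : ℝ, 0 ≤ z → z < 1 →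
      Integrable (rotIntegrand (ptSum a z) (ptSum b z) v) (volume.prod angleMeasure) ∧
      HasSum (fun p : ℕ × ℕ => z ^ (p.1 + p.2) * coll rot (a p.1) (b p.2) v)
        (coll rot (ptSum a z) (ptSum b z) v) := by
  have H1 : ∀ᵐ v, ∀ m : ℕ, Integrable (rotIntegrand (ptSum a ((m : ℝ) / (m + 1)))
      (ptSum b ((m : ℝ) / (m + 1))) v) (volume.prod angleMeasure) :=
    ae_all_iff.2 fun m => rotIntegrand_integrable_ae
      (integrable_ptSum ha (by positivity) (nat_ratio_lt_one m))
      (integrable_ptSum hb (by positivity) (nat_ratio_lt_one m))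
  have H2 : ∀ᵐ v, ∀ p : ℕ × ℕ, Integrable (rotIntegrand (a p.1) (b p.2) v)
      (volume.prod angleMeasure) :=
    ae_all_iff.2 fun p => rotIntegrand_integrable_ae (L1.integrable_coeFn _)
      (L1.integrable_coeFn _)
  filter_upwards [H1, H2, convAt_rot_ae ha hb] with v h1 h2 h3 z hz0 hz1
  -- The null set was fixed before `z`. The series at a countable radius `r ≥ z` dominates the one
  -- at `z`, since all terms are nonnegative, and permits termwise integration.
  obtain ⟨m, hm⟩ := exists_nat_ratio hz1
  set r : ℝ := (m : ℝ) / (m + 1)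
  have hr0 : 0 ≤ r := by positivity
  have hr1 : r < 1 := nat_ratio_lt_one m
  have hsum : ∀ s : ℝ, 0 ≤ s → s < 1 → ∀ᵐ q ∂(volume.prod angleMeasure),
      HasSum (fun p : ℕ × ℕ => s ^ (p.1 + p.2) * rotIntegrand (a p.1) (b p.2) v q)
        (rotIntegrand (ptSum a s) (ptSum b s) v q) := by
    intro s hs0 hs1
    filter_upwards [h3] with q hq
    have e1 := hq.1.hasSum hs0 hs1
    have e2 := hq.2.hasSum hs0 hs1
    have e3 := e1.mul e2 (e1.summable.mul_of_nonneg e2.summable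
      (fun n => mul_nonneg (by positivity) (hq.1.1 n))
      fun n => mul_nonneg (by positivity) (hq.2.1 n))
    refine hasSum_of_eq e3 fun p => ?_
    rw [pow_add, rotIntegrand]; ring
  have hmeas : ∀ p : ℕ × ℕ, AEStronglyMeasurable (fun q => z ^ (p.1 + p.2) *
      rotIntegrand (a p.1) (b p.2) v q) (volume.prod angleMeasure) :=
    fun p => ((h2 p).const_mul _).aestronglyMeasurable
  have hnn : ∀ᵐ q ∂(volume.prod angleMeasure), ∀ p : ℕ × ℕ,
      0 ≤ rotIntegrand (a p.1) (b p.2) v q := by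
    filter_upwards [h3] with q hq p using mul_nonneg (hq.1.1 _) (hq.2.1 _)
  have hpow : ∀ n, z ^ n ≤ r ^ n := fun n => by gcongr
  have hint : Integrable (rotIntegrand (ptSum a z) (ptSum b z) v) (volume.prod angleMeasure) := by
    refine (h1 m).mono' ?_ ?_
    · refine aestronglyMeasurable_of_tendsto_ae (atTop : Filter (Finset (ℕ × ℕ)))
        (f := fun s q => ∑ p ∈ s, z ^ (p.1 + p.2) * rotIntegrand (a p.1) (b p.2) v q)
        (fun s => Finset.aestronglyMeasurable_fun_sum s fun p _ => hmeas p) ?_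
      filter_upwards [hsum z hz0 hz1] with q hq using hq
    · filter_upwards [hsum z hz0 hz1, hsum r hr0 hr1, hnn] with q hq1 hq2 hq3
      rw [Real.norm_of_nonneg (hq1.nonneg fun p => mul_nonneg (by positivity) (hq3 p))]
      exact hasSum_le (fun p => mul_le_mul_of_nonneg_right (hpow _) (hq3 p)) hq1 hq2
  refine ⟨hint, ?_⟩
  rw [coll_eq_of_integrable hint]
  have hfin := hasSum_integral_of_dominated_convergence (μ := volume.prod angleMeasure)
    (F := fun (p : ℕ × ℕ) q => z ^ (p.1 + p.2) * rotIntegrand (a p.1) (b p.2) v q)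
    (f := rotIntegrand (ptSum a z) (ptSum b z) v)
    (fun p q => r ^ (p.1 + p.2) * rotIntegrand (a p.1) (b p.2) v q) hmeas ?_ ?_ ?_ (hsum z hz0 hz1)
  · refine hasSum_of_eq hfin fun p => ?_
    rw [integral_const_mul, coll_eq_of_integrable (h2 p)]
    rfl
  · intro p
    filter_upwards [hnn] with q hq
    rw [Real.norm_of_nonneg (mul_nonneg (by positivity) (hq p))]
    exact mul_le_mul_of_nonneg_right (hpow _) (hq p)
  · filter_upwards [hsum r hr0 hr1] with q hq using hq.summable
  · refine (h1 m).congr ?_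
    filter_upwards [hsum r hr0 hr1] with q hq using hq.tsum_eq.symm

variable {lam mu β : ℝ} (hβ : 0 < β) {f₀ : ℝ →₁[volume] ℝ}

/-- Representatives of the solution of the Boltzmann equation. -/
def boltzPt (lam mu : ℝ) (f₀ : ℝ →₁[volume] ℝ) (t v : ℝ) : ℝ :=
  exp (-(rate lam mu * t)) *
    ptSum (wildCoeff (wildOp hβ lam mu) f₀) (1 - exp (-(rate lam mu * t))) v

lemma wildCoeff_succ_ae (n : ℕ) : ∀ᵐ v, ((n : ℝ) + 1) * wildCoeff (wildOp hβ lam mu) f₀ (n + 1) v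
    = ∑ p ∈ Finset.HasAntidiagonal.antidiagonal n,
      wildOp hβ lam mu (wildCoeff (wildOp hβ lam mu) f₀ p.1)
        (wildCoeff (wildOp hβ lam mu) f₀ p.2) v := by
  have h := wildCoeff_succ (wildOp hβ lam mu) f₀ n
  filter_upwards [Lp.coeFn_smul ((n : ℝ) + 1) (wildCoeff (wildOp hβ lam mu) f₀ (n + 1)),
    Lp.coeFn_fun_finsetSum (Finset.HasAntidiagonal.antidiagonal n) fun p : ℕ × ℕ =>
      wildOp hβ lam mu (wildCoeff (wildOp hβ lam mu) f₀ p.1)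
        (wildCoeff (wildOp hβ lam mu) f₀ p.2)] with v h1 h2
  rw [← h2, ← h, h1, Pi.smul_apply, smul_eq_mul]

lemma wildOp_ae (F G : ℝ →₁[volume] ℝ) (hG : mass G = 1) : wildOp hβ lam mu F G =ᵐ[volume]
    fun v => (rate lam mu)⁻¹ * (2 * lam * coll rot F G v + mu * coll rot F (gaussL hβ) v + F v) := by
  rw [wildOp_apply, hG, one_smul, one_smul]
  filter_upwards [coeFn_collL isFlow_rot F G, coeFn_collL isFlow_rot F (gaussL hβ),
    Lp.coeFn_smul (rate lam mu)⁻¹ ((2 * lam) • collL isFlow_rot F G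
      + mu • collL isFlow_rot F (gaussL hβ) + F),
    Lp.coeFn_add ((2 * lam) • collL isFlow_rot F G + mu • collL isFlow_rot F (gaussL hβ)) F,
    Lp.coeFn_add ((2 * lam) • collL isFlow_rot F G) (mu • collL isFlow_rot F (gaussL hβ)),
    Lp.coeFn_smul (2 * lam) (collL isFlow_rot F G),
    Lp.coeFn_smul mu (collL isFlow_rot F (gaussL hβ))] with v h1 h2 e1 e2 e3 e4 e5
  rw [e1, Pi.smul_apply, e2, Pi.add_apply, e3, Pi.add_apply, e4, e5, Pi.smul_apply, Pi.smul_apply,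
    h1, h2]
  rfl

/-- The exceptional set depends only on the representative of the Gaussian. Uniformity in `f` is
essential, because `f` will be the solution at an arbitrary time. -/
lemma coll_rot_gaussL_ae : ∀ᵐ v, ∀ f : ℝ → ℝ,
    coll rot f (gaussL hβ) v = coll rot f (gauss β) v := by
  have h1 : ∀ᵐ p : ℝ × ℝ, gaussL hβ p.2 = gauss β p.2 :=
    Measure.quasiMeasurePreserving_snd.ae (coeFn_gaussL hβ)
  filter_upwards [Measure.ae_ae_of_ae_prod (isFlow_rot.ae_of_ae h1)] with v hv f
  refine integral_congr_ae ?_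
  filter_upwards [hv] with w hw
  refine integral_congr_ae ?_
  filter_upwards [hw] with θ hθ
  simp only [tensor, hθ]

lemma isPointwiseSolution_boltzPt (hlam : 0 ≤ lam) (hmu : 0 ≤ mu) (h₀ : f₀ ∈ densities ℝ) :
    IsPointwiseSolution lam mu β (boltzSol hβ lam mu f₀) (boltzPt hβ lam mu f₀) := by
  have hr := rate_pos hlam hmu
  set a := wildCoeff (wildOp hβ lam mu) f₀ with ha_def
  have ha : ∀ n, a n ∈ densities ℝ := boltzCoeff_mem hβ hlam hmu h₀
  have hrep : ∀ t, 0 ≤ t → boltzPt hβ lam mu f₀ t =ᵐ[volume] boltzSol hβ lam mu f₀ t := by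
    intro t ht
    have hz := wild_arg_mem hr ht
    filter_upwards [ptSum_ae_eq ha hz.1 hz.2, Lp.coeFn_smul (exp (-(rate lam mu * t)))
      (powSum a (1 - exp (-(rate lam mu * t))))] with v h1 h2
    rw [boltzPt, boltzSol, wildSum, ← ha_def, h2, h1]
    rfl
  refine ⟨hrep, ?_⟩
  have hrec : ∀ᵐ v, ∀ n : ℕ, ((n : ℝ) + 1) * a (n + 1) v
      = ∑ p ∈ Finset.HasAntidiagonal.antidiagonal n, wildOp hβ lam mu (a p.1) (a p.2) v :=
    ae_all_iff.2 fun n => wildCoeff_succ_ae hβ n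
  have hop : ∀ᵐ v, ∀ p : ℕ × ℕ, wildOp hβ lam mu (a p.1) (a p.2) v = (rate lam mu)⁻¹ *
      (2 * lam * coll rot (a p.1) (a p.2) v + mu * coll rot (a p.1) (gaussL hβ) v + a p.1 v) :=
    ae_all_iff.2 fun p => wildOp_ae hβ _ _ (ha p.2).2
  filter_upwards [convAt_ae ha, hrec, hop, hasSum_coll_ptSum_ae ha ha,
    hasSum_coll_ptSum_ae ha (fun _ => gaussL_mem_densities hβ), coll_rot_gaussL_ae hβ]
    with v hc h1 h2 h3 h4 h5 t ht
  have hz := wild_arg_mem hr ht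
  set z := 1 - exp (-(rate lam mu * t)) with hz_def
  have hez : exp (-(rate lam mu * t)) = 1 - z := by rw [hz_def]; ring
  have hz1 : 1 - z ≠ 0 := by linarith [hz.2]
  have hgeo := hasSum_geometric_of_lt_one hz.1 hz.2
  -- All coefficients have mass one, so the mass factors in `wildOp` sum to a geometric series. The
  -- thermostat term is thus a double series with constant second sequence, and the idle term is a
  -- product with the geometric series itself.
  have hγ : ptSum (fun _ => gaussL hβ) z = (1 - z)⁻¹ • (gaussL hβ : ℝ → ℝ) := by
    ext w
    exact (hgeo.mul_right _).tsum_eq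
  have k1 := (h3 z hz.1 hz.2).2
  have k2 := (h4 z hz.1 hz.2).2
  have k3 := (hc.hasSum hz.1 hz.2).mul hgeo ((hc.2 z hz.1 hz.2).mul_of_nonneg
    (summable_geometric_of_lt_one hz.1 hz.2)
    (fun n => mul_nonneg (pow_nonneg hz.1 n) (hc.1 n)) fun n => pow_nonneg hz.1 n)
  have k4 := coll_smul_smul (T := rot) 1 (1 - z)⁻¹ (ptSum a z) (gaussL hβ) v
  rw [one_smul, one_mul] at k4
  rw [hγ, k4, h5] at k2
  have hsum := ((k1.mul_left (2 * lam)).add (k2.mul_left mu)).add k3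
  have hD := hasSum_of_eq (f := fun p : ℕ × ℕ => z ^ (p.1 + p.2) •
    wildOp hβ lam mu (a p.1) (a p.2) v) (hsum.mul_left (rate lam mu)⁻¹) fun p => by
      rw [h2, smul_eq_mul, pow_add]; ring
  have hD' := hasSum_antidiagonal hD
  simp only [← h1] at hD'
  have hder := hasDerivAt_exp_smul_powSum (a := fun n => a n v) (fun r hr0 hr1 => by
    simpa only [Real.norm_of_nonneg (hc.1 _)] using hc.2 r hr0 hr1) hr ht hD'
  refine HasDerivAt.hasDerivWithinAt (hder.congr_deriv ?_)
  have hf : boltzPt hβ lam mu f₀ t = (1 - z) • ptSum a z := by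
    ext w; rw [← hez]; rfl
  have hi : Integrable (boltzPt hβ lam mu f₀ t) :=
    (L1.integrable_coeFn _).congr (hrep t ht).symm
  have hm : ∫ w, boltzPt hβ lam mu f₀ t w = 1 := by
    rw [integral_congr_ae (hrep t ht), ← mass_apply]
    exact (boltzSol_mem hβ hlam hmu h₀ ht).2
  have hri : Integrable (rotIntegrand (boltzPt hβ lam mu f₀ t) (boltzPt hβ lam mu f₀ t) v)
      (volume.prod angleMeasure) := by
    have := ((h3 z hz.1 hz.2).1).const_mul ((1 - z) * (1 - z))
    refine this.congr (ae_of_all _ fun q => ?_)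
    rw [hf]
    simp only [rotIntegrand, Pi.smul_apply, smul_eq_mul]
    ring
  have k5 := coll_smul_smul (T := rot) (1 - z) 1 (ptSum a z) (gauss β) v
  rw [one_smul, mul_one] at k5
  rw [boltzmannRHS_eq hi hri, hm, hf, coll_smul_smul, k5]
  simp only [smul_eq_mul, Pi.smul_apply, hez, sub_sub_cancel]
  change _ - rate lam mu * ((1 - z) * ptSum a z v) = _
  field_simp
  rw [rate]
  ring

end pointwise

/-! ### The generator of the master equation on L¹ -/

section master

variable {N : ℕ}

/-- The angular average over the collisions of two particles as an operator on `L¹`. -/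
def pairL (i j : Fin N) : ((Fin N → ℝ) →₁[volume] ℝ) →L[ℝ] ((Fin N → ℝ) →₁[volume] ℝ) :=
  if h : i ≠ j then (isFlow_collide h).isL1Op.toCLM else 0

lemma coeFn_pairL {i j : Fin N} (h : i ≠ j) (F : (Fin N → ℝ) →₁[volume] ℝ) :
    pairL i j F =ᵐ[volume] avg (fun θ v => collide v i j θ) F := by
  rw [pairL, dif_pos h]
  exact IsL1Op.coeFn_toCLM _ F

lemma norm_pairL_le (i j : Fin N) (F : (Fin N → ℝ) →₁[volume] ℝ) : ‖pairL i j F‖ ≤ ‖F‖ := by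
  unfold pairL
  split_ifs with h
  · exact IsL1Op.norm_toCLM_le _ F
  · simp

lemma collide_comm (v : Fin N → ℝ) {i j : Fin N} (h : i ≠ j) (θ : ℝ) :
    collide v j i θ = collide v i j (-θ) := by
  ext k
  rw [collide_apply _ h, collide_apply _ h.symm, cos_neg, sin_neg]
  split_ifs with h1 h2 h3
  · exact absurd (h2.symm.trans h1) h
  · ring
  · ring
  · rfl

/-- Exchanging the two particles reverses the angle, and the average runs over a full period. -/
lemma pairL_comm (i j : Fin N) : pairL i j = pairL j i := by
  by_cases h : i = j
  · rw [h]
  ext1 F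
  refine Lp.ext ?_
  filter_upwards [coeFn_pairL h F, coeFn_pairL (Ne.symm h) F] with v h1 h2
  rw [h1, h2]
  simp only [avg, collide_comm v h]
  refine (integral_angle_neg (h := fun θ => F (collide v i j θ)) fun θ => ?_).symm
  simp only [collide, cos_add_two_pi, sin_add_two_pi]

/-- The thermostat operator on `L¹`. -/
def thermL {β : ℝ} (hβ : 0 < β) (j : Fin N) :
    ((Fin N → ℝ) →₁[volume] ℝ) →L[ℝ] ((Fin N → ℝ) →₁[volume] ℝ) :=
  (collL (isFlow_kick j)).flip (gaussL hβ)

/-- The thermostat is a collision with an extra particle of Gaussian law whose outgoing velocity is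
forgotten, so it is covered by the same bilinear operator as the Boltzmann gain term. -/
lemma thermR_eq_coll (β : ℝ) (j : Fin N) (f : (Fin N → ℝ) → ℝ) :
    thermR β j f = coll (kick j) f (gauss β) := by
  ext v
  simp only [thermR, intervalAverage_eq, mul_comm (gauss β _)]
  rfl

lemma coeFn_thermL {β : ℝ} (hβ : 0 < β) (j : Fin N) (F : (Fin N → ℝ) →₁[volume] ℝ) :
    thermL hβ j F =ᵐ[volume] thermR β j F := by
  rw [thermR_eq_coll]
  exact (coeFn_collL (isFlow_kick j) F (gaussL hβ)).trans (coll_congr (isFlow_kick j)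
    (L1.integrable_coeFn F) (L1.integrable_coeFn (gaussL hβ)) (ae_eq_refl F) (coeFn_gaussL hβ))

lemma norm_thermL_le {β : ℝ} (hβ : 0 < β) (j : Fin N) (F : (Fin N → ℝ) →₁[volume] ℝ) :
    ‖thermL hβ j F‖ ≤ ‖F‖ := by
  have := norm_collL_le (isFlow_kick j) F (gaussL hβ)
  rwa [norm_eq_one_of_mem_densities (gaussL_mem_densities hβ), mul_one] at this

/-- The generator of the master equation on `L¹`. -/
def masterL (lam mu : ℝ) {β : ℝ} (hβ : 0 < β) (N : ℕ) :
    ((Fin N → ℝ) →₁[volume] ℝ) →L[ℝ] ((Fin N → ℝ) →₁[volume] ℝ) :=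
  -((lam * N) • (ContinuousLinearMap.id ℝ _
      - (1 / (N.choose 2 : ℝ)) • ∑ i : Fin N, ∑ j ∈ Finset.Ioi i, pairL i j))
    - mu • ∑ j : Fin N, (ContinuousLinearMap.id ℝ _ - thermL hβ j)

lemma masterL_apply (lam mu : ℝ) {β : ℝ} (hβ : 0 < β) (F : (Fin N → ℝ) →₁[volume] ℝ) :
    masterL lam mu hβ N F = -((lam * N) • (F - (1 / (N.choose 2 : ℝ)) •
      ∑ i : Fin N, ∑ j ∈ Finset.Ioi i, pairL i j F)) - mu • ∑ j : Fin N, (F - thermL hβ j F) := by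
  simp [masterL, _root_.sum_apply]

lemma coeFn_masterL (lam mu : ℝ) {β : ℝ} (hβ : 0 < β) (F : (Fin N → ℝ) →₁[volume] ℝ) :
    masterL lam mu hβ N F =ᵐ[volume] masterRHS lam mu β F := by
  rw [masterL_apply]
  have hpair : ∀ᵐ v, ∀ i j : Fin N, i ≠ j →
      pairL i j F v = avg (fun θ v => collide v i j θ) F v := by
    rw [ae_all_iff]; intro i
    rw [ae_all_iff]; intro j
    by_cases h : i = j
    · exact ae_of_all _ fun v h' => absurd h h'
    · filter_upwards [coeFn_pairL h F] with v hv _ using hv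
  have hth : ∀ᵐ v, ∀ j : Fin N, thermL hβ j F v = thermR β j F v :=
    ae_all_iff.2 fun j => coeFn_thermL hβ j F
  have hs1 : ∀ᵐ v, ∀ i : Fin N, (∑ j ∈ Finset.Ioi i, pairL i j F : (Fin N → ℝ) →₁[volume] ℝ) v
      = ∑ j ∈ Finset.Ioi i, pairL i j F v :=
    ae_all_iff.2 fun i => Lp.coeFn_fun_finsetSum _ _
  have hsub : ∀ᵐ v, ∀ j : Fin N, (F - thermL hβ j F : (Fin N → ℝ) →₁[volume] ℝ) v
      = F v - thermL hβ j F v := ae_all_iff.2 fun j => Lp.coeFn_sub _ _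
  filter_upwards [hpair, hth, hs1, hsub,
    Lp.coeFn_fun_finsetSum Finset.univ fun i : Fin N => ∑ j ∈ Finset.Ioi i, pairL i j F,
    Lp.coeFn_fun_finsetSum Finset.univ fun j : Fin N => F - thermL hβ j F,
    Lp.coeFn_sub (-((lam * N) • (F - (1 / (N.choose 2 : ℝ)) •
      ∑ i : Fin N, ∑ j ∈ Finset.Ioi i, pairL i j F))) (mu • ∑ j : Fin N, (F - thermL hβ j F)),
    Lp.coeFn_neg ((lam * N) • (F - (1 / (N.choose 2 : ℝ)) •
      ∑ i : Fin N, ∑ j ∈ Finset.Ioi i, pairL i j F)),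
    Lp.coeFn_smul (lam * N) (F - (1 / (N.choose 2 : ℝ)) •
      ∑ i : Fin N, ∑ j ∈ Finset.Ioi i, pairL i j F),
    Lp.coeFn_sub F ((1 / (N.choose 2 : ℝ)) • ∑ i : Fin N, ∑ j ∈ Finset.Ioi i, pairL i j F),
    Lp.coeFn_smul (1 / (N.choose 2 : ℝ)) (∑ i : Fin N, ∑ j ∈ Finset.Ioi i, pairL i j F),
    Lp.coeFn_smul mu (∑ j : Fin N, (F - thermL hβ j F))]
    with v h1 h2 h3 h4 e1 e2 e3 e4 e5 e6 e7 e8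
  rw [e3, Pi.sub_apply, e4, Pi.neg_apply, e5, Pi.smul_apply, e6, Pi.sub_apply, e7, Pi.smul_apply,
    e8, Pi.smul_apply, e1, e2]
  simp only [h3, h4, h2, smul_eq_mul, masterRHS, kacQ]
  congr 5
  refine Finset.sum_congr rfl fun i _ => Finset.sum_congr rfl fun j hj => ?_
  exact h1 i j (Finset.mem_Ioi.1 hj).ne

lemma IsMasterSolution.hasDerivWithinAt {lam mu β : ℝ} (hβ : 0 < β)
    {f : ℝ → (Fin N → ℝ) →₁[volume] ℝ} (hf : IsMasterSolution lam mu β f) (t : ℝ) (ht : 0 ≤ t) :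
    HasDerivWithinAt f (masterL lam mu hβ N (f t)) (Set.Ici 0) t := by
  obtain ⟨D, h1, h2⟩ := hf t ht
  rwa [← Lp.ext (h2.trans (coeFn_masterL lam mu hβ (f t)).symm)]

lemma card_pairs (N : ℕ) : ∑ i : Fin N, (Finset.Ioi i).card = N.choose 2 := by
  simp only [Fin.card_Ioi]
  rw [Fin.sum_univ_eq_sum_range (fun i => N - 1 - i) N, Finset.sum_range_reflect (fun i => i) N,
    Finset.sum_range_id, Nat.choose_two_right]

/-- Adding back the total loss rate leaves only gain terms, which are contractions whose weights add
up to that same rate. -/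
lemma norm_masterL_add_le {lam mu β : ℝ} (hβ : 0 < β) (hlam : 0 ≤ lam) (hmu : 0 ≤ mu)
    (hN : 2 ≤ N) (F : (Fin N → ℝ) →₁[volume] ℝ) :
    ‖masterL lam mu hβ N F + (lam * N + mu * N) • F‖ ≤ (lam * N + mu * N) * ‖F‖ := by
  have hc : (0 : ℝ) < N.choose 2 := by exact_mod_cast Nat.choose_pos hN
  have e : masterL lam mu hβ N F + (lam * N + mu * N) • F =
      (lam * N) • (1 / (N.choose 2 : ℝ)) • ∑ i : Fin N, ∑ j ∈ Finset.Ioi i, pairL i j F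
        + mu • ∑ j : Fin N, thermL hβ j F := by
    rw [masterL_apply, Finset.sum_sub_distrib]
    simp only [Finset.sum_const, Finset.card_univ, Fintype.card_fin]
    rw [← Nat.cast_smul_eq_nsmul ℝ]
    module
  have h1 : ‖∑ i : Fin N, ∑ j ∈ Finset.Ioi i, pairL i j F‖ ≤ N.choose 2 * ‖F‖ := by
    rw [← card_pairs, Nat.cast_sum, Finset.sum_mul]
    refine norm_sum_le_of_le _ fun i _ => ?_
    refine (norm_sum_le_of_le _ fun j _ => norm_pairL_le i j F).trans_eq ?_
    simp
  have h2 : ‖∑ j : Fin N, thermL hβ j F‖ ≤ N * ‖F‖ := by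
    refine (norm_sum_le_of_le _ fun j _ => norm_thermL_le hβ j F).trans_eq ?_
    simp
  rw [e]
  refine (norm_add_le _ _).trans ?_
  rw [norm_smul, norm_smul, norm_smul, Real.norm_of_nonneg hmu,
    Real.norm_of_nonneg (by positivity : 0 ≤ lam * N),
    Real.norm_of_nonneg (by positivity : 0 ≤ 1 / (N.choose 2 : ℝ))]
  calc _ ≤ lam * N * (1 / (N.choose 2 : ℝ) * (N.choose 2 * ‖F‖)) + mu * (N * ‖F‖) := by gcongr
    _ = _ := by field_simp

/-- With the integrating factor `exp (c * t)`, Grönwall's bound grows exactly like that factor,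
which then cancels. Positivity of `f t` is not needed for the later estimates; this norm bound is
enough. -/
lemma IsMasterSolution.norm_le {lam mu β : ℝ} (hβ : 0 < β) (hlam : 0 ≤ lam) (hmu : 0 ≤ mu)
    (hN : 2 ≤ N) {f : ℝ → (Fin N → ℝ) →₁[volume] ℝ} (hf : IsMasterSolution lam mu β f) {t : ℝ}
    (ht : 0 ≤ t) : ‖f t‖ ≤ ‖f 0‖ := by
  set c := lam * N + mu * N
  have hd : ∀ s, 0 ≤ s → HasDerivWithinAt (fun s => exp (c * s) • f s)
      (exp (c * s) • (masterL lam mu hβ N (f s) + c • f s)) (Set.Ici 0) s := by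
    intro s hs
    have h1 : HasDerivAt (fun s => exp (c * s)) (exp (c * s) * c) s := by
      have : HasDerivAt (fun s => c * s) c s := by simpa using (hasDerivAt_id s).const_mul c
      exact this.exp
    refine (h1.hasDerivWithinAt.smul (hf.hasDerivWithinAt hβ s hs)).congr_deriv ?_
    module
  have h2 := norm_le_gronwallBound_of_norm_deriv_right_le (f := fun s => exp (c * s) • f s)
    (f' := fun s => exp (c * s) • (masterL lam mu hβ N (f s) + c • f s)) (δ := ‖f 0‖) (K := c)
    (ε := 0) (a := 0) (b := t)
    (fun s hs => ((hd s hs.1).continuousWithinAt).mono Set.Icc_subset_Ici_self)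
    (fun s hs => (hd s hs.1).mono (Set.Ici_subset_Ici.2 hs.1)) (by simp) (fun s hs => by
      rw [norm_smul, norm_smul, add_zero, mul_left_comm]
      exact mul_le_mul_of_nonneg_left (norm_masterL_add_le hβ hlam hmu hN _) (norm_nonneg _))
    t ⟨ht, le_rfl⟩
  rw [gronwallBound_ε0, sub_zero, norm_smul, Real.norm_of_nonneg (Real.exp_pos _).le,
    mul_comm] at h2
  exact le_of_mul_le_mul_right h2 (Real.exp_pos _)

end master

/-! ### Permutation symmetry is preserved in time -/

section symmetry

variable {N : ℕ}

lemma measurePreserving_comp_perm (σ : Equiv.Perm (Fin N)) :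
    MeasurePreserving (fun (v : Fin N → ℝ) i => v (σ i)) volume volume := by
  have h := volume_measurePreserving_piCongrLeft (fun _ : Fin N => ℝ) σ.symm
  convert h using 1
  ext v i
  simp [MeasurableEquiv.piCongrLeft, Equiv.piCongrLeft]

lemma isL1Op_perm (σ : Equiv.Perm (Fin N)) :
    IsL1Op (fun (f : (Fin N → ℝ) → ℝ) (v : Fin N → ℝ) => f fun i => v (σ i)) where
  integrable hf := (measurePreserving_comp_perm σ).integrable_comp_of_integrable hf
  congr _ h := (measurePreserving_comp_perm σ).quasiMeasurePreserving.ae h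
  add _ _ := ae_eq_refl _
  smul _ _ _ := ae_eq_refl _
  norm_le {f} hf := by
    have h := (measurePreserving_comp_perm σ)
    have h2 := integral_map h.measurable.aemeasurable (f := fun v => |f v|)
      (by rw [h.map_eq]; exact hf.abs.aestronglyMeasurable)
    rw [h.map_eq] at h2
    exact h2.symm.le

/-- Relabelling of the particles as an operator on `L¹`. -/
def permL (σ : Equiv.Perm (Fin N)) :
    ((Fin N → ℝ) →₁[volume] ℝ) →L[ℝ] ((Fin N → ℝ) →₁[volume] ℝ) := (isL1Op_perm σ).toCLM

lemma coeFn_permL (σ : Equiv.Perm (Fin N)) (F : (Fin N → ℝ) →₁[volume] ℝ) :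
    permL σ F =ᵐ[volume] fun v => F fun i => v (σ i) := IsL1Op.coeFn_toCLM _ F

lemma collide_comp_perm (σ : Equiv.Perm (Fin N)) (v : Fin N → ℝ) {i j : Fin N} (h : i ≠ j)
    (θ : ℝ) : (fun k => collide v (σ i) (σ j) θ (σ k)) = collide (fun k => v (σ k)) i j θ := by
  ext k
  rw [collide_apply _ h, collide_apply _ (σ.injective.ne h)]
  simp only [σ.injective.eq_iff]

lemma pairL_permL (σ : Equiv.Perm (Fin N)) (i j : Fin N) (F : (Fin N → ℝ) →₁[volume] ℝ) :
    pairL (σ i) (σ j) (permL σ F) = permL σ (pairL i j F) := by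
  by_cases h : i = j
  · simp [h, pairL]
  refine Lp.ext ?_
  have h' := σ.injective.ne h
  filter_upwards [coeFn_pairL h' (permL σ F), (isFlow_collide h').avg_congr (coeFn_permL σ F),
    coeFn_permL σ (pairL i j F),
    (measurePreserving_comp_perm σ).quasiMeasurePreserving.ae (coeFn_pairL h F)] with v h1 h2 h3 h4
  rw [h1, h2, h3, h4]
  simp only [avg, collide_comp_perm σ v h]

lemma thermL_permL {β : ℝ} (hβ : 0 < β) (σ : Equiv.Perm (Fin N)) (j : Fin N)
    (F : (Fin N → ℝ) →₁[volume] ℝ) : thermL hβ (σ j) (permL σ F) = permL σ (thermL hβ j F) := by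
  refine Lp.ext ?_
  have h0 := coll_congr (isFlow_kick (σ j)) (L1.integrable_coeFn (permL σ F)) (integrable_gauss hβ)
    (coeFn_permL σ F) (ae_eq_refl (gauss β))
  filter_upwards [coeFn_thermL hβ (σ j) (permL σ F), h0, coeFn_permL σ (thermL hβ j F),
    (measurePreserving_comp_perm σ).quasiMeasurePreserving.ae (coeFn_thermL hβ j F)]
    with v h1 h2 h3 h4
  rw [h1, thermR_eq_coll, h2, h3, h4, thermR_eq_coll]
  have e : ∀ θ w, (fun i => thermalize v (σ j) θ w (σ i)) = thermalize (fun i => v (σ i)) j θ w := by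
    intro θ w
    ext i
    simp [thermalize, Function.update_apply, σ.injective.eq_iff]
  simp only [coll, marg, avg, tensor, kick, e]

lemma two_nsmul_sum_Ioi {M : Type*} [AddCommMonoid M] (X : Fin N → Fin N → M)
    (hX : ∀ i j, X i j = X j i) (h0 : ∀ i, X i i = 0) :
    2 • ∑ i, ∑ j ∈ Finset.Ioi i, X i j = ∑ i, ∑ j, X i j := by
  have h1 : ∀ i, ∑ j ∈ Finset.Ioi i, X i j = ∑ j, if i < j then X i j else 0 := by
    intro i
    rw [← Finset.sum_filter]
    congr 1
    ext j; simp
  have h2 : ∑ i, ∑ j, (if j < i then X i j else 0) = ∑ i, ∑ j, if i < j then X i j else 0 := by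
    rw [Finset.sum_comm]
    refine Finset.sum_congr rfl fun i _ => Finset.sum_congr rfl fun j _ => ?_
    rw [hX]
  simp only [h1]
  rw [two_nsmul]
  nth_rewrite 2 [← h2]
  simp only [← Finset.sum_add_distrib]
  refine Finset.sum_congr rfl fun i _ => Finset.sum_congr rfl fun j _ => ?_
  rcases lt_trichotomy i j with h | h | h
  · simp [h, h.not_gt]
  · simp [h, h0]
  · simp [h, h.not_gt]

/-- A permutation does not respect the range i < j, so the sum over pairs is first doubled to a sum
over all (i, j). This uses the symmetry of `pairL` and its vanishing on the diagonal. -/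
lemma masterL_permL {lam mu β : ℝ} (hβ : 0 < β) (σ : Equiv.Perm (Fin N))
    (F : (Fin N → ℝ) →₁[volume] ℝ) :
    masterL lam mu hβ N (permL σ F) = permL σ (masterL lam mu hβ N F) := by
  have h1 : ∀ G : (Fin N → ℝ) →₁[volume] ℝ, (2 : ℝ) • ∑ i, ∑ j ∈ Finset.Ioi i, pairL i j G
      = ∑ i : Fin N, ∑ j : Fin N, pairL i j G := by
    intro G
    rw [← two_nsmul_sum_Ioi (fun i j => pairL i j G) (fun i j => by rw [pairL_comm])
      (fun i => by simp [pairL]), ofNat_smul_eq_nsmul]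
  have h2 : ∑ i : Fin N, ∑ j : Fin N, pairL i j (permL σ F)
      = permL σ (∑ i : Fin N, ∑ j : Fin N, pairL i j F) := by
    simp only [map_sum, ← pairL_permL]
    rw [← Equiv.sum_comp σ]
    refine Finset.sum_congr rfl fun i _ => ?_
    rw [← Equiv.sum_comp σ]
  have h3 : ∑ i, ∑ j ∈ Finset.Ioi i, pairL i j (permL σ F)
      = permL σ (∑ i : Fin N, ∑ j ∈ Finset.Ioi i, pairL i j F) := by
    rw [← h1, ← h1, map_smul] at h2
    exact smul_right_injective _ two_ne_zero h2
  have h4 : ∑ j : Fin N, (permL σ F - thermL hβ j (permL σ F))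
      = permL σ (∑ j : Fin N, (F - thermL hβ j F)) := by
    simp only [map_sum, map_sub, ← thermL_permL]
    rw [← Equiv.sum_comp σ]
  rw [masterL_apply, masterL_apply, h3, h4]
  simp only [map_sub, map_neg, map_smul]

/-- The relabelled curve solves the same linear equation with the same initial value; uniqueness is
the case of zero quadratic part. -/
lemma IsMasterSolution.permL_eq {lam mu β : ℝ} (hβ : 0 < β)
    {f : ℝ → (Fin N → ℝ) →₁[volume] ℝ} (hf : IsMasterSolution lam mu β f)
    (hs : IsSymmetric (f 0)) (σ : Equiv.Perm (Fin N)) {t : ℝ} (ht : 0 ≤ t) :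
    permL σ (f t) = f t := by
  refine eq_of_quadratic_ode 0 (masterL lam mu hβ N) (u := fun t => permL σ (f t)) (v := f)
    (fun s hs => ?_) (fun s hs => ?_) (Lp.ext ((coeFn_permL σ (f 0)).trans (hs σ))) ht
  · have := (permL σ).hasFDerivAt.comp_hasDerivWithinAt s (hf.hasDerivWithinAt hβ s hs)
    refine this.congr_deriv ?_
    simp [masterL_permL]
  · simpa using hf.hasDerivWithinAt hβ s hs

end symmetry

/-! ### Collisions acting on test functions -/

section testFunctions

variable {N k : ℕ}

lemma continuous_thermalize (j : Fin N) :
    Continuous fun p : ((Fin N → ℝ) × ℝ) × ℝ => thermalize p.1.1 j p.2 p.1.2 := by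
  unfold thermalize; fun_prop

/-- The average of a test function over the collisions of particle `i` with another particle. -/
def kickTest (i : Fin k) (φ : (Fin k → ℝ) →ᵇ ℝ) : ((Fin k → ℝ) × ℝ) →ᵇ ℝ :=
  BoundedContinuousFunction.ofNormedAddCommGroup
    (fun p => ∫ θ, φ (thermalize p.1 i (-θ) p.2) ∂angleMeasure)
    (continuous_of_dominated (bound := fun _ => ‖φ‖)
      (fun p => (φ.continuous.comp ((continuous_thermalize i).comp
        (by fun_prop : Continuous fun θ : ℝ => (p, -θ)))).aestronglyMeasurable)
      (fun p => ae_of_all _ fun θ => φ.norm_coe_le_norm _) (integrable_const _)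
      (ae_of_all _ fun θ => φ.continuous.comp ((continuous_thermalize i).comp
        (by fun_prop : Continuous fun p : (Fin k → ℝ) × ℝ => (p, -θ)))))
    ‖φ‖ (fun p => by
      refine (norm_integral_le_of_norm_le_const (ae_of_all _ fun θ => φ.norm_coe_le_norm _)).trans ?_
      simp)

lemma kickTest_apply (i : Fin k) (φ : (Fin k → ℝ) →ᵇ ℝ) (p : (Fin k → ℝ) × ℝ) :
    kickTest i φ p = ∫ θ, φ (thermalize p.1 i (-θ) p.2) ∂angleMeasure := rfl

lemma norm_kickTest_le (i : Fin k) (φ : (Fin k → ℝ) →ᵇ ℝ) : ‖kickTest i φ‖ ≤ ‖φ‖ :=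
  BoundedContinuousFunction.norm_ofNormedAddCommGroup_le _ (norm_nonneg _) _

lemma norm_compContinuous_le {E F : Type*} [TopologicalSpace E] [TopologicalSpace F]
    (φ : E →ᵇ ℝ) (g : C(F, E)) : ‖φ.compContinuous g‖ ≤ ‖φ‖ :=
  (BoundedContinuousFunction.norm_le (norm_nonneg _)).2 fun _ => φ.norm_coe_le_norm _

/-- Splitting off the last coordinate. -/
def splitLast (k : ℕ) : C(Fin (k + 1) → ℝ, (Fin k → ℝ) × ℝ) :=
  ⟨fun y => (Fin.init y, y (Fin.last k)), by unfold Fin.init; fun_prop⟩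

/-- The test function on `k + 1` particles obtained from the collisions of particle `i`. -/
def collTest (i : Fin k) (φ : (Fin k → ℝ) →ᵇ ℝ) : (Fin (k + 1) → ℝ) →ᵇ ℝ :=
  (kickTest i φ).compContinuous (splitLast k)

/-- The adjoint of the thermostat operator. -/
def thermTest {β : ℝ} (hβ : 0 < β) (i : Fin k) (φ : (Fin k → ℝ) →ᵇ ℝ) : (Fin k → ℝ) →ᵇ ℝ :=
  BoundedContinuousFunction.ofNormedAddCommGroup
    (fun x => ∫ w, kickTest i φ (x, w) * gauss β w)
    (continuous_of_dominated (bound := fun w => ‖φ‖ * gauss β w)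
      (fun x => (((kickTest i φ).continuous.comp (Continuous.prodMk_right x)).mul
        (continuous_gauss β)).aestronglyMeasurable)
      (fun x => ae_of_all _ fun w => by
        rw [norm_mul, Real.norm_of_nonneg (gauss_nonneg β w)]
        exact mul_le_mul_of_nonneg_right (((kickTest i φ).norm_coe_le_norm _).trans
          (norm_kickTest_le i φ)) (gauss_nonneg β w))
      ((integrable_gauss hβ).const_mul _)
      (ae_of_all _ fun w => ((kickTest i φ).continuous.comp (Continuous.prodMk_left w)).mul
        continuous_const))
    ‖φ‖ (fun x => by
      refine (norm_integral_le_of_norm_le ((integrable_gauss hβ).const_mul ‖φ‖)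
        (ae_of_all _ fun w => ?_)).trans_eq ?_
      · rw [norm_mul, Real.norm_of_nonneg (gauss_nonneg β w)]
        exact mul_le_mul_of_nonneg_right (((kickTest i φ).norm_coe_le_norm _).trans
          (norm_kickTest_le i φ)) (gauss_nonneg β w)
      · rw [integral_const_mul, integral_gauss hβ, mul_one])

lemma thermTest_apply {β : ℝ} (hβ : 0 < β) (i : Fin k) (φ : (Fin k → ℝ) →ᵇ ℝ) (x : Fin k → ℝ) :
    thermTest hβ i φ x = ∫ w, kickTest i φ (x, w) * gauss β w := rfl

lemma norm_thermTest_le {β : ℝ} (hβ : 0 < β) (i : Fin k) (φ : (Fin k → ℝ) →ᵇ ℝ) :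
    ‖thermTest hβ i φ‖ ≤ ‖φ‖ :=
  BoundedContinuousFunction.norm_ofNormedAddCommGroup_le _ (norm_nonneg _) _

/-- Restriction to the first `k` particles. -/
def restr (h : k ≤ N) : C(Fin N → ℝ, Fin k → ℝ) :=
  ⟨fun v i => v (Fin.castLE h i), by fun_prop⟩

/-- A test function of the first `k` particles as a test function of all particles. -/
def lift (h : k ≤ N) (φ : (Fin k → ℝ) →ᵇ ℝ) : (Fin N → ℝ) →ᵇ ℝ := φ.compContinuous (restr h)

lemma lift_apply (h : k ≤ N) (φ : (Fin k → ℝ) →ᵇ ℝ) (v : Fin N → ℝ) :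
    lift h φ v = φ fun i => v (Fin.castLE h i) := rfl

/-- The test function on `k + 1` particles generated by the gain terms. -/
def gainTest (lam mu : ℝ) {β : ℝ} (hβ : 0 < β) (φ : (Fin k → ℝ) →ᵇ ℝ) :
    (Fin (k + 1) → ℝ) →ᵇ ℝ :=
  ∑ i : Fin k, ((2 * lam) • collTest i φ + mu • lift k.le_succ (thermTest hβ i φ))

/-- The constant coincides with the loss rate of the hierarchy. This balance is what allows the
comparison with a Yule process. -/
lemma norm_gainTest_le {lam mu β : ℝ} (hβ : 0 < β) (hlam : 0 ≤ lam) (hmu : 0 ≤ mu)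
    (φ : (Fin k → ℝ) →ᵇ ℝ) : ‖gainTest lam mu hβ φ‖ ≤ (2 * lam + mu) * k * ‖φ‖ := by
  have : ∀ i ∈ Finset.univ, ‖(2 * lam) • collTest i φ + mu • lift k.le_succ (thermTest hβ i φ)‖
      ≤ (2 * lam + mu) * ‖φ‖ := by
    intro i _
    refine (norm_add_le _ _).trans ?_
    rw [norm_smul, norm_smul, Real.norm_of_nonneg hmu,
      Real.norm_of_nonneg (by positivity : 0 ≤ 2 * lam), add_mul]
    gcongr
    · exact (norm_compContinuous_le _ _).trans (norm_kickTest_le i φ)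
    · exact (norm_compContinuous_le _ _).trans (norm_thermTest_le hβ i φ)
  refine (norm_sum_le_of_le _ this).trans_eq ?_
  simp; ring

end testFunctions

/-! ### The approximate hierarchy for the marginals -/

section hierarchy

variable {N k : ℕ} {F : (Fin N → ℝ) →₁[volume] ℝ} (φ : (Fin k → ℝ) →ᵇ ℝ)

lemma pair_pairL {i j : Fin N} (h : i ≠ j) (ψ : (Fin N → ℝ) →ᵇ ℝ) :
    pair ψ (pairL i j F)
      = ∫ v, (∫ θ, ψ (collide v i j (-θ)) ∂angleMeasure) * F v := by
  have h1 : pair ψ (pairL i j F) = ∫ v, ψ v * avg (fun θ v => collide v i j θ) F v := by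
    refine integral_congr_ae ?_
    filter_upwards [coeFn_pairL h F] with v hv
    rw [hv]
  rw [h1]
  exact (isFlow_collide h).integral_mul_avg (L1.integrable_coeFn F) ψ.continuous.measurable
    ψ.norm_coe_le_norm

lemma pair_thermL {β : ℝ} (hβ : 0 < β) (j : Fin N) (ψ : (Fin N → ℝ) →ᵇ ℝ) :
    pair ψ (thermL hβ j F) = pair (thermTest hβ j ψ) F := by
  have hF := L1.integrable_coeFn F
  have h1 : pair ψ (thermL hβ j F) = ∫ v, ψ v * coll (kick j) F (gauss β) v := by
    refine integral_congr_ae ?_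
    filter_upwards [coeFn_thermL hβ j F] with v hv
    rw [hv, thermR_eq_coll]
  rw [h1, integral_mul_coll (isFlow_kick j) hF (integrable_gauss hβ) ψ.continuous.measurable
    ψ.norm_coe_le_norm]
  have hi : Integrable (fun p : (Fin N → ℝ) × ℝ => kickTest j ψ p * (F p.1 * gauss β p.2)) :=
    (integrable_tensor hF (integrable_gauss hβ)).bdd_mul
      (kickTest j ψ).continuous.measurable.aestronglyMeasurable
      (ae_of_all _ fun p => (kickTest j ψ).norm_coe_le_norm p)
  refine (integral_prod _ hi).trans ?_
  rw [pair_apply]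
  congr 1
  ext v
  rw [thermTest_apply, ← integral_mul_const]
  congr 1
  ext w
  ring

lemma castLE_ne {h : k ≤ N} {i : Fin N} (hi : k ≤ i) (l : Fin k) : Fin.castLE h l ≠ i := by
  intro e
  have := congrArg Fin.val e
  simp at this
  omega

lemma pair_lift_pairL_of_le (h : k ≤ N) {i j : Fin N} (hij : i ≠ j) (hi : k ≤ i) (hj : k ≤ j) :
    pair (lift h φ) (pairL i j F) = pair (lift h φ) F := by
  rw [pair_pairL hij, pair_apply]
  congr 1
  ext v
  have : ∀ θ, lift h φ (collide v i j (-θ)) = lift h φ v := by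
    intro θ
    rw [lift_apply, lift_apply]
    congr 1
    ext l
    rw [collide_apply _ hij, if_neg (castLE_ne hi l), if_neg (castLE_ne hj l)]
  simp [this]

lemma pair_lift_thermL_of_le {β : ℝ} (hβ : 0 < β) (h : k ≤ N) {j : Fin N} (hj : k ≤ j) :
    pair (lift h φ) (thermL hβ j F) = pair (lift h φ) F := by
  rw [pair_thermL]
  congr 2
  ext v
  have : ∀ θ w, lift h φ (thermalize v j (-θ) w) = lift h φ v := by
    intro θ w
    rw [lift_apply, lift_apply]
    congr 1
    ext l
    rw [thermalize, Function.update_of_ne (castLE_ne hj l)]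
  rw [thermTest_apply]
  simp [kickTest_apply, this, integral_const_mul, integral_gauss hβ]

lemma pair_lift_thermL_castLE {β : ℝ} (hβ : 0 < β) (h : k ≤ N) (i : Fin k) :
    pair (lift h φ) (thermL hβ (Fin.castLE h i) F) = pair (lift h (thermTest hβ i φ)) F := by
  rw [pair_thermL]
  congr 2
  ext v
  have : ∀ θ w, lift h φ (thermalize v (Fin.castLE h i) (-θ) w)
      = φ (thermalize (fun l => v (Fin.castLE h l)) i (-θ) w) := by
    intro θ w
    rw [lift_apply]
    congr 1
    ext l
    simp [thermalize, Function.update_apply]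
  rw [thermTest_apply, lift_apply, thermTest_apply]
  simp only [kickTest_apply, this]

lemma pair_comp_perm {σ : Equiv.Perm (Fin N)} (hσ : permL σ F = F) (ψ : (Fin N → ℝ) → ℝ) :
    ∫ v, ψ (fun i => v (σ i)) * F v = ∫ v, ψ v * F v := by
  have h1 : ∫ v, ψ (fun i => v (σ i)) * F v
      = ∫ v : Fin N → ℝ, ψ (fun i => v (σ i)) * F (fun i => v (σ i)) := by
    refine integral_congr_ae ?_
    filter_upwards [coeFn_permL σ F] with v hv
    rw [← hv, hσ]
  rw [h1]
  have hm := measurePreserving_comp_perm σ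
  let e : (Fin N → ℝ) ≃ᵐ (Fin N → ℝ) := MeasurableEquiv.piCongrLeft (fun _ : Fin N => ℝ) σ.symm
  have he : (e : (Fin N → ℝ) → (Fin N → ℝ)) = fun v i => v (σ i) := by
    ext v i
    simp [e, MeasurableEquiv.piCongrLeft, Equiv.piCongrLeft]
  have := (he ▸ hm : MeasurePreserving e volume volume).integral_comp e.measurableEmbedding
    (fun v => ψ v * F v)
  rw [he] at this
  exact this

/-- After the collision is moved onto the test function, only the first `k` velocities and that of
`j` occur. Swapping `j` with the particle of index `k` fixes the former and, by symmetry of `F`,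
leaves the integral unchanged. -/
lemma pair_lift_pairL_castLE (h : k + 1 ≤ N) (i : Fin k) {j : Fin N} (hj : k ≤ j)
    (hF : ∀ σ, permL σ F = F) :
    pair (lift (k.le_succ.trans h) φ) (pairL (Fin.castLE (k.le_succ.trans h) i) j F)
      = pair (lift h (collTest i φ)) F := by
  set h' := k.le_succ.trans h
  have hij : Fin.castLE h' i ≠ j := castLE_ne hj i
  rw [pair_pairL hij]
  have h1 : ∀ v : Fin N → ℝ, ∫ θ, lift h' φ (collide v (Fin.castLE h' i) j (-θ)) ∂angleMeasure
      = kickTest i φ (fun l => v (Fin.castLE h' l), v j) := by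
    intro v
    rw [kickTest_apply]
    congr 1
    ext θ
    rw [lift_apply]
    congr 1
    ext l
    rw [collide_apply _ hij, if_neg (castLE_ne hj l)]
    simp [thermalize, Function.update_apply]
  simp only [h1]
  let m : Fin N := ⟨k, h⟩
  have h2 := pair_comp_perm (hF (Equiv.swap j m))
    (fun v => kickTest i φ (fun l => v (Fin.castLE h' l), v m))
  simp only [Equiv.swap_apply_right] at h2
  have h3 : ∀ l : Fin k, Equiv.swap j m (Fin.castLE h' l) = Fin.castLE h' l := fun l =>
    Equiv.swap_apply_of_ne_of_ne (castLE_ne hj l) (castLE_ne (le_refl k) l)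
  simp only [h3] at h2
  rw [h2]
  rfl

lemma sum_of_eq_zero {M : Type*} [AddCommMonoid M] (h : k ≤ N) (g : Fin N → M)
    (hg : ∀ i : Fin N, k ≤ i → g i = 0) : ∑ i, g i = ∑ i : Fin k, g (Fin.castLE h i) := by
  obtain ⟨m, rfl⟩ := Nat.exists_eq_add_of_le h
  rw [Fin.sum_univ_add]
  have : ∀ i : Fin m, g (Fin.natAdd k i) = 0 := fun i => hg _ (by simp)
  simp only [this, Finset.sum_const_zero, add_zero]
  rfl

/-- The first `k` particles obey the hierarchy up to an error of order `k² / N`. -/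
lemma hierarchy_error {lam mu β : ℝ} (hβ : 0 < β) (hlam : 0 ≤ lam)
    (hN : 2 ≤ N) (h : k + 1 ≤ N) (hF : ∀ σ, permL σ F = F) :
    |pair (lift (k.le_succ.trans h) φ) (masterL lam mu hβ N F)
      - (pair (lift h (gainTest lam mu hβ φ)) F
        - (2 * lam + mu) * k * pair (lift (k.le_succ.trans h) φ) F)|
      ≤ 12 * lam * k ^ 2 * (‖φ‖ * ‖F‖) / (N - 1) := by
  set h' := k.le_succ.trans h
  set M := ‖φ‖ * ‖F‖
  set ψ := lift h' φ
  have hM : 0 ≤ M := by positivity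
  have hN1 : (0 : ℝ) < N - 1 := by
    have : (2 : ℝ) ≤ N := by exact_mod_cast hN
    linarith
  have hψ : ∀ G : (Fin N → ℝ) →₁[volume] ℝ, ‖G‖ ≤ ‖F‖ → |pair ψ G| ≤ M := fun G hG =>
    (abs_pair_le ψ G).trans (mul_le_mul (norm_compContinuous_le _ _) hG (norm_nonneg _)
      (norm_nonneg _))
  set X : Fin N → Fin N → ℝ := fun i j => pair ψ (pairL i j F) - pair ψ F with hX_def
  set c : Fin k → ℝ := fun i => pair (lift h (collTest i φ)) F - pair ψ F with hc_def
  have hX : ∀ i j, |X i j| ≤ 2 * M := fun i j =>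
    (abs_sub _ _).trans (by linarith [hψ _ (norm_pairL_le i j F), hψ F le_rfl])
  have hc : ∀ i, |c i| ≤ 2 * M := by
    intro i
    refine (abs_sub _ _).trans ?_
    have h1 := abs_pair_le (lift h (collTest i φ)) F
    have h2 : ‖lift h (collTest i φ)‖ ≤ ‖φ‖ := (norm_compContinuous_le _ _).trans
      ((norm_compContinuous_le _ _).trans (norm_kickTest_le i φ))
    have h3 : ‖lift h (collTest i φ)‖ * ‖F‖ ≤ M := mul_le_mul_of_nonneg_right h2 (norm_nonneg _)
    linarith [hψ F le_rfl]
  -- Since j > i ≥ k, neither collision partner is seen by the test function.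
  have hrow0 : ∀ i : Fin N, k ≤ i → ∑ j ∈ Finset.Ioi i, X i j = 0 := by
    intro i hi
    refine Finset.sum_eq_zero fun j hj => ?_
    have hj' := Finset.mem_Ioi.1 hj
    have : k ≤ (j : ℕ) := hi.trans (Fin.lt_def.1 hj').le
    rw [hX_def]
    simp only
    rw [pair_lift_pairL_of_le φ h' hj'.ne hi this, sub_self]
  -- Row `i` has N - 1 - i entries. Those with j ≥ k equal `c i` exactly, the fewer than `k` others
  -- are each off by at most 4M, and the `i` entries missing from N - 1 cost at most 2M each: in
  -- total 6kM.
  have hrow : ∀ i : Fin k, |∑ j ∈ Finset.Ioi (Fin.castLE h' i), X (Fin.castLE h' i) j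
      - (N - 1) * c i| ≤ 6 * k * M := by
    intro i
    have e1 : ∑ j ∈ Finset.Ioi (Fin.castLE h' i), X (Fin.castLE h' i) j - (N - 1) * c i
        = ∑ j ∈ Finset.Ioi (Fin.castLE h' i), (X (Fin.castLE h' i) j - c i) - i * c i := by
      rw [Finset.sum_sub_distrib (X (Fin.castLE h' i)) fun _ => c i, Finset.sum_const,
        Fin.card_Ioi, nsmul_eq_mul]
      have : ((N - 1 - (Fin.castLE h' i : ℕ) : ℕ) : ℝ) = N - 1 - i := by
        have := i.2
        rw [Nat.sub_sub, Nat.cast_sub (by simp; omega)]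
        push_cast; simp; ring
      rw [this]; ring
    have e2 : |∑ j ∈ Finset.Ioi (Fin.castLE h' i), (X (Fin.castLE h' i) j - c i)|
        ≤ k * (4 * M) := by
      calc _ ≤ ∑ j ∈ Finset.Ioi (Fin.castLE h' i), |X (Fin.castLE h' i) j - c i| :=
            Finset.abs_sum_le_sum_abs _ _
        _ ≤ ∑ j ∈ Finset.Ioi (Fin.castLE h' i), if (j : ℕ) < k then 4 * M else 0 := by
            refine Finset.sum_le_sum fun j _ => ?_
            split_ifs with hj
            · refine (abs_sub _ _).trans ?_
              linarith [hX (Fin.castLE h' i) j, hc i]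
            · rw [hX_def, hc_def]
              simp only
              rw [pair_lift_pairL_castLE φ h i (not_lt.1 hj) hF, sub_self, abs_zero]
        _ ≤ ∑ j : Fin N, if (j : ℕ) < k then 4 * M else 0 :=
            Finset.sum_le_sum_of_subset_of_nonneg (Finset.subset_univ _) fun j _ _ => by
              split_ifs <;> positivity
        _ = k * (4 * M) := by
            rw [sum_of_eq_zero h' _ fun j hj => if_neg (not_lt.2 hj)]
            simp
    have e3 : |(i : ℝ) * c i| ≤ k * (2 * M) := by
      rw [abs_mul, abs_of_nonneg (Nat.cast_nonneg _)]
      have : (i : ℝ) ≤ k := by exact_mod_cast i.2.le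
      exact mul_le_mul this (hc i) (abs_nonneg _) (Nat.cast_nonneg _)
    rw [e1]
    refine (abs_sub _ _).trans ?_
    linarith
  -- The prefactor is λN divided by the number of pairs. The loss term is shared out equally among
  -- the pairs and is contained in `X`.
  have e1 : pair ψ (masterL lam mu hβ N F) = 2 * lam / (N - 1) *
      (∑ i : Fin k, ∑ j ∈ Finset.Ioi (Fin.castLE h' i), X (Fin.castLE h' i) j)
      + mu * ∑ i : Fin k, (pair (lift h' (thermTest hβ i φ)) F - pair ψ F) := by
    have f1 : ∑ i : Fin N, ∑ j ∈ Finset.Ioi i, pair ψ (pairL i j F)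
        = ∑ i : Fin N, ∑ j ∈ Finset.Ioi i, X i j + N.choose 2 * pair ψ F := by
      rw [← card_pairs, Nat.cast_sum, Finset.sum_mul, ← Finset.sum_add_distrib]
      refine Finset.sum_congr rfl fun i _ => ?_
      rw [hX_def]
      simp only
      rw [Finset.sum_sub_distrib, Finset.sum_const, nsmul_eq_mul]
      ring
    have f2 : ∑ j : Fin N, (pair ψ F - pair ψ (thermL hβ j F))
        = -∑ i : Fin k, (pair (lift h' (thermTest hβ i φ)) F - pair ψ F) := by
      rw [sum_of_eq_zero h' _ fun j hj => by
        rw [pair_lift_thermL_of_le φ hβ h' hj, sub_self], ← Finset.sum_neg_distrib]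
      refine Finset.sum_congr rfl fun i _ => ?_
      rw [pair_lift_thermL_castLE]; ring
    rw [masterL_apply]
    simp only [map_sub, map_neg, map_smul, map_sum, smul_eq_mul]
    rw [f1, f2, sum_of_eq_zero h' _ hrow0, Nat.cast_choose_two]
    have hN0 : (N : ℝ) ≠ 0 := by positivity
    field_simp
    ring
  have e2 : pair (lift h (gainTest lam mu hβ φ)) F - (2 * lam + mu) * k * pair ψ F
      = 2 * lam * (∑ i : Fin k, c i)
        + mu * ∑ i : Fin k, (pair (lift h' (thermTest hβ i φ)) F - pair ψ F) := by
    have f1 : lift h (gainTest lam mu hβ φ) = ∑ i : Fin k, ((2 * lam) • lift h (collTest i φ)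
        + mu • lift h' (thermTest hβ i φ)) := by
      ext v
      simp only [lift_apply, gainTest, BoundedContinuousFunction.sum_apply,
        BoundedContinuousFunction.coe_add, Pi.add_apply, BoundedContinuousFunction.coe_smul]
      rfl
    rw [f1, pair_sum]
    simp only [pair_add, pair_smul, hc_def, Finset.sum_sub_distrib, Finset.sum_add_distrib,
      Finset.sum_const, Finset.card_univ, Fintype.card_fin, nsmul_eq_mul, ← Finset.mul_sum]
    ring
  rw [e1, e2]
  have e3 : 2 * lam / (N - 1) *
      (∑ i : Fin k, ∑ j ∈ Finset.Ioi (Fin.castLE h' i), X (Fin.castLE h' i) j)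
      + mu * ∑ i : Fin k, (pair (lift h' (thermTest hβ i φ)) F - pair ψ F)
      - (2 * lam * (∑ i : Fin k, c i)
        + mu * ∑ i : Fin k, (pair (lift h' (thermTest hβ i φ)) F - pair ψ F))
      = 2 * lam / (N - 1) * ∑ i : Fin k,
        (∑ j ∈ Finset.Ioi (Fin.castLE h' i), X (Fin.castLE h' i) j - (N - 1) * c i) := by
    conv_rhs => rw [Finset.sum_sub_distrib, ← Finset.mul_sum]
    field_simp
    ring
  rw [e3, abs_mul, abs_of_nonneg (by positivity : 0 ≤ 2 * lam / (N - 1 : ℝ))]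
  calc _ ≤ 2 * lam / (N - 1) * (k * (6 * k * M)) := by
        gcongr
        refine (Finset.abs_sum_le_sum_abs _ _).trans ((Finset.sum_le_sum fun i _ => hrow i).trans_eq ?_)
        simp
    _ = _ := by ring

end hierarchy

/-! ### Tensor powers and the exact hierarchy -/

section tensorPower

variable {k : ℕ}

/-- The tensor product of functions of one variable. -/
def prodFun (Fs : Fin k → ℝ →₁[volume] ℝ) (x : Fin k → ℝ) : ℝ := ∏ j, Fs j (x j)

lemma integrable_prodFun (Fs : Fin k → ℝ →₁[volume] ℝ) : Integrable (prodFun Fs) :=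
  Integrable.fintype_prod fun j => L1.integrable_coeFn (Fs j)

lemma ae_coord (i : Fin k) {p : ℝ → Prop} (h : ∀ᵐ v, p v) : ∀ᵐ x : Fin k → ℝ, p (x i) :=
  (Measure.quasiMeasurePreserving_eval (fun _ : Fin k => (volume : Measure ℝ)) i).ae h

lemma prodFun_update [DecidableEq (Fin k)] (Fs : Fin k → ℝ →₁[volume] ℝ) (i : Fin k)
    (G : ℝ →₁[volume] ℝ) (x : Fin k → ℝ) :
    prodFun (Function.update Fs i G) x = G (x i) * ∏ j ∈ Finset.univ.erase i, Fs j (x j) := by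
  rw [prodFun, ← Finset.mul_prod_erase Finset.univ _ (Finset.mem_univ i), Function.update_self]
  congr 1
  refine Finset.prod_congr rfl fun j hj => ?_
  rw [Function.update_of_ne (Finset.ne_of_mem_erase hj)]

/-- The tensor product as a continuous multilinear map on `L¹`. -/
def tprodL (k : ℕ) : ContinuousMultilinearMap ℝ (fun _ : Fin k => ℝ →₁[volume] ℝ)
    ((Fin k → ℝ) →₁[volume] ℝ) :=
  MultilinearMap.mkContinuous
    { toFun := fun Fs => (integrable_prodFun Fs).toL1 _
      map_update_add' := fun Fs i x y => by
        rw [← Integrable.toL1_add, Integrable.toL1_eq_toL1_iff]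
        filter_upwards [ae_coord i (Lp.coeFn_add x y)] with v hv
        rw [Pi.add_apply, prodFun_update, prodFun_update, prodFun_update, hv, Pi.add_apply, add_mul]
      map_update_smul' := fun Fs i c x => by
        rw [← Integrable.toL1_smul', Integrable.toL1_eq_toL1_iff]
        filter_upwards [ae_coord i (Lp.coeFn_smul c x)] with v hv
        rw [Pi.smul_apply, prodFun_update, prodFun_update, hv, Pi.smul_apply, smul_eq_mul,
          smul_eq_mul, mul_assoc] }
    1 (fun Fs => by
      simp only [MultilinearMap.coe_mk]
      rw [L1.norm_of_fun_eq_integral_norm, one_mul]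
      simp only [prodFun, norm_prod, L1.norm_eq_integral_norm]
      exact (integral_fintype_prod_volume_eq_prod (fun j w => ‖Fs j w‖)).le)

lemma coeFn_tprodL (Fs : Fin k → ℝ →₁[volume] ℝ) : tprodL k Fs =ᵐ[volume] prodFun Fs :=
  Integrable.coeFn_toL1 (integrable_prodFun Fs)

lemma norm_tprodL_le (Fs : Fin k → ℝ →₁[volume] ℝ) : ‖tprodL k Fs‖ ≤ ∏ i, ‖Fs i‖ := by
  have h := (tprodL k).le_of_opNorm_le (C := 1) (MultilinearMap.mkContinuous_norm_le _ zero_le_one _) Fs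
  rwa [one_mul] at h

lemma pair_tprodL (φ : (Fin k → ℝ) →ᵇ ℝ) (Fs : Fin k → ℝ →₁[volume] ℝ) :
    pair φ (tprodL k Fs) = ∫ x, φ x * prodFun Fs x := by
  refine integral_congr_ae ?_
  filter_upwards [coeFn_tprodL Fs] with v hv
  rw [hv]

/-- The tensor power of an element of `L¹`. -/
def tpow (k : ℕ) (F : ℝ →₁[volume] ℝ) : (Fin k → ℝ) →₁[volume] ℝ := tprodL k fun _ => F

lemma norm_tpow_le {F : ℝ →₁[volume] ℝ} (hF : F ∈ densities ℝ) : ‖tpow k F‖ ≤ 1 := by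
  refine (norm_tprodL_le _).trans_eq ?_
  simp [norm_eq_one_of_mem_densities hF]

lemma hasDerivAt_tpow {F : ℝ → ℝ →₁[volume] ℝ} {D : ℝ →₁[volume] ℝ} {t : ℝ}
    (h : HasDerivAt F D t) : HasDerivAt (fun t => tpow k (F t))
      (∑ i, tprodL k (Function.update (fun _ => F t) i D)) t := by
  have h1 : HasDerivAt (fun t (_ : Fin k) => F t) (fun _ => D) t := hasDerivAt_pi.2 fun _ => h
  have h2 := ((tprodL k).hasFDerivAt (x := fun _ => F t)).comp_hasDerivAt t h1
  rwa [ContinuousMultilinearMap.linearDeriv_apply] at h2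

lemma measurePreserving_splitLast : MeasurePreserving (splitLast k) volume volume := by
  have h1 := volume_preserving_piFinSuccAbove (fun _ : Fin (k + 1) => ℝ) (Fin.last k)
  have h2 := (Measure.measurePreserving_swap (μ := (volume : Measure ℝ))
    (ν := (volume : Measure (Fin k → ℝ)))).comp h1
  have e : (splitLast k : (Fin (k + 1) → ℝ) → (Fin k → ℝ) × ℝ)
      = Prod.swap ∘ MeasurableEquiv.piFinSuccAbove (fun _ : Fin (k + 1) => ℝ) (Fin.last k) := by
    funext y
    refine Prod.ext (funext fun i => ?_) rfl
    simp [splitLast, MeasurableEquiv.piFinSuccAbove, Fin.init]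
  rw [e]
  exact h2

lemma integral_comp_splitLast {f : (Fin k → ℝ) × ℝ → ℝ} (hf : Integrable f) :
    ∫ y, f (splitLast k y) = ∫ p, f p := by
  have h := measurePreserving_splitLast (k := k)
  have h2 := integral_map h.measurable.aemeasurable (f := f)
    (by rw [h.map_eq]; exact hf.aestronglyMeasurable)
  rw [h.map_eq] at h2
  exact h2.symm

lemma pair_tpow_succ (χ : ((Fin k → ℝ) × ℝ) →ᵇ ℝ) (F : ℝ →₁[volume] ℝ) :
    pair (χ.compContinuous (splitLast k)) (tpow (k + 1) F)
      = ∫ p, χ p * (prodFun (fun _ => F) p.1 * F p.2) := by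
  rw [tpow, pair_tprodL, ← integral_comp_splitLast]
  · simp only [prodFun, Fin.prod_univ_castSucc]
    rfl
  · exact ((integrable_prodFun _).mul_prod (L1.integrable_coeFn F)).bdd_mul
      χ.continuous.measurable.aestronglyMeasurable (ae_of_all _ χ.norm_coe_le_norm)

lemma pair_lift_tpow_succ (ψ : (Fin k → ℝ) →ᵇ ℝ) {F : ℝ →₁[volume] ℝ} (hF : mass F = 1) :
    pair (lift k.le_succ ψ) (tpow (k + 1) F) = pair ψ (tpow k F) := by
  have h := pair_tpow_succ (ψ.compContinuous ⟨Prod.fst, continuous_fst⟩) F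
  have e : (ψ.compContinuous ⟨Prod.fst, continuous_fst⟩ : (Fin k → ℝ) × ℝ →ᵇ ℝ).compContinuous
      (splitLast k) = lift k.le_succ ψ := rfl
  rw [e] at h
  rw [h, tpow, pair_tprodL]
  have h2 := integral_prod_mul (μ := (volume : Measure (Fin k → ℝ))) (ν := (volume : Measure ℝ))
    (fun x => ψ x * prodFun (fun _ => F) x) F
  rw [← mass_apply, hF, mul_one] at h2
  rw [← h2]
  congr 1
  ext p
  simp [mul_assoc]

/-- A collision of particle `i` with an independent particle alters only the i-th factor of a
product. This identifies the product-rule terms for a tensor power with the gain terms of the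
hierarchy. -/
lemma coll_kick_prodFun (i : Fin k) (F H : ℝ →₁[volume] ℝ) (x : Fin k → ℝ) :
    coll (kick i) (prodFun fun _ => F) H x
      = coll rot F H (x i) * ∏ j ∈ Finset.univ.erase i, F (x j) := by
  simp only [coll, marg, avg, tensor]
  rw [← integral_mul_const]
  congr 1
  ext w
  rw [← integral_mul_const]
  congr 1
  ext θ
  have : prodFun (fun _ => F) (kick i θ (x, w)).1
      = F (rot θ (x i, w)).1 * ∏ j ∈ Finset.univ.erase i, F (x j) := by
    rw [prodFun, ← Finset.mul_prod_erase Finset.univ _ (Finset.mem_univ i)]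
    simp only [kick, thermalize, Function.update_self, rot]
    congr 1
    refine Finset.prod_congr rfl fun j hj => ?_
    rw [Function.update_of_ne (Finset.ne_of_mem_erase hj)]
  rw [this]
  simp only [kick, rot]
  ring

lemma pair_tprodL_update_collL (φ : (Fin k → ℝ) →ᵇ ℝ) (i : Fin k) (F H : ℝ →₁[volume] ℝ) :
    pair φ (tprodL k (Function.update (fun _ => F) i (collL isFlow_rot F H)))
      = ∫ p, kickTest i φ p * (prodFun (fun _ => F) p.1 * H p.2) := by
  rw [pair_tprodL]
  have h1 : ∫ x, φ x * prodFun (Function.update (fun _ => F) i (collL isFlow_rot F H)) x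
      = ∫ x, φ x * coll (kick i) (prodFun fun _ => F) H x := by
    refine integral_congr_ae ?_
    filter_upwards [ae_coord i (coeFn_collL isFlow_rot F H)] with x hx
    rw [prodFun_update, hx, coll_kick_prodFun]
  rw [h1]
  exact integral_mul_coll (isFlow_kick i) (integrable_prodFun _) (L1.integrable_coeFn H)
    φ.continuous.measurable φ.norm_coe_le_norm

lemma pair_update_collL_self (φ : (Fin k → ℝ) →ᵇ ℝ) (i : Fin k) (F : ℝ →₁[volume] ℝ) :
    pair φ (tprodL k (Function.update (fun _ => F) i (collL isFlow_rot F F)))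
      = pair (collTest i φ) (tpow (k + 1) F) := by
  rw [pair_tprodL_update_collL, collTest, pair_tpow_succ]

lemma pair_update_collL_gaussL {β : ℝ} (hβ : 0 < β) (φ : (Fin k → ℝ) →ᵇ ℝ) (i : Fin k)
    (F : ℝ →₁[volume] ℝ) :
    pair φ (tprodL k (Function.update (fun _ => F) i (collL isFlow_rot F (gaussL hβ))))
      = pair (thermTest hβ i φ) (tpow k F) := by
  rw [pair_tprodL_update_collL, tpow, pair_tprodL]
  have hi : Integrable (fun p : (Fin k → ℝ) × ℝ =>
      kickTest i φ p * (prodFun (fun _ => F) p.1 * gaussL hβ p.2)) :=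
    ((integrable_prodFun _).mul_prod (L1.integrable_coeFn _)).bdd_mul
      (kickTest i φ).continuous.measurable.aestronglyMeasurable
      (ae_of_all _ (kickTest i φ).norm_coe_le_norm)
  refine (integral_prod _ hi).trans ?_
  congr 1
  ext x
  rw [thermTest_apply, ← integral_mul_const]
  refine integral_congr_ae ?_
  filter_upwards [coeFn_gaussL hβ] with w hw
  rw [hw]
  ring

/-- The tensor powers of a solution of the Boltzmann equation obey the limiting hierarchy. -/
lemma hasDerivAt_pair_tpow {lam mu β : ℝ} (hβ : 0 < β) (φ : (Fin k → ℝ) →ᵇ ℝ)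
    {F : ℝ → ℝ →₁[volume] ℝ} {t : ℝ} (hF : mass (F t) = 1)
    (h : HasDerivAt F (boltzQuad lam (F t) (F t) + boltzLin hβ mu (F t)) t) :
    HasDerivAt (fun t => pair φ (tpow k (F t)))
      (pair (gainTest lam mu hβ φ) (tpow (k + 1) (F t))
        - (2 * lam + mu) * k * pair φ (tpow k (F t))) t := by
  refine ((pair φ).hasFDerivAt.comp_hasDerivAt t (hasDerivAt_tpow h)).congr_deriv ?_
  rw [boltzOp_eq, hF, one_smul]
  have hself : ∀ i : Fin k, Function.update (fun _ => F t) i (F t) = fun _ => F t := fun i =>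
    Function.update_eq_self i _
  simp only [ContinuousMultilinearMap.map_update_add, ContinuousMultilinearMap.map_update_sub,
    ContinuousMultilinearMap.map_update_smul, hself, map_sum, map_add, map_sub, map_smul,
    pair_update_collL_self, pair_update_collL_gaussL, gainTest, pair_sum, pair_add, pair_smul,
    pair_lift_tpow_succ _ hF, smul_eq_mul]
  change ∑ i : Fin k, (2 * lam * (_ - pair φ (tpow k (F t))) + mu * (_ - pair φ (tpow k (F t)))) = _
  simp only [mul_sub, Finset.sum_add_distrib, Finset.sum_sub_distrib, Finset.sum_const,
    Finset.card_univ, Fintype.card_fin, nsmul_eq_mul]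
  ring

end tensorPower

/-! ### Vanishing of solutions of an asymptotic hierarchy -/

section hierarchyLimit

/-- Duhamel's inequality, by the integrating factor `exp (κ * t)`. Only the bound `g` has to be
continuous; nothing is asked of the derivative `d`. -/
lemma exp_mul_abs_le_of_deriv {κ : ℝ} {e d g : ℝ → ℝ} (hg : ContinuousOn g (Set.Ici 0))
    (he : ∀ s, 0 ≤ s → HasDerivWithinAt e (d s) (Set.Ici 0) s)
    (hd : ∀ s, 0 ≤ s → |d s + κ * e s| ≤ g s) {t : ℝ} (ht : 0 ≤ t) :
    exp (κ * t) * |e t| ≤ |e 0| + ∫ s in (0 : ℝ)..t, exp (κ * s) * g s := by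
  -- Extending `g` by its value at 0 makes the integral differentiable at every point, the endpoint
  -- included.
  have hgc : Continuous fun s => exp (κ * s) * g (max s 0) := by
    have h1 : Continuous fun s : ℝ => g (max s 0) :=
      hg.comp_continuous (by fun_prop) fun s => le_max_right s 0
    exact Continuous.mul (by fun_prop) h1
  have hexp : ∀ s, HasDerivAt (fun s => exp (κ * s)) (exp (κ * s) * κ) s := fun s => by
    have : HasDerivAt (fun s => κ * s) κ s := by simpa using (hasDerivAt_id s).const_mul κ
    exact this.exp
  have hder : ∀ s, 0 ≤ s → HasDerivWithinAt (fun s => exp (κ * s) * e s)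
      (exp (κ * s) * (d s + κ * e s)) (Set.Ici 0) s := fun s hs => by
    refine ((hexp s).hasDerivWithinAt.mul (he s hs)).congr_deriv ?_
    ring
  have h := image_norm_le_of_norm_deriv_right_le_deriv_boundary (a := 0) (b := t)
    (f := fun s => exp (κ * s) * e s) (f' := fun s => exp (κ * s) * (d s + κ * e s))
    (B := fun x => |e 0| + ∫ s in (0 : ℝ)..x, exp (κ * s) * g (max s 0))
    (B' := fun s => exp (κ * s) * g (max s 0))
    (fun s hs => ((hder s hs.1).continuousWithinAt).mono Set.Icc_subset_Ici_self)
    (fun s hs => (hder s hs.1).mono (Set.Ici_subset_Ici.2 hs.1)) (by simp)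
    (fun x => ((hgc.integral_hasStrictDerivAt 0 x).hasDerivAt).const_add _)
    (fun s hs => by
      rw [norm_mul, Real.norm_of_nonneg (Real.exp_pos _).le, max_eq_left hs.1]
      exact mul_le_mul_of_nonneg_left (hd s hs.1) (Real.exp_pos _).le) ⟨ht, le_rfl⟩
  rw [norm_mul, Real.norm_of_nonneg (Real.exp_pos _).le] at h
  refine h.trans_eq ?_
  congr 1
  refine intervalIntegral.integral_congr fun s hs => ?_
  rw [Set.uIcc_of_le ht] at hs
  simp only [max_eq_left hs.1]

/-- An auxiliary function, related to the generating function of the Yule process. -/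
def yule (α s τ : ℝ) : ℝ := s / (1 - s * (1 - exp (-(α * τ))))

/-- An upper bound for the probability that a Yule process started from `k` particles has at least
`n` births before time `τ`. -/
def yuleTail (α s : ℝ) (n k : ℕ) (τ : ℝ) : ℝ :=
  s⁻¹ ^ (n + k) * yule α s τ ^ k * exp (-(α * k * τ))

variable {α s T : ℝ}

lemma yule_denom_pos (hα : 0 ≤ α) (hs : 1 < s) (hsT : s * (1 - exp (-(α * T))) < 1) {τ : ℝ}
    (h1 : τ ≤ T) : 0 < 1 - s * (1 - exp (-(α * τ))) := by
  have : exp (-(α * T)) ≤ exp (-(α * τ)) := Real.exp_le_exp.2 (by nlinarith)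
  nlinarith

lemma hasDerivAt_yule (hα : 0 ≤ α) (hs : 1 < s) (hsT : s * (1 - exp (-(α * T))) < 1) {τ : ℝ}
    (h1 : τ ≤ T) : HasDerivAt (yule α s) (yule α s τ ^ 2 * (α * exp (-(α * τ)))) τ := by
  have hd := yule_denom_pos hα hs hsT h1
  have h2 : HasDerivAt (fun τ => 1 - s * (1 - exp (-(α * τ)))) (-(s * (α * exp (-(α * τ))))) τ := by
    refine ((((hasDerivAt_exp_neg_mul α τ).const_sub 1).const_mul s).const_sub 1).congr_deriv ?_
    ring
  refine ((hasDerivAt_const τ s).div h2 hd.ne').congr_deriv ?_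
  unfold yule
  field_simp
  ring

/-- With no births required, the Chernoff bound is the k-th power of q/(1 - s(1 - q)), where q =
e^(-ατ), and this ratio is at least one because s > 1. -/
lemma one_le_yuleTail_zero (hα : 0 ≤ α) (hs : 1 < s) (hsT : s * (1 - exp (-(α * T))) < 1)
    {τ : ℝ} (h0 : 0 ≤ τ) (h1 : τ ≤ T) (k : ℕ) : 1 ≤ yuleTail α s 0 k τ := by
  have hd := yule_denom_pos hα hs hsT h1
  have hs0 : s ≠ 0 := by positivity
  have e : yuleTail α s 0 k τ = (exp (-(α * τ)) / (1 - s * (1 - exp (-(α * τ))))) ^ k := by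
    have : exp (-(α * k * τ)) = exp (-(α * τ)) ^ k := by rw [← Real.exp_nat_mul]; ring_nf
    rw [yuleTail, this, zero_add, ← mul_pow, ← mul_pow, yule]
    field_simp
  rw [e]
  refine one_le_pow₀ ?_
  rw [le_div_iff₀ hd]
  have : exp (-(α * τ)) ≤ 1 := Real.exp_le_one_iff.2 (by nlinarith)
  nlinarith

lemma continuousOn_yuleTail (hα : 0 ≤ α) (hs : 1 < s) (hsT : s * (1 - exp (-(α * T))) < 1)
    (n k : ℕ) : ContinuousOn (yuleTail α s n k) (Set.Iic T) := by
  have h : ContinuousOn (yule α s) (Set.Iic T) := fun τ hτ =>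
    (hasDerivAt_yule hα hs hsT hτ).continuousAt.continuousWithinAt
  unfold yuleTail
  exact (continuousOn_const.mul (h.pow k)).mul (by fun_prop)

/-- The tail bounds reproduce themselves under one Duhamel step: `yule` solves y' = αe^(-ατ)y², so
the integrand is the derivative of s^(-(n+k+1))y^k, and the nonnegative value at time 0 is
discarded. -/
lemma integral_yuleTail_le (hα : 0 ≤ α) (hs : 1 < s) (hsT : s * (1 - exp (-(α * T))) < 1)
    {t : ℝ} (h0 : 0 ≤ t) (h1 : t ≤ T) (n k : ℕ) :
    ∫ τ in (0 : ℝ)..t, exp (α * k * τ) * (α * k * yuleTail α s n (k + 1) τ)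
      ≤ exp (α * k * t) * yuleTail α s (n + 1) k t := by
  have hle : ∀ τ ∈ Set.uIcc 0 t, τ ≤ T := fun τ hτ => by
    rw [Set.uIcc_of_le h0] at hτ; exact hτ.2.trans h1
  have hder : ∀ τ ∈ Set.uIcc 0 t, HasDerivAt (fun τ => s⁻¹ ^ (n + (k + 1)) * yule α s τ ^ k)
      (exp (α * k * τ) * (α * k * yuleTail α s n (k + 1) τ)) τ := by
    intro τ hτ
    refine (((hasDerivAt_yule hα hs hsT (hle τ hτ)).fun_pow k).const_mul _).congr_deriv ?_
    have e : exp (-(α * (k + 1 : ℕ) * τ)) = exp (-(α * τ)) * (exp (α * k * τ))⁻¹ := by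
      rw [← Real.exp_neg, ← Real.exp_add]; push_cast; ring_nf
    rw [yuleTail, e]
    have := (Real.exp_pos (α * k * τ)).ne'
    rcases k with _ | k
    · simp
    · field_simp
      simp only [Nat.add_sub_cancel]
      ring
  rw [intervalIntegral.integral_eq_sub_of_hasDerivAt hder]
  · have e : exp (α * k * t) * yuleTail α s (n + 1) k t = s⁻¹ ^ (n + (k + 1)) * yule α s t ^ k := by
      rw [yuleTail, Real.exp_neg, show n + 1 + k = n + (k + 1) by ring]
      have := (Real.exp_pos (α * k * t)).ne'
      field_simp
    rw [e]
    have h2 : 0 ≤ yule α s 0 := by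
      simp [yule]; linarith
    have : 0 ≤ s⁻¹ ^ (n + (k + 1)) * yule α s 0 ^ k := by positivity
    linarith
  · refine ContinuousOn.intervalIntegrable ?_
    have := (continuousOn_yuleTail hα hs hsT n (k + 1)).mono hle
    exact ContinuousOn.mul (by fun_prop) (continuousOn_const.mul this)

lemma yuleTail_tendsto (hs : 1 < s) (k : ℕ) (τ : ℝ) :
    Tendsto (fun n => yuleTail α s n k τ) atTop (𝓝 0) := by
  have h := (tendsto_pow_atTop_nhds_zero_of_lt_one (inv_nonneg.2 (zero_le_one.trans hs.le))
    (inv_lt_one_of_one_lt₀ hs)).mul_const (s⁻¹ ^ k * yule α s τ ^ k * exp (-(α * k * τ)))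
  rw [zero_mul] at h
  refine h.congr fun n => ?_
  rw [yuleTail, pow_add]; ring

/-- Solutions of an asymptotic hierarchy with vanishing initial values vanish in the limit. -/
theorem tendsto_zero_of_hierarchy {V : ℕ → Type*} [∀ k, SeminormedAddCommGroup (V k)] (hα : 0 ≤ α)
    (Γ : ∀ k, V k → V (k + 1)) (hΓ : ∀ k φ, ‖Γ k φ‖ ≤ α * k * ‖φ‖)
    (e : ℕ → ∀ k, V k → ℝ → ℝ) (η : ∀ k, V k → ℕ → ℝ)
    (hη : ∀ k φ, Tendsto (η k φ) atTop (𝓝 0))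
    (hc : ∀ N k φ, ContinuousOn (e N k φ) (Set.Ici 0))
    (hb : ∀ N k φ t, 0 ≤ t → |e N k φ t| ≤ 2 * ‖φ‖)
    (h0 : ∀ k, 1 ≤ k → ∀ φ, Tendsto (fun N => e N k φ 0) atTop (𝓝 0))
    (hd : ∀ k φ, ∀ᶠ N in atTop, ∃ d : ℝ → ℝ, ∀ t, 0 ≤ t →
      HasDerivWithinAt (e N k φ) (d t) (Set.Ici 0) t ∧
      |d t - (e N (k + 1) (Γ k φ) t - α * k * e N k φ t)| ≤ η k φ N)
    {k : ℕ} (hk : 1 ≤ k) (φ : V k) {t : ℝ} (ht : 0 ≤ t) :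
    Tendsto (fun N => e N k φ t) atTop (𝓝 0) := by
  -- With x = 1 - e^(-αt) < 1, the choice s = 2/(1 + x) gives s > 1 and sx < 1, so the Chernoff
  -- bound stays finite up to time t.
  obtain ⟨s, hs, hsT⟩ : ∃ s, 1 < s ∧ s * (1 - exp (-(α * t))) < 1 := by
    have h1 : exp (-(α * t)) ≤ 1 := Real.exp_le_one_iff.2 (by nlinarith)
    have h2 := Real.exp_pos (-(α * t))
    refine ⟨2 / (1 + (1 - exp (-(α * t)))), ?_, ?_⟩
    · rw [lt_div_iff₀ (by linarith)]; linarith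
    · rw [div_mul_eq_mul_div, div_lt_one (by linarith)]; linarith
  -- This says that the limsup in N of the error is at most 2‖φ‖ times the tail bound. Written
  -- through positive parts, it passes through the time integral by dominated convergence, with no
  -- uniformity in time required.
  have key : ∀ n k, 1 ≤ k → ∀ (φ : V k) (τ : ℝ), 0 ≤ τ → τ ≤ t →
      Tendsto (fun N => max (|e N k φ τ| - 2 * ‖φ‖ * yuleTail α s n k τ) 0) atTop (𝓝 0) := by
    intro n
    induction n with
    | zero =>
      intro k _ φ τ hτ0 hτ1
      have : ∀ N, max (|e N k φ τ| - 2 * ‖φ‖ * yuleTail α s 0 k τ) 0 = 0 := fun N => by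
        refine max_eq_right ?_
        have h1 := one_le_yuleTail_zero hα hs hsT hτ0 hτ1 k
        have h2 := hb N k φ τ hτ0
        have h3 := norm_nonneg φ
        nlinarith
      simp only [this]
      exact tendsto_const_nhds
    | succ n ih =>
      intro k hk φ τ hτ0 hτ1
      have hmem : ∀ x ∈ Set.uIcc 0 τ, 0 ≤ x ∧ x ≤ t := fun x hx => by
        rw [Set.uIcc_of_le hτ0] at hx; exact ⟨hx.1, hx.2.trans hτ1⟩
      set U : ℝ → ℝ := fun x => 2 * ‖Γ k φ‖ * yuleTail α s n (k + 1) x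
      set P : ℕ → ℝ → ℝ := fun N x => max (|e N (k + 1) (Γ k φ) x| - U x) 0
      have hUc : ContinuousOn U (Set.uIcc 0 τ) := continuousOn_const.mul
        ((continuousOn_yuleTail hα hs hsT n (k + 1)).mono fun x hx => (hmem x hx).2)
      have hPc : ∀ N, ContinuousOn (P N) (Set.uIcc 0 τ) := fun N =>
        ((((hc N (k + 1) (Γ k φ)).mono fun x hx => (hmem x hx).1).abs).sub hUc).sup
          continuousOn_const
      have hec : Continuous fun x => exp (α * k * x) := by fun_prop
      have hU0 : ∀ x ∈ Set.uIcc 0 τ, 0 ≤ U x := by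
        intro x hx
        have hd := yule_denom_pos hα hs hsT (hmem x hx).2
        have : 0 ≤ yule α s x := div_nonneg (by linarith) hd.le
        have hs0 : 0 < s := by linarith
        simp only [U, yuleTail]
        positivity
      have hlim : Tendsto (fun N => ∫ x in (0 : ℝ)..τ, exp (α * k * x) * P N x) atTop
          (𝓝 (∫ x in (0 : ℝ)..τ, (0 : ℝ))) := by
        refine intervalIntegral.tendsto_integral_filter_of_dominated_convergence
          (fun x => exp (α * k * x) * (2 * ‖Γ k φ‖)) ?_ ?_ ?_ ?_
        · refine Eventually.of_forall fun N => ?_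
          exact ((hec.continuousOn.mul (hPc N)).intervalIntegrable).def'.aestronglyMeasurable
        · refine Eventually.of_forall fun N => ae_of_all _ fun x hx => ?_
          have hx' := Set.uIoc_subset_uIcc hx
          rw [norm_mul, Real.norm_of_nonneg (Real.exp_pos _).le,
            Real.norm_of_nonneg (le_max_right _ _)]
          refine mul_le_mul_of_nonneg_left (max_le ?_ (by positivity)) (Real.exp_pos _).le
          linarith [hb N (k + 1) (Γ k φ) x (hmem x hx').1, hU0 x hx']
        · exact (Continuous.mul hec continuous_const).intervalIntegrable _ _
        · refine ae_of_all _ fun x hx => ?_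
          have hx' := hmem x (Set.uIoc_subset_uIcc hx)
          simpa using (ih (k + 1) (by omega) (Γ k φ) x hx'.1 hx'.2).const_mul (exp (α * k * x))
      rw [intervalIntegral.integral_zero] at hlim
      have hη' := (hη k φ).mul_const (∫ x in (0 : ℝ)..τ, exp (α * k * x))
      have htot := ((((h0 k hk φ).abs.add hlim).add hη').const_mul (exp (α * k * τ))⁻¹)
      simp only [abs_zero, zero_mul, add_zero, mul_zero] at htot
      refine squeeze_zero' (Eventually.of_forall fun N => le_max_right _ _) ?_ htot
      filter_upwards [hd k φ] with N hN
      obtain ⟨d, hd⟩ := hN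
      have hη0 : 0 ≤ η k φ N := (abs_nonneg _).trans (hd 0 le_rfl).2
      have hduh := exp_mul_abs_le_of_deriv (κ := α * k) (e := e N k φ) (d := d)
        (g := fun x => |e N (k + 1) (Γ k φ) x| + η k φ N)
        ((hc N (k + 1) (Γ k φ)).abs.add continuousOn_const) (fun x hx => (hd x hx).1)
        (fun x hx => by
          have h1 := (hd x hx).2
          have h2 : d x + α * k * e N k φ x = (d x - (e N (k + 1) (Γ k φ) x - α * k * e N k φ x))
            + e N (k + 1) (Γ k φ) x := by ring
          rw [h2]
          refine (abs_add_le _ _).trans ?_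
          linarith) hτ0
      have i1 : IntervalIntegrable (fun x => exp (α * k * x) * U x) volume 0 τ :=
        (hec.continuousOn.mul hUc).intervalIntegrable
      have i2 : IntervalIntegrable (fun x => exp (α * k * x) * P N x) volume 0 τ :=
        (hec.continuousOn.mul (hPc N)).intervalIntegrable
      have i3 : IntervalIntegrable (fun x => exp (α * k * x) * η k φ N) volume 0 τ :=
        (Continuous.mul hec continuous_const).intervalIntegrable _ _
      have hI : ∫ x in (0 : ℝ)..τ, exp (α * k * x) * (|e N (k + 1) (Γ k φ) x| + η k φ N)
          ≤ (∫ x in (0 : ℝ)..τ, exp (α * k * x) * U x)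
            + (∫ x in (0 : ℝ)..τ, exp (α * k * x) * P N x)
            + η k φ N * ∫ x in (0 : ℝ)..τ, exp (α * k * x) := by
        rw [mul_comm (η k φ N), ← intervalIntegral.integral_mul_const,
          ← intervalIntegral.integral_add i1 i2, ← intervalIntegral.integral_add (i1.add i2) i3]
        refine intervalIntegral.integral_mono_on hτ0 ?_ ((i1.add i2).add i3) fun x hx => ?_
        · refine ContinuousOn.intervalIntegrable (hec.continuousOn.mul ?_)
          exact (((hc N (k + 1) (Γ k φ)).mono fun x hx => (hmem x hx).1).abs).add continuousOn_const
        · rw [← mul_add, ← mul_add]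
          refine mul_le_mul_of_nonneg_left ?_ (Real.exp_pos _).le
          have : |e N (k + 1) (Γ k φ) x| - U x ≤ P N x := le_max_left _ _
          linarith
      have hU : ∫ x in (0 : ℝ)..τ, exp (α * k * x) * U x
          ≤ exp (α * k * τ) * (2 * ‖φ‖ * yuleTail α s (n + 1) k τ) := by
        have h1 := integral_yuleTail_le hα hs hsT hτ0 hτ1 n k
        have h2 : ∫ x in (0 : ℝ)..τ, exp (α * k * x) * U x ≤ ∫ x in (0 : ℝ)..τ,
            2 * ‖φ‖ * (exp (α * k * x) * (α * k * yuleTail α s n (k + 1) x)) := by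
          refine intervalIntegral.integral_mono_on hτ0 i1 ?_ fun x hx => ?_
          · refine ContinuousOn.intervalIntegrable (continuousOn_const.mul
              (hec.continuousOn.mul (continuousOn_const.mul ?_)))
            exact (continuousOn_yuleTail hα hs hsT n (k + 1)).mono fun x hx => (hmem x hx).2
          · have hx' : x ∈ Set.uIcc 0 τ := by rwa [Set.uIcc_of_le hτ0]
            have hd := yule_denom_pos hα hs hsT (hmem x hx').2
            have : 0 ≤ yule α s x := div_nonneg (by linarith) hd.le
            have hs0 : 0 < s := by linarith
            have hy : 0 ≤ yuleTail α s n (k + 1) x := by unfold yuleTail; positivity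
            calc exp (α * k * x) * (2 * ‖Γ k φ‖ * yuleTail α s n (k + 1) x)
                ≤ exp (α * k * x) * (2 * (α * k * ‖φ‖) * yuleTail α s n (k + 1) x) := by
                  gcongr; exact hΓ k φ
              _ = _ := by ring
        rw [intervalIntegral.integral_const_mul] at h2
        have h3 : 0 ≤ 2 * ‖φ‖ := by positivity
        nlinarith
      have hexp := Real.exp_pos (α * k * τ)
      refine max_le ?_ ?_
      · rw [← div_eq_inv_mul, le_div_iff₀ hexp]
        nlinarith
      · refine mul_nonneg (inv_nonneg.2 hexp.le) (add_nonneg (add_nonneg (abs_nonneg _) ?_)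
          (mul_nonneg hη0 ?_))
        · exact intervalIntegral.integral_nonneg hτ0 fun x _ =>
            mul_nonneg (Real.exp_pos _).le (le_max_right _ _)
        · exact intervalIntegral.integral_nonneg hτ0 fun x _ => (Real.exp_pos _).le
  rw [Metric.tendsto_atTop']
  intro ε hε
  have htail := (yuleTail_tendsto (α := α) hs k t).const_mul (2 * ‖φ‖)
  rw [mul_zero] at htail
  -- The number of iterations is fixed first, from the decay of the tail; N is taken large only
  -- afterwards.
  obtain ⟨n, hn⟩ := (htail.eventually (gt_mem_nhds (half_pos hε))).exists
  have h1 := (key n k hk φ t ht le_rfl).eventually (gt_mem_nhds (half_pos hε))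
  obtain ⟨N₀, hN₀⟩ := eventually_atTop.1 h1
  refine ⟨N₀, fun N hN => ?_⟩
  have h2 := (le_max_left _ _).trans_lt (hN₀ N hN.le)
  rw [Real.dist_eq, sub_zero]
  linarith

end hierarchyLimit

/-! ### Marginals as pairings with lifted test functions -/

section marginals

variable {k N : ℕ}

/-- Concatenation of two configurations. -/
def glue (k N : ℕ) (p : (Fin k → ℝ) × (Fin (N - k) → ℝ)) : Fin N → ℝ :=
  fun i => if hi : i.1 < k then p.1 ⟨i.1, hi⟩ else p.2 ⟨i.1 - k, by omega⟩

lemma measurePreserving_glue (h : k ≤ N) : MeasurePreserving (glue k N) volume volume := by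
  let e : Fin k ⊕ Fin (N - k) ≃ Fin N := finSumFinEquiv.trans (finCongr (by omega))
  have h1 := (volume_measurePreserving_piCongrLeft (fun _ : Fin N => ℝ) e).comp
    (volume_measurePreserving_sumPiEquivProdPi_symm fun _ : Fin k ⊕ Fin (N - k) => ℝ)
  have h2 : glue k N = MeasurableEquiv.piCongrLeft (fun _ : Fin N => ℝ) e ∘
      (MeasurableEquiv.sumPiEquivProdPi fun _ : Fin k ⊕ Fin (N - k) => ℝ).symm := by
    funext p i
    obtain ⟨a, rfl⟩ := e.surjective i
    rw [Function.comp_apply, MeasurableEquiv.coe_piCongrLeft, Equiv.piCongrLeft_apply_apply]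
    cases a <;> simp [glue, e] <;> rfl
  rw [h2]
  exact h1

lemma integrable_comp_glue (h : k ≤ N) {f : (Fin N → ℝ) → ℝ} (hf : Integrable f) :
    Integrable fun p => f (glue k N p) :=
  (measurePreserving_glue h).integrable_comp_of_integrable hf

lemma integral_comp_glue (h : k ≤ N) {f : (Fin N → ℝ) → ℝ} (hf : Integrable f) :
    ∫ p, f (glue k N p) = ∫ v, f v := by
  have hm := measurePreserving_glue h
  have h2 := integral_map hm.measurable.aemeasurable (f := f)
    (by rw [hm.map_eq]; exact hf.aestronglyMeasurable)
  rw [hm.map_eq] at h2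
  exact h2.symm

lemma integrable_marginal (h : k ≤ N) {f : (Fin N → ℝ) → ℝ} (hf : Integrable f) :
    Integrable (marginal k f) :=
  (integrable_comp_glue h hf).integral_prod_left

lemma marginal_nonneg (h : k ≤ N) {f : (Fin N → ℝ) → ℝ} (hf : 0 ≤ᵐ[volume] f) :
    0 ≤ᵐ[volume] marginal k f := by
  have h1 := Measure.ae_ae_of_ae_prod ((measurePreserving_glue h).quasiMeasurePreserving.ae hf)
  filter_upwards [h1] with x hx
  exact integral_nonneg_of_ae hx

lemma integral_mul_marginal (h : k ≤ N) (φ : (Fin k → ℝ) →ᵇ ℝ) (F : (Fin N → ℝ) →₁[volume] ℝ) :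
    ∫ x, φ x * marginal k F x = pair (lift h φ) F := by
  have hi := integrable_bcf_mul (lift h φ) (L1.integrable_coeFn F)
  rw [pair_apply, ← integral_comp_glue h hi]
  refine Eq.trans ?_ (integral_prod _ (integrable_comp_glue h hi)).symm
  congr 1
  ext x
  rw [marginal, ← integral_const_mul]
  congr 1
  ext y
  have : (fun i => glue k N (x, y) (Fin.castLE h i)) = x := by
    funext i
    simp [glue]
  rw [lift_apply, this]
  rfl

lemma measurePreserving_const_fin_one :
    MeasurePreserving (fun (v : ℝ) (_ : Fin 1) => v) volume volume := by
  have h := (measurePreserving_piUnique fun _ : Fin 1 => (volume : Measure ℝ)).symm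
  rw [volume_pi]
  convert h using 1 <;> rfl

lemma integral_fin_one (g : (Fin 1 → ℝ) → ℝ) : ∫ v : ℝ, g (fun _ => v) = ∫ x, g x := by
  have h := measurePreserving_const_fin_one.map_eq
  have he : MeasurableEmbedding (fun (v : ℝ) (_ : Fin 1) => v) :=
    (MeasurableEquiv.funUnique (Fin 1) ℝ).symm.measurableEmbedding
  rw [← h, he.integral_map]

lemma integrable_marginalOne (h : 1 ≤ N) {f : (Fin N → ℝ) → ℝ} (hf : Integrable f) :
    Integrable (marginalOne f) :=
  measurePreserving_const_fin_one.integrable_comp_of_integrable (integrable_marginal h hf)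

lemma marginalOne_nonneg (h : 1 ≤ N) {f : (Fin N → ℝ) → ℝ} (hf : 0 ≤ᵐ[volume] f) :
    0 ≤ᵐ[volume] marginalOne f :=
  measurePreserving_const_fin_one.quasiMeasurePreserving.ae (marginal_nonneg h hf)

/-- A test function of one velocity as a test function on one-particle configurations. -/
def oneTest (φ : ℝ →ᵇ ℝ) : (Fin 1 → ℝ) →ᵇ ℝ :=
  φ.compContinuous ⟨fun x => x 0, continuous_apply 0⟩

lemma integral_mul_marginalOne (h : 1 ≤ N) (φ : ℝ →ᵇ ℝ) (F : (Fin N → ℝ) →₁[volume] ℝ) :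
    ∫ v, φ v * marginalOne F v = pair (lift h (oneTest φ)) F := by
  rw [← integral_mul_marginal h, ← integral_fin_one]
  rfl

lemma pair_oneTest_tpow (φ : ℝ →ᵇ ℝ) (F : ℝ →₁[volume] ℝ) :
    pair (oneTest φ) (tpow 1 F) = pair φ F := by
  rw [tpow, pair_tprodL, ← integral_fin_one]
  simp [prodFun, oneTest, pair_apply]

lemma marginalOne_isProbDensity (h : 1 ≤ N) {F : (Fin N → ℝ) →₁[volume] ℝ}
    (hF : IsProbDensity F) : IsProbDensity (marginalOne F) := by
  refine ⟨integrable_marginalOne h hF.1, marginalOne_nonneg h hF.2.1, ?_⟩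
  have h1 := integral_mul_marginalOne h (BoundedContinuousFunction.const ℝ 1) F
  rw [pair_apply] at h1
  simpa [lift_apply, oneTest, hF.2.2] using h1

lemma toL1_mem_densities {E : Type*} [MeasureSpace E] [TopologicalSpace E] [BorelSpace E]
    {f : E → ℝ} (hf : IsProbDensity f) : hf.1.toL1 f ∈ densities E := by
  rw [mem_densities_iff]
  have h := hf.1.coeFn_toL1
  refine ⟨L1.integrable_coeFn _, ?_, (integral_congr_ae h).trans hf.2.2⟩
  filter_upwards [h, hf.2.1] with v h1 h2
  rw [h1]
  exact h2

end marginals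

/-! ### Weak limits of densities and of their tensor powers -/

section weakProducts

variable {E : Type*} [MeasureSpace E]

/-- The measure with density `F`. -/
def densMeasure (F : E →₁[volume] ℝ) : Measure E :=
  volume.withDensity fun v => ENNReal.ofReal (F v)

variable [TopologicalSpace E] [BorelSpace E]

lemma densMeasure_apply {F : E →₁[volume] ℝ} (hF : F ∈ densities E) {s : Set E}
    (hs : MeasurableSet s) : densMeasure F s = ENNReal.ofReal (∫ v in s, F v) := by
  rw [densMeasure, withDensity_apply _ hs, ofReal_integral_eq_lintegral_ofReal
    (L1.integrable_coeFn F).integrableOn (ae_restrict_of_ae ((Lp.coeFn_nonneg F).2 hF.1))]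

lemma isProbabilityMeasure_densMeasure {F : E →₁[volume] ℝ} (hF : F ∈ densities E) :
    IsProbabilityMeasure (densMeasure F) := by
  refine ⟨?_⟩
  rw [densMeasure_apply hF MeasurableSet.univ, setIntegral_univ, ← mass_apply, hF.2,
    ENNReal.ofReal_one]

lemma integral_densMeasure {F : E →₁[volume] ℝ} (hF : F ∈ densities E) (φ : E →ᵇ ℝ) :
    ∫ v, φ v ∂densMeasure F = pair φ F := by
  rw [densMeasure, integral_withDensity_eq_integral_toReal_smul₀
    (L1.integrable_coeFn F).aestronglyMeasurable.aemeasurable.ennreal_ofReal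
    (ae_of_all _ fun _ => ENNReal.ofReal_lt_top), pair_apply]
  refine integral_congr_ae ?_
  filter_upwards [(Lp.coeFn_nonneg F).2 hF.1] with v hv
  rw [ENNReal.toReal_ofReal hv, smul_eq_mul, mul_comm]

lemma tpow_mem_densities (k : ℕ) {F : ℝ →₁[volume] ℝ} (hF : F ∈ densities ℝ) :
    tpow k F ∈ densities (Fin k → ℝ) := by
  have h0 := (Lp.coeFn_nonneg F).2 hF.1
  rw [mem_densities_iff]
  refine ⟨L1.integrable_coeFn _, ?_, ?_⟩
  · filter_upwards [coeFn_tprodL fun _ : Fin k => F,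
      ae_all_iff.2 fun i : Fin k => ae_coord i h0] with x hx h1
    rw [tpow, hx]
    exact Finset.prod_nonneg fun j _ => h1 j
  · rw [tpow, integral_congr_ae (coeFn_tprodL _)]
    refine (integral_fintype_prod_volume_eq_prod fun (_ : Fin k) => (F : ℝ → ℝ)).trans ?_
    rw [← mass_apply, hF.2]
    simp

lemma pi_densMeasure (k : ℕ) {F : ℝ →₁[volume] ℝ} (hF : F ∈ densities ℝ) :
    Measure.pi (fun _ : Fin k => densMeasure F) = densMeasure (tpow k F) := by
  have := isProbabilityMeasure_densMeasure hF
  refine Measure.pi_eq fun s hs => ?_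
  have h0 := (Lp.coeFn_nonneg F).2 hF.1
  rw [densMeasure_apply (tpow_mem_densities k hF) (MeasurableSet.univ_pi hs)]
  simp only [densMeasure_apply hF (hs _)]
  rw [← ENNReal.ofReal_prod_of_nonneg fun i _ => setIntegral_nonneg_of_ae h0]
  congr 1
  rw [tpow, integral_congr_ae (ae_restrict_of_ae (coeFn_tprodL _)), volume_pi,
    Measure.restrict_pi_pi]
  exact integral_fintype_prod_eq_prod (𝕜 := ℝ) fun (_ : Fin k) => (F : ℝ → ℝ)

/-- Weak convergence of densities passes to tensor powers. -/
lemma tendsto_pair_tpow {P : ℕ → ℝ →₁[volume] ℝ} {P' : ℝ →₁[volume] ℝ}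
    (hP : ∀ n, P n ∈ densities ℝ) (hP' : P' ∈ densities ℝ)
    (h : ∀ φ : ℝ →ᵇ ℝ, Tendsto (fun n => pair φ (P n)) atTop (𝓝 (pair φ P')))
    (k : ℕ) (φ : (Fin k → ℝ) →ᵇ ℝ) :
    Tendsto (fun n => pair φ (tpow k (P n))) atTop (𝓝 (pair φ (tpow k P'))) := by
  let m : ℕ → ProbabilityMeasure ℝ := fun n =>
    ⟨densMeasure (P n), isProbabilityMeasure_densMeasure (hP n)⟩
  let m' : ProbabilityMeasure ℝ := ⟨densMeasure P', isProbabilityMeasure_densMeasure hP'⟩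
  have h1 : Tendsto m atTop (𝓝 m') := by
    rw [ProbabilityMeasure.tendsto_iff_forall_integral_tendsto]
    intro ψ
    have := h ψ
    simp only [← integral_densMeasure (hP _), ← integral_densMeasure hP'] at this
    exact this
  -- Test functions on k velocities need not be products; continuity of finite products of
  -- probability measures in the weak topology handles all of them.
  have h2 : Tendsto (fun n => ProbabilityMeasure.pi fun _ : Fin k => m n) atTop
      (𝓝 (ProbabilityMeasure.pi fun _ : Fin k => m')) :=
    (ProbabilityMeasure.continuous_pi.tendsto _).comp (tendsto_pi_nhds.2 fun _ => h1)
  have h3 := ProbabilityMeasure.tendsto_iff_forall_integral_tendsto.1 h2 φ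
  have e : ∀ {F : ℝ →₁[volume] ℝ}, F ∈ densities ℝ →
      ∫ x, φ x ∂(Measure.pi fun _ : Fin k => densMeasure F) = pair φ (tpow k F) := fun hF => by
    rw [pi_densMeasure k hF, integral_densMeasure (tpow_mem_densities k hF)]
  rw [← e hP']
  simp only [← e (hP _)]
  exact h3

/-- The weak limit of probability densities is a probability density. -/
lemma isProbDensity_of_tendsto {P : ℕ → ℝ → ℝ} {f : ℝ → ℝ} (hf : Integrable f)
    (hP : ∀ᶠ n in atTop, IsProbDensity (P n)) (h : WeakTendsto P f) : IsProbDensity f := by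
  refine ⟨hf, ?_, ?_⟩
  · have hle : ∀ φ : ℝ →ᵇ ℝ, 0 ≤ φ → 0 ≤ ∫ v, φ v * f v := fun φ hφ => by
      refine ge_of_tendsto (h φ) ?_
      filter_upwards [hP] with n hn
      refine integral_nonneg_of_ae ?_
      filter_upwards [hn.2.1] with v hv
      exact mul_nonneg (hφ v) hv
    refine ae_nonneg_of_forall_setIntegral_nonneg hf fun s hs _ => ?_
    refine le_of_forall_pos_le_add fun ε hε => ?_
    let ν : Measure ℝ := volume.withDensity fun v => ENNReal.ofReal |f v|
    have : IsFiniteMeasure ν := isFiniteMeasure_withDensity_ofReal hf.abs.2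
    -- The indicator of `s` is approximated in L¹ with respect to |f(v)| dv, which is exactly the
    -- error incurred in the integral against `f`.
    obtain ⟨φ, hφ, -⟩ := ((integrable_const (μ := ν) (1 : ℝ)).indicator
      hs).exists_boundedContinuous_integral_sub_le hε
    rw [integral_withDensity_eq_integral_toReal_smul₀ hf.abs.aemeasurable.ennreal_ofReal
      (ae_of_all _ fun _ => ENNReal.ofReal_lt_top)] at hφ
    -- Taking the positive part makes the test function admissible and does not increase its
    -- distance to an indicator.
    let ψ : ℝ →ᵇ ℝ := φ ⊔ 0
    have h1 := hle ψ le_sup_right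
    have hψ : Integrable fun v => ψ v * f v := integrable_bcf_mul ψ hf
    have hs' : Integrable (s.indicator f) := hf.indicator hs
    have hφ' : Integrable fun v =>
        (ENNReal.ofReal |f v|).toReal • ‖s.indicator (fun _ => (1 : ℝ)) v - φ v‖ := by
      have hi : Integrable fun v => |f v| * ‖s.indicator (fun _ => (1 : ℝ)) v - φ v‖ := by
        refine hf.abs.mul_bdd (c := 1 + ‖φ‖) ?_ (ae_of_all _ fun v => ?_)
        · exact (((measurable_const.indicator hs).sub φ.continuous.measurable).norm).aestronglyMeasurable
        · rw [norm_norm]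
          refine (norm_sub_le _ _).trans (add_le_add ?_ (φ.norm_coe_le_norm v))
          exact (norm_indicator_le_norm_self _ _).trans_eq norm_one
      refine hi.congr (ae_of_all _ fun v => ?_)
      dsimp only
      rw [ENNReal.toReal_ofReal (abs_nonneg _), smul_eq_mul]
    have h2 : ∫ v, (ψ v * f v - s.indicator f v) ≤ ε := by
      refine (integral_mono (hψ.sub hs') hφ' fun v => ?_).trans hφ
      have h3 : |s.indicator (fun _ => (1 : ℝ)) v - ψ v|
          ≤ |s.indicator (fun _ => (1 : ℝ)) v - φ v| := by
        have : ψ v = max (φ v) 0 := rfl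
        rw [this]
        by_cases hv : v ∈ s
        · simp only [Set.indicator_of_mem hv]
          rcases le_total (φ v) 0 with h | h
          · rw [max_eq_right h, sub_zero, abs_one, abs_of_nonneg] <;> linarith
          · rw [max_eq_left h]
        · simp only [Set.indicator_of_notMem hv]
          rcases le_total (φ v) 0 with h | h
          · rw [max_eq_right h, sub_zero, abs_zero]
            exact abs_nonneg _
          · rw [max_eq_left h]
      have h4 : ψ v * f v - s.indicator f v
          = f v * -(s.indicator (fun _ => (1 : ℝ)) v - ψ v) := by
        by_cases hv : v ∈ s
        · simp only [Set.indicator_of_mem hv]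
          ring
        · simp only [Set.indicator_of_notMem hv]
          ring
      change ψ v * f v - s.indicator f v ≤ _
      rw [h4, ENNReal.toReal_ofReal (abs_nonneg _), smul_eq_mul, Real.norm_eq_abs]
      refine (le_abs_self _).trans ?_
      rw [abs_mul, abs_neg]
      exact mul_le_mul_of_nonneg_left h3 (abs_nonneg _)
    rw [integral_sub hψ hs', integral_indicator hs] at h2
    linarith
  · have h1 := h (BoundedContinuousFunction.const ℝ 1)
    simp only [BoundedContinuousFunction.const_apply, one_mul] at h1
    refine tendsto_nhds_unique h1 (tendsto_const_nhds.congr' ?_)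
    filter_upwards [hP] with n hn
    exact hn.2.2.symm

end weakProducts

/-! ### Propagation of chaos -/

section propagation

variable {lam mu β : ℝ}

/-- The difference between the `k`-particle marginals and the tensor powers of the limit, tested
against `φ`. -/
def chaosError (f : ∀ N : ℕ, ℝ → (Fin N → ℝ) →₁[volume] ℝ) (F : ℝ → ℝ →₁[volume] ℝ) (N k : ℕ)
    (φ : (Fin k → ℝ) →ᵇ ℝ) (t : ℝ) : ℝ :=
  -- The default 0 keeps continuity and the uniform bound valid for all N and k, including those
  -- without a k-particle marginal.
  if h : 2 ≤ N ∧ k ≤ N then pair (lift h.2 φ) (f N t) - pair φ (tpow k (F t)) else 0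

/-- Under chaotic initial data, the error vanishes at time `0`. -/
lemma tendsto_chaosError_zero {f : ∀ N : ℕ, ℝ → (Fin N → ℝ) →₁[volume] ℝ}
    (hdens : ∀ N : ℕ, 2 ≤ N → IsProbDensity (f N 0)) (hchaos : IsChaotic fun N => f N 0)
    {F : ℝ → ℝ →₁[volume] ℝ} (hF : F 0 ∈ densities ℝ)
    (hlim : WeakTendsto (fun N => marginalOne (f N 0)) (F 0)) {k : ℕ} (hk : 1 ≤ k)
    (φ : (Fin k → ℝ) →ᵇ ℝ) : Tendsto (fun N => chaosError f F N k φ 0) atTop (𝓝 0) := by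
  obtain ⟨l, h1, h2⟩ := hchaos k hk φ
  -- The shift by two is needed because the initial values are known to be densities only for N ≥ 2.
  have hm : ∀ n, IsProbDensity (marginalOne (f (n + 2) 0)) := fun n =>
    marginalOne_isProbDensity (by omega) (hdens (n + 2) (by omega))
  have hpow := tendsto_pair_tpow (P := fun n => (hm n).1.toL1 _)
    (fun n => toL1_mem_densities (hm n)) hF (fun ψ => by
      refine ((tendsto_add_atTop_iff_nat 2).2 (hlim ψ)).congr fun n => ?_
      refine integral_congr_ae ?_
      filter_upwards [(hm n).1.coeFn_toL1] with v hv
      rw [hv]) k φ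
  -- Chaos supplies only a common limit; it is identified through the products of the one-particle
  -- marginals, whose weak limit is the tensor power.
  have hl : l = pair φ (tpow k (F 0)) := by
    refine tendsto_nhds_unique ((tendsto_add_atTop_iff_nat 2).2 h2) (hpow.congr fun n => ?_)
    rw [tpow, pair_tprodL]
    refine integral_congr_ae ?_
    filter_upwards [ae_all_iff.2 fun i : Fin k => ae_coord i (hm n).1.coeFn_toL1] with x hx
    simp only [prodFun, hx]
  have h3 := h1.sub_const (pair φ (tpow k (F 0)))
  rw [hl, sub_self] at h3
  refine h3.congr' ?_
  filter_upwards [eventually_ge_atTop 2, eventually_ge_atTop k] with N hN hkN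
  rw [chaosError, dif_pos ⟨hN, hkN⟩, integral_mul_marginal hkN]

/-- Propagation of chaos for the thermostated Kac master equation. -/
theorem tendsto_chaosError (hlam : 0 ≤ lam) (hmu : 0 ≤ mu) (hβ : 0 < β)
    {f : ∀ N : ℕ, ℝ → (Fin N → ℝ) →₁[volume] ℝ}
    (hdens : ∀ N : ℕ, 2 ≤ N → IsProbDensity (f N 0))
    (hsymm : ∀ N : ℕ, 2 ≤ N → IsSymmetric (f N 0))
    (hsol : ∀ N : ℕ, 2 ≤ N → IsMasterSolution lam mu β (f N))
    {F : ℝ → ℝ →₁[volume] ℝ} (hF : ∀ t, 0 ≤ t → F t ∈ densities ℝ)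
    (hd : ∀ t, 0 ≤ t → HasDerivAt F (boltzQuad lam (F t) (F t) + boltzLin hβ mu (F t)) t)
    (h0 : ∀ k, 1 ≤ k → ∀ φ : (Fin k → ℝ) →ᵇ ℝ,
      Tendsto (fun N => chaosError f F N k φ 0) atTop (𝓝 0))
    {k : ℕ} (hk : 1 ≤ k) (φ : (Fin k → ℝ) →ᵇ ℝ) {t : ℝ} (ht : 0 ≤ t) :
    Tendsto (fun N => chaosError f F N k φ t) atTop (𝓝 0) := by
  have hnorm : ∀ N, 2 ≤ N → ∀ t, 0 ≤ t → ‖f N t‖ ≤ 1 := fun N hN t ht =>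
    ((hsol N hN).norm_le hβ hlam hmu hN ht).trans_eq
      (norm_eq_one_of_mem_densities (mem_densities_iff.2 (hdens N hN)))
  have hderiv : ∀ N k (φ : (Fin k → ℝ) →ᵇ ℝ) (h : 2 ≤ N ∧ k ≤ N) t, 0 ≤ t →
      HasDerivWithinAt (chaosError f F N k φ)
        (pair (lift h.2 φ) (masterL lam mu hβ N (f N t))
          - (pair (gainTest lam mu hβ φ) (tpow (k + 1) (F t))
            - (2 * lam + mu) * k * pair φ (tpow k (F t)))) (Set.Ici 0) t := by
    intro N k φ h t ht
    have e : chaosError f F N k φ = fun t => pair (lift h.2 φ) (f N t) - pair φ (tpow k (F t)) :=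
      funext fun _ => dif_pos h
    rw [e]
    exact ((pair (lift h.2 φ)).hasFDerivAt.comp_hasDerivWithinAt t
      ((hsol N h.1).hasDerivWithinAt hβ t ht)).sub
      (hasDerivAt_pair_tpow hβ φ (hF t ht).2 (hd t ht)).hasDerivWithinAt
  refine tendsto_zero_of_hierarchy (V := fun k => (Fin k → ℝ) →ᵇ ℝ) (α := 2 * lam + mu)
    (by positivity)
    (fun _ => gainTest lam mu hβ) (fun _ => norm_gainTest_le hβ hlam hmu) (chaosError f F)
    (fun k φ N => 12 * lam * k ^ 2 * ‖φ‖ / (N - 1)) (fun k φ => ?_) (fun N k φ => ?_)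
    (fun N k φ t ht => ?_) h0 (fun k φ => ?_) hk φ ht
  · exact tendsto_const_nhds.div_atTop
      (tendsto_atTop_add_const_right _ (-1) tendsto_natCast_atTop_atTop)
  · by_cases h : 2 ≤ N ∧ k ≤ N
    · exact fun t ht => (hderiv N k φ h t ht).continuousWithinAt
    · have e : chaosError f F N k φ = fun _ => 0 := funext fun _ => dif_neg h
      rw [e]
      exact continuousOn_const
  · rw [chaosError]
    split_ifs with h
    · have h1 := (abs_pair_le (lift h.2 φ) (f N t)).trans
        (mul_le_mul (norm_compContinuous_le φ _) (hnorm N h.1 t ht) (norm_nonneg _)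
          (norm_nonneg _))
      have h2 := (abs_pair_le φ (tpow k (F t))).trans
        (mul_le_mul_of_nonneg_left (norm_tpow_le (hF t ht)) (norm_nonneg _))
      refine (abs_sub _ _).trans ?_
      linarith
    · rw [abs_zero]
      positivity
  · filter_upwards [eventually_ge_atTop 2, eventually_ge_atTop (k + 1)] with N hN hkN
    refine ⟨_, fun t ht => ⟨hderiv N k φ ⟨hN, k.le_succ.trans hkN⟩ t ht, ?_⟩⟩
    have h1 := hierarchy_error (mu := mu) (F := f N t) φ hβ hlam hN hkN
      fun σ => (hsol N hN).permL_eq hβ (hsymm N hN) σ ht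
    have e1 : chaosError f F N k φ t = _ := dif_pos ⟨hN, k.le_succ.trans hkN⟩
    have e2 : chaosError f F N (k + 1) (gainTest lam mu hβ φ) t = _ := dif_pos ⟨hN, hkN⟩
    have hN1 : (0 : ℝ) < N - 1 := by
      have : (2 : ℝ) ≤ N := by exact_mod_cast hN
      linarith
    rw [e1, e2]
    refine le_trans (le_of_eq ?_) (h1.trans ?_)
    · congr 1
      ring
    · have h2 := mul_le_mul_of_nonneg_left (hnorm N hN t ht) (norm_nonneg φ)
      rw [mul_one] at h2
      gcongr

end propagation

end KacThermostat

end
-- Convergence of the one-particle marginals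
theorem theorem3
    (lam mu β : ℝ) (hlam : 0 ≤ lam) (hmu : 0 ≤ mu) (hβ : 0 < β)
    (f : ∀ N : ℕ, ℝ → (Fin N → ℝ) →₁[volume] ℝ)
    (hdens : ∀ N : ℕ, 2 ≤ N → KacThermostat.IsProbDensity (f N 0))
    (hsymm : ∀ N : ℕ, 2 ≤ N → KacThermostat.IsSymmetric (f N 0))
    (hsol : ∀ N : ℕ, 2 ≤ N → KacThermostat.IsMasterSolution lam mu β (f N))
    (hchaos : KacThermostat.IsChaotic (fun N => f N 0))
    (f₀ : ℝ → ℝ) (hf₀ : Integrable f₀ volume)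
    (hlim : KacThermostat.WeakTendsto (fun N => KacThermostat.marginalOne (f N 0)) f₀) :
    ∃ F : ℝ → ℝ →₁[volume] ℝ,
      (∀ t : ℝ, 0 ≤ t →
        KacThermostat.IsProbDensity (F t) ∧
        KacThermostat.WeakTendsto (fun N => KacThermostat.marginalOne (f N t)) (F t)) ∧
      KacThermostat.IsBoltzmannSolution lam mu β f₀ F ∧
      (∃ fbar : ℝ → ℝ → ℝ, KacThermostat.IsPointwiseSolution lam mu β F fbar) ∧
      (∀ F' : ℝ → ℝ →₁[volume] ℝ, KacThermostat.IsBoltzmannSolution lam mu β f₀ F' →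
        ∀ t : ℝ, 0 ≤ t → F' t = F t) := by
  open KacThermostat in
  -- The limit is assumed only to be integrable, whereas the Wild sum must start from a probability
  -- density.
  have hp : IsProbDensity f₀ := isProbDensity_of_tendsto hf₀
    (eventually_atTop.2 ⟨2, fun N hN => marginalOne_isProbDensity (by omega) (hdens N hN)⟩) hlim
  have h₀ := toL1_mem_densities hp
  have hf := hp.1.coeFn_toL1
  set F₀ := hp.1.toL1 f₀
  have hsolF := isBoltzmannSolution_boltzSol hβ hlam hmu h₀
  have hF0 : boltzSol hβ lam mu F₀ 0 =ᵐ[volume] f₀ := hsolF.1.trans hf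
  have hsolF' : IsBoltzmannSolution lam mu β f₀ (boltzSol hβ lam mu F₀) := ⟨hF0, hsolF.2⟩
  have hmem : ∀ t, 0 ≤ t → boltzSol hβ lam mu F₀ t ∈ densities ℝ := fun _ ht =>
    boltzSol_mem hβ hlam hmu h₀ ht
  refine ⟨boltzSol hβ lam mu F₀, fun t ht => ⟨mem_densities_iff.1 (hmem t ht), fun φ => ?_⟩,
    hsolF', ⟨_, isPointwiseSolution_boltzPt hβ hlam hmu h₀⟩,
    fun F' hF' t ht => hF'.unique hβ hsolF' ht⟩
  have hlim' : WeakTendsto (fun N => marginalOne (f N 0)) (boltzSol hβ lam mu F₀ 0) := fun ψ => by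
    have e : ∫ v, ψ v * boltzSol hβ lam mu F₀ 0 v = ∫ v, ψ v * f₀ v := by
      refine integral_congr_ae ?_
      filter_upwards [hF0] with v hv
      rw [hv]
    rw [e]
    exact hlim ψ
  have h := tendsto_chaosError hlam hmu hβ hdens hsymm hsol hmem
    (fun _ ht => boltzSol_hasDerivAt hβ hlam hmu h₀ ht)
    (fun k hk ψ => tendsto_chaosError_zero hdens hchaos (hmem 0 le_rfl) hlim' hk ψ)
    le_rfl (oneTest φ) ht
  have h1 := h.add_const (pair φ (boltzSol hβ lam mu F₀ t))
  rw [zero_add] at h1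
  refine h1.congr' ?_
  filter_upwards [eventually_ge_atTop 2] with N hN
  have hN1 : 1 ≤ N := by omega
  rw [chaosError, dif_pos ⟨hN, hN1⟩, pair_oneTest_tpow, sub_add_cancel,
    integral_mul_marginalOne hN1]
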